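/- Let $X$ be an $n$-dimensional smooth (Hausdorff) Riemannian manifold with smooth metric $g$, $f:X\to\mathbb R$ a smooth function (for instance a Morse function), $V=\nabla f$, and $p$ a critical point of $f$. Let $\lambda_1,\dots,\lambda_n$ be the Morse eigenvalues of $p$, i.e. the eigenvalues (with multiplicity) of $g^{-1}\,\mathrm{Hess} f|_p$, ordered so that $\lambda_1,\dots,\lambda_k>0$ and $\lambda_{k+1},\dots,\lambda_n<0$. Assume the $\mathbb N$-linearity condition: $a_1\lambda_1+\dots+a_n\lambda_n\neq\lambda_i$ for all $i$ and all $(a_1,\dots,a_n)\in\mathbb N^n$ with $a_1+\dots+a_n\ge 2$. Write points of $\mathbb R^n$ as $(\mathbf x_k,\mathbf x_{n-k})\in\mathbb R^k\times\mathbb R^{n-k}$, let $V_0=\sum_i\lambda_i x_i\,\partial_{x_i}$, with flow $F_t(\mathbf x)_i=e^{\lambda_i t}x_i$, and let $G_t$ be the flow of $V$. The unstable (resp. stable) manifold of $p$ is the set of points $q$ such that $G_t(q)$ exists for all $t\le 0$ and tends to $p$ as $t\to-\infty$ (resp. exists for all $t\ge 0$ and tends to $p$ as $t\to+\infty$). Call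 a smooth local coordinate system $\Phi:\hat U\to X$ ($0\in\hat U\subset\mathbb R^n$ open, $\Phi$ a diffeomorphism onto an open set, $\Phi(0)=p$) *adapted* if in these coordinates $|V-V_0|(\mathbf x)=O(|\mathbf x|^N)$ as $\mathbf x\to0$ for every $N$ (written $O(|\mathbf x|^\infty)$), and if a point $\Phi(\mathbf x)$, $\mathbf x\in\hat U$, lies in the unstable manifold of $p$ exactly when $\mathbf x_{n-k}=0$, and in the stable manifold of $p$ exactly when $\mathbf x_k=0$. Then adapted coordinates exist. Moreover, for every adapted coordinate system $\Phi$, the following holds. Let $W^u$ be the set of points $\mathbf x_k\in\mathbb R^k$ with $(\mathbf x_k,0)\in\hat U$ whose backward $V$-flow line exists for all $t\le0$, stays in $\Phi(\hat U)$ and tends to $p$ as $t\to-\infty$; let $W^s\subset\mathbb R^{n-k}$ be defined in the same way by the points $(0,\mathbf x_{n-k})$ and forward flow lines. These are open neighbourhoods of $0$ in $\mathbb R^k$ and $\mathbb R^{n-k}$. In the coordinates $\Phi$ the limits $$\Psi_u=\lim_{T\to\infty}F_TG_{-T}\ \text{ on } W^u,\qquad \Psi_s=\lim_{T\to\infty}F_{-T}G_T\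 \text{ on } W^s$$ exist, with values in $\mathbb R^k\times\{0\}$ and $\{0\}\times\mathbb R^{n-k}$ respectively; $\Psi_u:W^u\to\mathbb R^k$ and $\Psi_s:W^s\to\mathbb R^{n-k}$ are smooth local diffeomorphisms (at every point), they fix $0$, the field $V$ is tangent to $W^u$ and to $W^s$, and $\Psi_u$, $\Psi_s$ carry $V$ to $V_0$: $$D\Psi_u\cdot V|_{W^u}=V_0\circ\Psi_u,\qquad D\Psi_s\cdot V|_{W^s}=V_0\circ\Psi_s.$$ Finally, there are open neighbourhoods $A\subset W^u$ and $B\subset W^s$ of the origins with $A\times B\subset\hat U$ such that $\Theta(\Psi_u(\mathbf x_k),\Psi_s(\mathbf x_{n-k}))=\Phi(\mathbf x_k,\mathbf x_{n-k})$ for $(\mathbf x_k,\mathbf x_{n-k})\in A\times B$ defines a smooth local coordinate system $\Theta$ on $\Psi_u(A)\times\Psi_s(B)$, centred at $p$, which is again adapted (in particular $|V-V_0|(\mathbf x)=O(|\mathbf x|^\infty)$), and in which $$V(\mathbf x_k,0)=V_0(\mathbf x_k,0),\qquad V(0,\mathbf x_{n-k})=V_0(0,\mathbf x_{n-k})$$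 for all points $(\mathbf x_k,0)$ and $(0,\mathbf x_{n-k})$ of its domain. -/

import Mathlib

open Set Filter Topology Asymptotics
open scoped Manifold ContDiff

/-! ### Gradient and Morse eigenvalues on a Riemannian manifold -/

section Riemannian

variable {n : ℕ} {X : Type*} [TopologicalSpace X] [ChartedSpace (EuclideanSpace ℝ (Fin n)) X]
  [IsManifold (𝓡 n) ∞ X]

/-- A smooth Riemannian metric on an `n`-dimensional manifold `X`. -/
abbrev SmoothMetric (n : ℕ) (X : Type*) [TopologicalSpace X]
    [ChartedSpace (EuclideanSpace ℝ (Fin n)) X] [IsManifold (𝓡 n) ∞ X] :=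
  Bundle.ContMDiffRiemannianMetric (𝓡 n) ∞ (EuclideanSpace ℝ (Fin n))
    (fun x : X => TangentSpace (𝓡 n) x)

/-- Lowering an index at `x`: `v ↦ g_x(v, ·)`. (In Mathlib, `TangentSpace (𝓡 n) x` is the model
space, the identification being given by the preferred chart at `x`.) -/
noncomputable def lowerIndex (g : SmoothMetric n X) (x : X) :
    EuclideanSpace ℝ (Fin n) →ₗ[ℝ] Module.Dual ℝ (EuclideanSpace ℝ (Fin n)) where
  toFun v := (g.inner x v : EuclideanSpace ℝ (Fin n) →L[ℝ] ℝ).toLinearMap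
  map_add' v w := by
    ext u
    exact congrArg (fun l : EuclideanSpace ℝ (Fin n) →L[ℝ] ℝ => l u) ((g.inner x).map_add v w)
  map_smul' c v := by
    ext u
    exact congrArg (fun l : EuclideanSpace ℝ (Fin n) →L[ℝ] ℝ => l u) ((g.inner x).map_smul c v)

theorem lowerIndex_injective (g : SmoothMetric n X) (x : X) :
    Function.Injective (lowerIndex g x) := by
  rw [injective_iff_map_eq_zero]
  intro v hv
  by_contra hne
  have h0 : g.inner x v v = 0 :=
    congrArg (fun l : Module.Dual ℝ (EuclideanSpace ℝ (Fin n)) => l v) hv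
  exact (g.pos x v hne).ne' h0

/-- Raising an index at `x`: the inverse of `v ↦ g_x(v, ·)`. -/
noncomputable def raiseIndex (g : SmoothMetric n X) (x : X) :
    Module.Dual ℝ (EuclideanSpace ℝ (Fin n)) ≃ₗ[ℝ] EuclideanSpace ℝ (Fin n) :=
  (LinearEquiv.ofInjectiveOfFinrankEq (lowerIndex g x) (lowerIndex_injective g x)
    Subspace.dual_finrank_eq.symm).symm

theorem lowerIndex_raiseIndex (g : SmoothMetric n X) (x : X)
    (l : Module.Dual ℝ (EuclideanSpace ℝ (Fin n))) : lowerIndex g x (raiseIndex g x l) = l :=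
  (LinearEquiv.ofInjectiveOfFinrankEq (lowerIndex g x) (lowerIndex_injective g x)
    Subspace.dual_finrank_eq.symm).apply_symm_apply l

/-- The Riemannian gradient `∇f`. -/
noncomputable def riemGradient (g : SmoothMetric n X) (f : X → ℝ) (x : X) :
    TangentSpace (𝓡 n) x :=
  raiseIndex g x (mfderiv (𝓡 n) 𝓘(ℝ, ℝ) f x : EuclideanSpace ℝ (Fin n) →L[ℝ] ℝ).toLinearMap

/-- The defining property of the gradient, `g(∇f, w) = df(w)`. -/
theorem inner_riemGradient (g : SmoothMetric n X) (f : X → ℝ) (x : X)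
    (w : TangentSpace (𝓡 n) x) :
    g.inner x (riemGradient g f x) w = mfderiv (𝓡 n) 𝓘(ℝ, ℝ) f x w :=
  congrArg (fun l : Module.Dual ℝ (EuclideanSpace ℝ (Fin n)) => l w)
    (lowerIndex_raiseIndex g x
      (mfderiv (𝓡 n) 𝓘(ℝ, ℝ) f x : EuclideanSpace ℝ (Fin n) →L[ℝ] ℝ).toLinearMap)

/-- The second derivative `∂ᵢ∂ⱼf(p)` in the preferred chart at `p`. At a critical point `p` of `f`
this is the Hessian `∇df(p)`, a bilinear form on the tangent space at `p`. -/
noncomputable def hessianForm (f : X → ℝ) (p : X) :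
    EuclideanSpace ℝ (Fin n) →L[ℝ] EuclideanSpace ℝ (Fin n) →L[ℝ] ℝ :=
  fderiv ℝ (fderiv ℝ (f ∘ (extChartAt (𝓡 n) p).symm)) (extChartAt (𝓡 n) p p)

/-- The endomorphism `g⁻¹ Hess f` of the tangent space at the critical point `p`. -/
noncomputable def hessianOperator (g : SmoothMetric n X) (f : X → ℝ) (p : X) :
    Module.End ℝ (EuclideanSpace ℝ (Fin n)) :=
  (raiseIndex g p).toLinearMap ∘ₗ
    ContinuousLinearMap.coeLM ℝ ∘ₗ (hessianForm f p).toLinearMap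

/-- `lam` lists the Morse eigenvalues of the critical point `p`, i.e. the eigenvalues of
`g⁻¹ Hess f` at `p`, with multiplicity. -/
def IsMorseEigenvalues (g : SmoothMetric n X) (f : X → ℝ) (p : X) (lam : Fin n → ℝ) : Prop :=
  (hessianOperator g f p).charpoly = ∏ i, (Polynomial.X - Polynomial.C (lam i))

/-- The unstable manifold of `p` for the flow of `V`: starting points of backward flow lines
that converge to `p`. -/
def unstableManifold (V : (x : X) → TangentSpace (𝓡 n) x) (p : X) : Set X :=
  {q | ∃ γ : ℝ → X, IsMIntegralCurveOn γ V (Iic 0) ∧ γ 0 = q ∧ Tendsto γ atBot (𝓝 p)}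

/-- The stable manifold of `p` for the flow of `V`: starting points of forward flow lines
that converge to `p`. -/
def stableManifold (V : (x : X) → TangentSpace (𝓡 n) x) (p : X) : Set X :=
  {q | ∃ γ : ℝ → X, IsMIntegralCurveOn γ V (Ici 0) ∧ γ 0 = q ∧ Tendsto γ atTop (𝓝 p)}

end Riemannian

/-- The `ℕ`-linearity condition. -/
def NLinearity {n : ℕ} (lam : Fin n → ℝ) : Prop :=
  ∀ a : Fin n → ℕ, 2 ≤ ∑ j, a j → ∀ i, ∑ j, (a j : ℝ) * lam j - lam i ≠ 0

/-! ### Coordinates `(x_k, x_{n-k}) ∈ ℝᵏ × ℝᵐ`, where `n = k + m` -/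

section Coordinates

variable {k m : ℕ}

/-- The coordinate space `ℝᵏ × ℝᵐ`. -/
abbrev Coord (k m : ℕ) : Type := EuclideanSpace ℝ (Fin k) × EuclideanSpace ℝ (Fin m)

/-- The first `k` components of the standard form: `x ↦ (λ₁x₁, …, λₖxₖ)`. -/
noncomputable def stdUnstable (lam : Fin (k + m) → ℝ) (x : EuclideanSpace ℝ (Fin k)) :
    EuclideanSpace ℝ (Fin k) :=
  WithLp.toLp 2 fun i => lam (Fin.castAdd m i) * x i

/-- The last `m` components of the standard form: `y ↦ (λₖ₊₁y₁, …, λₖ₊ₘyₘ)`. -/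
noncomputable def stdStable (lam : Fin (k + m) → ℝ) (y : EuclideanSpace ℝ (Fin m)) :
    EuclideanSpace ℝ (Fin m) :=
  WithLp.toLp 2 fun j => lam (Fin.natAdd k j) * y j

/-- The standard form `V₀ = ∑ᵢ λᵢ xᵢ ∂ᵢ`. -/
noncomputable def stdField (lam : Fin (k + m) → ℝ) (z : Coord k m) : Coord k m :=
  (stdUnstable lam z.1, stdStable lam z.2)

/-- The flow `F_t(x)ᵢ = e^{λᵢ t} xᵢ` of the standard form. -/
noncomputable def stdFlow (lam : Fin (k + m) → ℝ) (t : ℝ) (z : Coord k m) : Coord k m :=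
  (WithLp.toLp 2 fun i => Real.exp (lam (Fin.castAdd m i) * t) * z.1 i,
    WithLp.toLp 2 fun j => Real.exp (lam (Fin.natAdd k j) * t) * z.2 j)

variable {X : Type*} [TopologicalSpace X] [ChartedSpace (EuclideanSpace ℝ (Fin (k + m))) X]
  [IsManifold (𝓡 (k + m)) ∞ X]

/-- The expression of the vector field `V` in the local coordinates `Φ` (that is, `Φ^* V`). -/
noncomputable def coordField (V : (x : X) → TangentSpace (𝓡 (k + m)) x)
    (Φ : OpenPartialHomeomorph (Coord k m) X) (z : Coord k m) : Coord k m :=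
  VectorField.mpullback 𝓘(ℝ, Coord k m) (𝓡 (k + m)) Φ V z

/-- `Φ` is a smooth local coordinate system centred at `p` in which `V - V₀` is flat at `0` and the
unstable and stable manifolds of `p` are the coordinate planes `(x_k, 0)` and `(0, x_{n-k})`. -/
structure IsAdaptedChart (V : (x : X) → TangentSpace (𝓡 (k + m)) x) (p : X)
    (lam : Fin (k + m) → ℝ) (Φ : OpenPartialHomeomorph (Coord k m) X) : Prop where
  zero_mem : 0 ∈ Φ.source
  map_zero : Φ 0 = p
  smooth : ContMDiffOn 𝓘(ℝ, Coord k m) (𝓡 (k + m)) ∞ Φ Φ.source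
  smooth_symm : ContMDiffOn (𝓡 (k + m)) 𝓘(ℝ, Coord k m) ∞ Φ.symm Φ.target
  flat : ∀ N : ℕ, (fun z => coordField V Φ z - stdField lam z) =O[𝓝 0] fun z => ‖z‖ ^ N
  unstable : ∀ z ∈ Φ.source, Φ z ∈ unstableManifold V p ↔ z.2 = 0
  stable : ∀ z ∈ Φ.source, Φ z ∈ stableManifold V p ↔ z.1 = 0

/-- `γ(t) = G_t(z)`, `t ≤ 0`, is the backward flow line of `V` from the point with coordinates
`z`; it stays in the domain of the coordinates `Φ` and converges to `p`. -/
structure IsUnstableLine (V : (x : X) → TangentSpace (𝓡 (k + m)) x) (p : X)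
    (Φ : OpenPartialHomeomorph (Coord k m) X) (z : Coord k m) (γ : ℝ → X) : Prop where
  curve : IsMIntegralCurveOn γ V (Iic 0)
  start : γ 0 = Φ z
  mem : ∀ t ≤ 0, γ t ∈ Φ.target
  lim : Tendsto γ atBot (𝓝 p)

/-- `γ(t) = G_t(z)`, `t ≥ 0`, is the forward flow line of `V` from the point with coordinates
`z`; it stays in the domain of the coordinates `Φ` and converges to `p`. -/
structure IsStableLine (V : (x : X) → TangentSpace (𝓡 (k + m)) x) (p : X)
    (Φ : OpenPartialHomeomorph (Coord k m) X) (z : Coord k m) (γ : ℝ → X) : Prop where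
  curve : IsMIntegralCurveOn γ V (Ici 0)
  start : γ 0 = Φ z
  mem : ∀ t, 0 ≤ t → γ t ∈ Φ.target
  lim : Tendsto γ atTop (𝓝 p)

/-- The local unstable manifold `W^u` in the coordinates `Φ`, as a subset of `ℝᵏ ≅ ℝᵏ × 0`: the
points on which `F_T G_{-T}` makes sense in the coordinates for every `T ≥ 0`. -/
def localUnstable (V : (x : X) → TangentSpace (𝓡 (k + m)) x) (p : X)
    (Φ : OpenPartialHomeomorph (Coord k m) X) : Set (EuclideanSpace ℝ (Fin k)) :=
  {x | (x, 0) ∈ Φ.source ∧ ∃ γ, IsUnstableLine V p Φ (x, 0) γ}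

/-- The local stable manifold `W^s` in the coordinates `Φ`, as a subset of `ℝᵐ ≅ 0 × ℝᵐ`: the
points on which `F_{-T} G_T` makes sense in the coordinates for every `T ≥ 0`. -/
def localStable (V : (x : X) → TangentSpace (𝓡 (k + m)) x) (p : X)
    (Φ : OpenPartialHomeomorph (Coord k m) X) : Set (EuclideanSpace ℝ (Fin m)) :=
  {y | (0, y) ∈ Φ.source ∧ ∃ γ, IsStableLine V p Φ (0, y) γ}

/-- `Ψ_u = lim_{T → ∞} F_T G_{-T}` on `W^u`, in the coordinates `Φ`. -/
def IsConjugateUnstable (V : (x : X) → TangentSpace (𝓡 (k + m)) x) (p : X)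
    (lam : Fin (k + m) → ℝ) (Φ : OpenPartialHomeomorph (Coord k m) X)
    (Ψu : EuclideanSpace ℝ (Fin k) → EuclideanSpace ℝ (Fin k)) : Prop :=
  ∀ x ∈ localUnstable V p Φ, ∀ γ, IsUnstableLine V p Φ (x, 0) γ →
    Tendsto (fun T : ℝ => stdFlow lam T (Φ.symm (γ (-T)))) atTop (𝓝 (Ψu x, 0))

/-- `Ψ_s = lim_{T → ∞} F_{-T} G_T` on `W^s`, in the coordinates `Φ`. -/
def IsConjugateStable (V : (x : X) → TangentSpace (𝓡 (k + m)) x) (p : X)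
    (lam : Fin (k + m) → ℝ) (Φ : OpenPartialHomeomorph (Coord k m) X)
    (Ψs : EuclideanSpace ℝ (Fin m) → EuclideanSpace ℝ (Fin m)) : Prop :=
  ∀ y ∈ localStable V p Φ, ∀ γ, IsStableLine V p Φ (0, y) γ →
    Tendsto (fun T : ℝ => stdFlow lam (-T) (Φ.symm (γ T))) atTop (𝓝 (0, Ψs y))

end Coordinates

/-! ### Smooth calculus -/

section Calculus

/-! Formal part. The operator g⁻¹ Hess f is symmetric for g, so a linear change of chart makes the
linear part of V diagonal. By nonresonance each coordinate can be corrected, degree by degree, to a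
formal eigenfunction V P_i = λ_i P_i. Borel's lemma realizes these series by smooth functions, and
in the coordinates P the field is V₀ + h with h flat (`exists_formal_linearization`,
`exists_flat_coordinates`).

Analytic part. The core is `exists_asymptotic_parametrization`: solutions of x' = Λx + h(x) that
tend to 0 are built from their asymptotics at t = ∞. Put ρ = e^{-αt} and x = ρ w(ρ). Variation of
constants from infinity turns the equation into w = ℓ(η) + K N(w) on C([0,1]), where N(w)(ρ) =
ρ^{-M} h(ρ w(ρ)). Because h is flat, N is smooth and has zero derivative at w = 0, for every M;
taking M large makes the integral operator K bounded whatever the signs of the λ_i. The inverse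
function theorem in C([0,1]) then gives w depending smoothly on η. A time shift is a rescaling of ρ,
so uniqueness makes e(η) = w(1) intertwine the linear flow with the flow of V, and the normalization
at infinity is exactly the limit of e^{-Λt} e(e^{μt} η).

This result is used twice. With projections onto the contracting and the expanding directions (the
latter for -V) it gives maps E_s and E_u whose sum straightens both invariant manifolds while
keeping the remainder flat (`exists_straightening`). With the identity, on a plane where the field
contracts, it gives the local inverse of the limit defining Ψ; the flow then carries the local
diffeomorphism property to the whole basin (`exists_conjugation`). The unstable case is the stable
case of -V.

Global part. Membership in the stable manifold involves the whole flow line, which might leave the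
chart and come back. The gradient structure excludes this: near p the growth of |z|² along V is at
most a constant times g(V,V), the growth of f, so a line that starts close to p and ends at p cannot
leave a small ball (`gradient_line_stays`). Inside the ball the expanding component has
nondecreasing norm and tends to 0, so it vanishes.

Finally, in the coordinates (Ψ_u, Ψ_s) the defect V - V₀ is the image under the derivative of the
difference between V and the product of its restrictions to the two planes. That difference is flat
and vanishes on both planes (`exists_induced_coordinates`). -/

theorem exists_openPartialHomeomorph_of_contDiffOn {E F : Type*} [NormedAddCommGroup E]
    [NormedSpace ℝ E] [CompleteSpace E] [NormedAddCommGroup F] [NormedSpace ℝ F]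
    {f : E → F} {O : Set E} {a : E} (hO : IsOpen O) (ha : a ∈ O) (hf : ContDiffOn ℝ ∞ f O)
    {f' : E ≃L[ℝ] F} (hf' : HasFDerivAt f (f' : E →L[ℝ] F) a) :
    ∃ e : OpenPartialHomeomorph E F, a ∈ e.source ∧ e.source ⊆ O ∧ ⇑e = f ∧
      ContDiffOn ℝ ∞ e.symm e.target ∧
      ∀ x ∈ e.source, ∃ A : E ≃L[ℝ] F, HasFDerivAt f (A : E →L[ℝ] F) x := by
  have hfa : ContDiffAt ℝ ∞ f a := hf.contDiffAt (hO.mem_nhds ha)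
  have hopen : IsOpen (O ∩ fderiv ℝ f ⁻¹' range ((↑) : (E ≃L[ℝ] F) → E →L[ℝ] F)) :=
    (hf.continuousOn_fderiv_of_isOpen hO (by simp)).isOpen_inter_preimage hO
      ContinuousLinearEquiv.isOpen
  set O' := O ∩ fderiv ℝ f ⁻¹' range ((↑) : (E ≃L[ℝ] F) → E →L[ℝ] F)
  have ha' : a ∈ O' := ⟨ha, f', hf'.fderiv.symm⟩
  have hder : ∀ x ∈ O', ∃ A : E ≃L[ℝ] F, HasFDerivAt f (A : E →L[ℝ] F) x := by
    rintro x ⟨hx, A, hA⟩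
    refine ⟨A, ?_⟩
    rw [hA]
    exact ((hf.contDiffAt (hO.mem_nhds hx)).differentiableAt (by simp)).hasFDerivAt
  let e := (hfa.toOpenPartialHomeomorph f hf' (by simp)).restrOpen O' hopen
  have hsrc : e.source ⊆ O' := fun x hx => hx.2
  refine ⟨e, ⟨hfa.mem_toOpenPartialHomeomorph_source hf' (by simp), ha'⟩,
    fun x hx => (hsrc hx).1, rfl, ?_, fun x hx => hder x (hsrc hx)⟩
  intro y hy
  have hx := e.map_target hy
  obtain ⟨A, hA⟩ := hder _ (hsrc hx)
  exact (e.contDiffAt_symm hy hA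
    (hf.contDiffAt (hO.mem_nhds (hsrc hx).1))).contDiffWithinAt

/-- Flatness at the origin: vanishing to infinite order. -/
def IsFlat {E F : Type*} [NormedAddCommGroup E] [NormedAddCommGroup F] (h : E → F) : Prop :=
  ∀ N : ℕ, h =O[𝓝 0] fun x => ‖x‖ ^ N

theorem IsFlat.apply_zero {E F : Type*} [NormedAddCommGroup E] [NormedAddCommGroup F] {h : E → F}
    (hh : IsFlat h) : h 0 = 0 := by
  obtain ⟨C, hC⟩ := (hh 1).bound
  simpa using hC.self_of_nhds

/-- Since the derivative is Lipschitz near 0, a difference quotient with step s = |x|^N approximates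
it up to O(s), and the quotient itself is O(|x|^{2N}/s) = O(s). Half of the order is lost, which is
harmless for flat functions. -/
theorem fderiv_isBigO_of_isBigO {E F : Type*} [NormedAddCommGroup E] [NormedSpace ℝ E]
    [NormedAddCommGroup F] [NormedSpace ℝ F] {h : E → F} (hh : ContDiffAt ℝ 2 h 0) {N : ℕ}
    (hN : 1 ≤ N) (hO : h =O[𝓝 0] fun x => ‖x‖ ^ (2 * N)) :
    fderiv ℝ h =O[𝓝 0] fun x => ‖x‖ ^ N := by
  have h0 : fderiv ℝ h 0 = 0 := by
    have : HasFDerivAt h (0 : E →L[ℝ] F) 0 :=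
      IsBigO.hasFDerivAt (n := 2 * N) (by simpa using hO) (by omega)
    exact this.fderiv
  obtain ⟨K, t, ht, hK⟩ := (hh.fderiv_right (m := 1) (by norm_num)).exists_lipschitzOnWith
  obtain ⟨C, hCpos, hC⟩ := hO.exists_pos
  have hdiff : ∀ᶠ x in 𝓝 (0 : E), DifferentiableAt ℝ h x :=
    (hh.eventually (by simp)).mono fun x hx => hx.differentiableAt (by simp)
  obtain ⟨r, hr, hball⟩ := Metric.eventually_nhds_iff_ball.1
    ((hC.bound.and hdiff).and (eventually_mem_set.2 ht))
  refine IsBigO.of_bound (C * 2 ^ (2 * N) + C + K) ?_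
  filter_upwards [Metric.ball_mem_nhds (0 : E) (lt_min (half_pos hr) one_pos)] with x hx
  rw [mem_ball_zero_iff, lt_min_iff] at hx
  rcases eq_or_ne x 0 with rfl | hx0
  · rw [h0]; simp only [norm_zero]; positivity
  have hxpos : 0 < ‖x‖ := norm_pos_iff.2 hx0
  set s := ‖x‖ ^ N with hs
  have hspos : 0 < s := pow_pos hxpos N
  have hsx : s ≤ ‖x‖ := by
    calc s ≤ ‖x‖ ^ 1 := pow_le_pow_of_le_one hxpos.le hx.2.le hN
      _ = ‖x‖ := pow_one _
  rw [Real.norm_of_nonneg hspos.le]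
  refine ContinuousLinearMap.opNorm_le_of_unit_norm (by positivity) fun u hu => ?_
  have hmem : ∀ y ∈ Metric.closedBall x s, y ∈ Metric.ball (0 : E) r := by
    intro y hy
    rw [mem_closedBall_iff_norm] at hy
    rw [mem_ball_zero_iff]
    calc ‖y‖ = ‖(y - x) + x‖ := by simp
      _ ≤ ‖y - x‖ + ‖x‖ := norm_add_le _ _
      _ < r := by linarith
  have hxmem : x ∈ Metric.closedBall x s := Metric.mem_closedBall_self hspos.le
  have hymem : x + s • u ∈ Metric.closedBall x s := by
    rw [mem_closedBall_iff_norm]; simp [norm_smul, hu, abs_of_pos hspos]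
  have key : ‖h (x + s • u) - h x - fderiv ℝ h x (x + s • u - x)‖ ≤ K * s * ‖x + s • u - x‖ := by
    refine (convex_closedBall x s).norm_image_sub_le_of_norm_hasFDerivWithin_le'
      (f' := fderiv ℝ h) (fun y hy => ?_) (fun y hy => ?_) hxmem hymem
    · exact ((hball y (hmem y hy)).1.2).hasFDerivAt.hasFDerivWithinAt
    · have := hK.norm_sub_le (hball y (hmem y hy)).2 (hball x (hmem x hxmem)).2
      refine this.trans ?_
      gcongr
      rwa [mem_closedBall_iff_norm] at hy
  have e1 : x + s • u - x = s • u := by abel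
  rw [e1, map_smul] at key
  have hn : ‖s • u‖ = s := by simp [norm_smul, hu, abs_of_pos hspos]
  rw [hn] at key
  have b1 := (hball _ (hmem _ hymem)).1.1
  have b2 := (hball _ (hmem _ hxmem)).1.1
  have e2 : ‖x‖ ^ (2 * N) = s * s := by rw [hs, two_mul, pow_add]
  rw [Real.norm_of_nonneg (by positivity)] at b1 b2
  rw [e2] at b2
  have b3 : ‖x + s • u‖ ^ (2 * N) ≤ 2 ^ (2 * N) * (s * s) := by
    rw [← e2, ← mul_pow]
    gcongr
    calc ‖x + s • u‖ ≤ ‖x‖ + ‖s • u‖ := norm_add_le _ _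
      _ ≤ 2 * ‖x‖ := by rw [hn]; linarith
  have b4 : s * ‖fderiv ℝ h x u‖ ≤ s * ((C * 2 ^ (2 * N) + C + K) * s) := by
    calc s * ‖fderiv ℝ h x u‖ = ‖s • fderiv ℝ h x u‖ := by rw [norm_smul, Real.norm_of_nonneg hspos.le]
      _ = ‖(h (x + s • u) - h x) - (h (x + s • u) - h x - s • fderiv ℝ h x u)‖ := by congr 1; abel
      _ ≤ ‖h (x + s • u)‖ + ‖h x‖ + K * s * s :=
        (norm_sub_le _ _).trans (add_le_add (norm_sub_le _ _) key)
      _ ≤ C * (2 ^ (2 * N) * (s * s)) + C * (s * s) + K * s * s := by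
        gcongr
        exact b1.trans (by gcongr)
      _ = _ := by ring
  exact le_of_mul_le_mul_left b4 hspos

theorem IsFlat.fderiv {E F : Type*} [NormedAddCommGroup E] [NormedSpace ℝ E]
    [NormedAddCommGroup F] [NormedSpace ℝ F] {h : E → F} (hh : IsFlat h) (hs : ContDiffAt ℝ 2 h 0) :
    IsFlat (fderiv ℝ h) := by
  intro N
  refine (fderiv_isBigO_of_isBigO hs (N := N + 1) (by omega) (hh _)).trans ?_
  refine IsBigO.of_bound 1 ?_
  filter_upwards [Metric.ball_mem_nhds (0 : E) one_pos] with x hx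
  rw [mem_ball_zero_iff] at hx
  simp only [norm_pow, norm_norm, one_mul]
  exact pow_le_pow_of_le_one (norm_nonneg _) hx.le (by omega)

/-- The rescaling `(ρ, w) ↦ ρ⁻ᴹ h(ρ w)`. -/
noncomputable def rescale {E F : Type*} [NormedAddCommGroup E] [NormedSpace ℝ E]
    [NormedAddCommGroup F] [NormedSpace ℝ F] (h : E → F) (M : ℕ) (p : ℝ × E) : F :=
  (p.1 ^ M)⁻¹ • h (p.1 • p.2)

theorem rescale_isBigO {E F : Type*} [NormedAddCommGroup E] [NormedSpace ℝ E]
    [NormedAddCommGroup F] [NormedSpace ℝ F] {h : E → F} (hh : IsFlat h) (M N : ℕ) (w : E) :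
    rescale h M =O[𝓝 (0, w)] fun p => p.1 ^ N := by
  obtain ⟨C, hCpos, hC⟩ := (hh (M + N)).exists_pos
  have hcont : Tendsto (fun p : ℝ × E => p.1 • p.2) (𝓝 (0, w)) (𝓝 0) := by
    have : Continuous fun p : ℝ × E => p.1 • p.2 := by fun_prop
    simpa using this.tendsto (0, w)
  have hw : ∀ᶠ p : ℝ × E in 𝓝 (0, w), ‖p.2‖ < ‖w‖ + 1 := by
    have : Continuous fun p : ℝ × E => ‖p.2‖ := by fun_prop
    exact this.tendsto (0, w) |>.eventually_lt_const (by simp)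
  refine IsBigO.of_bound (C * (‖w‖ + 1) ^ (M + N)) ?_
  filter_upwards [hcont.eventually hC.bound, hw] with p hp hpw
  rcases eq_or_ne p.1 0 with h0 | h0
  · rw [rescale, h0, zero_smul, hh.apply_zero, smul_zero, norm_zero]; positivity
  rw [rescale, norm_smul, norm_inv, norm_pow, norm_pow]
  rw [norm_pow, norm_norm, norm_smul, mul_pow, pow_add ‖p.1‖] at hp
  have hpos : 0 < ‖p.1‖ ^ M := pow_pos (norm_pos_iff.2 h0) _
  rw [inv_mul_le_iff₀ hpos]
  calc ‖h (p.1 • p.2)‖ ≤ C * (‖p.1‖ ^ M * ‖p.1‖ ^ N * ‖p.2‖ ^ (M + N)) := hp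
    _ ≤ C * (‖p.1‖ ^ M * ‖p.1‖ ^ N * (‖w‖ + 1) ^ (M + N)) := by gcongr
    _ = _ := by ring

/-- The derivative is expressed through rescalings of `h` and of `fderiv ℝ h`, both flat, so the
class of rescaled flat functions is closed under differentiation. At ρ = 0 the junk value of the
inverse is harmless: the function vanishes there and is O(ρ²) nearby. -/
theorem hasFDerivAt_rescale {E F : Type*} [NormedAddCommGroup E] [NormedSpace ℝ E]
    [NormedAddCommGroup F] [NormedSpace ℝ F] {h : E → F} (hs : ContDiff ℝ ∞ h) (hh : IsFlat h)
    (M : ℕ) (p : ℝ × E) :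
    HasFDerivAt (rescale h M)
      (-(M : ℝ) • (ContinuousLinearMap.fst ℝ ℝ E).smulRight (rescale h (M + 1) p) +
        (rescale (fderiv ℝ h) M p).comp
          ((ContinuousLinearMap.fst ℝ ℝ E).smulRight p.2 + p.1 • ContinuousLinearMap.snd ℝ ℝ E))
      p := by
  obtain ⟨ρ, w⟩ := p
  rcases eq_or_ne ρ 0 with rfl | h0
  · have e : rescale (fderiv ℝ h) M ((0 : ℝ), w) = 0 := by
      simp [rescale, (hh.fderiv (hs.contDiffAt.of_le (by norm_cast))).apply_zero]
    have e' : rescale h (M + 1) ((0 : ℝ), w) = 0 := by simp [rescale]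
    rw [e, e']
    simp only [ContinuousLinearMap.smulRight_zero, smul_zero, ContinuousLinearMap.zero_comp,
      add_zero]
    refine IsBigO.hasFDerivAt (n := 2) ((rescale_isBigO hh M 2 w).trans ?_) one_lt_two
    refine IsBigO.of_bound 1 (Eventually.of_forall fun p => ?_)
    simp only [norm_pow, norm_norm, one_mul]
    gcongr
    calc ‖p.1‖ = ‖(p - (0, w)).1‖ := by simp
      _ ≤ _ := norm_fst_le _
  · have h1 : HasFDerivAt (fun p : ℝ × E => (p.1 ^ M)⁻¹)
        ((-(M : ℝ) * (ρ ^ (M + 1))⁻¹) • ContinuousLinearMap.fst ℝ ℝ E) (ρ, w) := by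
      have := (((hasDerivAt_pow M ρ).inv (pow_ne_zero M h0)).comp_hasFDerivAt (ρ, w)
        (hasFDerivAt_fst (𝕜 := ℝ) (E := ℝ) (F := E)))
      refine this.congr_fderiv ?_
      congr 1
      rcases M with _ | M
      · simp
      · field_simp
        simp
        ring
    have h2 : HasFDerivAt (fun p : ℝ × E => p.1 • p.2)
        ((ContinuousLinearMap.fst ℝ ℝ E).smulRight w + ρ • ContinuousLinearMap.snd ℝ ℝ E)
        (ρ, w) := by
      have := (hasFDerivAt_fst (𝕜 := ℝ) (E := ℝ) (F := E) (p := (ρ, w))).smul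
        (hasFDerivAt_snd (𝕜 := ℝ) (E := ℝ) (F := E) (p := (ρ, w)))
      refine this.congr_fderiv ?_
      ext <;> simp
    have h3 := (((hs.differentiable (by simp)) (ρ • w)).hasFDerivAt.comp (ρ, w) h2)
    refine (h1.smul h3).congr_fderiv ?_
    ext <;> simp [rescale, smul_smul, mul_comm, add_comm]

universe u

/-- The induction replaces `F` by `E →L[ℝ] F` and `M` by `M + 1`, hence the quantification over both
and the common universe. -/
theorem contDiff_nat_rescale {E : Type u} [NormedAddCommGroup E] [NormedSpace ℝ E] (n : ℕ) :
    ∀ {F : Type u} [NormedAddCommGroup F] [NormedSpace ℝ F] {h : E → F}, ContDiff ℝ ∞ h →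
      IsFlat h → ∀ M : ℕ, ContDiff ℝ n (rescale h M) := by
  induction n with
  | zero =>
    intro F _ _ h hs hh M
    exact contDiff_zero.2 (continuous_iff_continuousAt.2 fun p =>
      (hasFDerivAt_rescale hs hh M p).continuousAt)
  | succ n ih =>
    intro F _ _ h hs hh M
    push_cast
    rw [contDiff_succ_iff_hasFDerivAt]
    refine ⟨_, ?_, hasFDerivAt_rescale hs hh M⟩
    have h1 := ih hs hh (M + 1)
    have h2 := ih (hs.fderiv_right (m := ∞) (by simp))
      (hh.fderiv (hs.contDiffAt.of_le (by norm_cast))) M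
    have h3 : ContDiff ℝ n fun p : ℝ × E => (ContinuousLinearMap.fst ℝ ℝ E).smulRight p.2 :=
      ((ContinuousLinearMap.smulRightL ℝ (ℝ × E) E (ContinuousLinearMap.fst ℝ ℝ E)).contDiff).comp
        contDiff_snd
    have h4 : ContDiff ℝ n fun p : ℝ × E =>
        (ContinuousLinearMap.fst ℝ ℝ E).smulRight (rescale h (M + 1) p) :=
      ((ContinuousLinearMap.smulRightL ℝ (ℝ × E) F (ContinuousLinearMap.fst ℝ ℝ E)).contDiff).comp
        h1
    exact (h4.const_smul _).add (h2.clm_comp (h3.add (contDiff_fst.smul contDiff_const)))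

theorem contDiff_rescale {E F : Type u} [NormedAddCommGroup E] [NormedSpace ℝ E]
    [NormedAddCommGroup F] [NormedSpace ℝ F] {h : E → F} (hs : ContDiff ℝ ∞ h) (hh : IsFlat h)
    (M : ℕ) : ContDiff ℝ ∞ (rescale h M) :=
  contDiff_infty.2 fun n => contDiff_nat_rescale n hs hh M

/-- The superposition operator `w ↦ k ∘ w` on continuous functions. -/
def superposition (K : Type*) [TopologicalSpace K] {E F : Type*} [TopologicalSpace E]
    [TopologicalSpace F] (k : C(E, F)) (w : C(K, E)) : C(K, F) :=
  k.comp w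

/-- Pointwise application of a continuous family of operators. -/
noncomputable def pointwiseApply (K : Type*) [TopologicalSpace K] [CompactSpace K] (E F : Type*)
    [NormedAddCommGroup E] [NormedSpace ℝ E] [NormedAddCommGroup F] [NormedSpace ℝ F] :
    C(K, E →L[ℝ] F) →L[ℝ] C(K, E) →L[ℝ] C(K, F) :=
  LinearMap.mkContinuous₂ (E := C(K, E →L[ℝ] F)) (F := C(K, E)) (G := C(K, F))
    (LinearMap.mk₂ ℝ (fun (A : C(K, E →L[ℝ] F)) (v : C(K, E)) =>
        (⟨fun t => A t (v t), A.continuous.clm_apply v.continuous⟩ : C(K, F)))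
      (fun A B v => by ext; simp) (fun c A v => by ext; simp)
      (fun A v w => by ext; simp) (fun c A v => by ext; simp)) 1 fun A v => by
    rw [ContinuousMap.norm_le _ (by positivity)]
    intro t
    rw [one_mul]
    exact ((A t).le_opNorm _).trans (mul_le_mul (A.norm_coe_le_norm t) (v.norm_coe_le_norm t)
      (norm_nonneg _) ((norm_nonneg (A t)).trans (A.norm_coe_le_norm t)))

@[simp]
theorem pointwiseApply_apply {K : Type*} [TopologicalSpace K] [CompactSpace K] {E F : Type*}
    [NormedAddCommGroup E] [NormedSpace ℝ E] [NormedAddCommGroup F] [NormedSpace ℝ F]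
    (A : C(K, E →L[ℝ] F)) (v : C(K, E)) (t : K) : pointwiseApply K E F A v t = A t (v t) :=
  rfl

/-- Compactness of `K` makes w ↦ k' ∘ w continuous for the sup norm. The pointwise mean value
inequality on the segment from w(t) to w(t) + v(t) is therefore uniform in t. -/
theorem hasFDerivAt_superposition {K : Type*} [TopologicalSpace K] [CompactSpace K] {E F : Type*}
    [NormedAddCommGroup E] [NormedSpace ℝ E] [NormedAddCommGroup F] [NormedSpace ℝ F]
    (k : C(E, F)) (k' : C(E, E →L[ℝ] F)) (hk : ∀ x, HasFDerivAt k (k' x) x) (w : C(K, E)) :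
    HasFDerivAt (superposition K k) (pointwiseApply K E F (superposition K k' w)) w := by
  rw [hasFDerivAt_iff_isLittleO_nhds_zero, isLittleO_iff]
  intro c hc
  have hcont : Continuous (superposition K k') := ContinuousMap.continuous_postcomp k'
  obtain ⟨δ, hδ, hball⟩ :=
    (Metric.continuous_iff (α := C(K, E)) (β := C(K, E →L[ℝ] F))).1 hcont w c hc
  filter_upwards [Metric.ball_mem_nhds (0 : C(K, E)) hδ] with v hv
  rw [mem_ball_zero_iff] at hv
  rw [ContinuousMap.norm_le _ (by positivity)]
  intro t
  have key : ‖k (w t + v t) - k (w t) - k' (w t) (w t + v t - w t)‖ ≤ c * ‖w t + v t - w t‖ := by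
    refine (convex_segment (w t) (w t + v t)).norm_image_sub_le_of_norm_hasFDerivWithin_le'
      (f' := k') (fun y _ => (hk y).hasFDerivWithinAt) (fun y hy => ?_)
      (left_mem_segment ℝ _ _) (right_mem_segment ℝ _ _)
    rw [segment_eq_image'] at hy
    obtain ⟨θ, hθ, rfl⟩ := hy
    have := hball (w + θ • v) (by
      rw [dist_eq_norm, add_sub_cancel_left, norm_smul, Real.norm_of_nonneg hθ.1]
      exact (mul_le_of_le_one_left (norm_nonneg _) hθ.2).trans_lt hv)
    have h2 := (ContinuousMap.dist_apply_le_dist t).trans this.le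
    rw [dist_eq_norm] at h2
    simpa [superposition] using h2
  simp only [add_sub_cancel_left] at key
  refine le_trans ?_ (key.trans (mul_le_mul_of_nonneg_left (v.norm_coe_le_norm t) hc.le))
  simp [superposition]

/-- The derivative is the superposition operator of `fderiv ℝ k` followed by the continuous bilinear
map `pointwiseApply`, which permits induction on the order. -/
theorem contDiff_nat_superposition {K : Type*} [TopologicalSpace K] [CompactSpace K] {E : Type u}
    [NormedAddCommGroup E] [NormedSpace ℝ E] (n : ℕ) :
    ∀ {F : Type u} [NormedAddCommGroup F] [NormedSpace ℝ F] (k : C(E, F)), ContDiff ℝ ∞ k →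
      ContDiff ℝ n (superposition K k) := by
  induction n with
  | zero =>
    intro F _ _ k hk
    exact contDiff_zero.2 (ContinuousMap.continuous_postcomp k)
  | succ n ih =>
    intro F _ _ k hk
    have hk' : ContDiff ℝ ∞ (fderiv ℝ k) := hk.fderiv_right (by simp)
    push_cast
    rw [contDiff_succ_iff_hasFDerivAt]
    refine ⟨_, ?_, hasFDerivAt_superposition k ⟨fderiv ℝ k, hk'.continuous⟩
      fun x => (hk.differentiable (by simp) x).hasFDerivAt⟩
    exact (pointwiseApply K E F).contDiff.comp (ih ⟨fderiv ℝ k, hk'.continuous⟩ hk')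

theorem contDiff_superposition {K : Type*} [TopologicalSpace K] [CompactSpace K] {E F : Type u}
    [NormedAddCommGroup E] [NormedSpace ℝ E] [NormedAddCommGroup F] [NormedSpace ℝ F]
    (k : C(E, F)) (hk : ContDiff ℝ ∞ k) : ContDiff ℝ ∞ (superposition K k) :=
  contDiff_infty.2 fun n => contDiff_nat_superposition n k hk

/-- A function that is smooth near a point agrees there with a globally smooth function. -/
theorem exists_contDiff_eventuallyEq {E F : Type*} [NormedAddCommGroup E] [NormedSpace ℝ E]
    [FiniteDimensional ℝ E] [NormedAddCommGroup F] [NormedSpace ℝ F] {f : E → F} {O : Set E}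
    {a : E} (hO : O ∈ 𝓝 a) (hf : ContDiffOn ℝ ∞ f O) :
    ∃ g : E → F, ContDiff ℝ ∞ g ∧ g =ᶠ[𝓝 a] f := by
  obtain ⟨r, hr, hrO⟩ := Metric.nhds_basis_closedBall.mem_iff.1 hO
  let χ : ContDiffBump a := ⟨r / 3, r / 2, by positivity, by linarith⟩
  refine ⟨fun x => χ x • f x, ?_, ?_⟩
  · rw [contDiff_iff_contDiffAt]
    intro x
    by_cases hx : x ∈ Metric.ball a r
    · exact χ.contDiff.contDiffAt.smul ((hf.mono (Metric.ball_subset_closedBall.trans hrO)).contDiffAt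
        (Metric.isOpen_ball.mem_nhds hx))
    · have : ∀ᶠ y in 𝓝 x, χ y • f y = 0 := by
        have hx' : x ∈ (Metric.closedBall a (r / 2))ᶜ := by
          simp only [Metric.mem_ball, not_lt] at hx
          simp only [mem_compl_iff, Metric.mem_closedBall, not_le]
          linarith
        filter_upwards [Metric.isClosed_closedBall.isOpen_compl.mem_nhds hx'] with y hy
        rw [χ.zero_of_le_dist (by
          simp only [mem_compl_iff, Metric.mem_closedBall, not_le] at hy
          exact hy.le), zero_smul]
      exact contDiffAt_const.congr_of_eventuallyEq this
  · filter_upwards [χ.eventuallyEq_one] with x hx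
    rw [hx]; simp

end Calculus

/-! ### Invariant manifolds parametrized by asymptotic data -/

section Asymptotic

/-- Extension of a continuous function on `[0, 1]` to the real line. -/
noncomputable def lineExtend {E : Type*} [TopologicalSpace E] (g : C(unitInterval, E)) (x : ℝ) : E :=
  g (projIcc 0 1 zero_le_one x)

theorem continuous_lineExtend {E : Type*} [TopologicalSpace E] (g : C(unitInterval, E)) :
    Continuous (lineExtend g) :=
  g.continuous.comp continuous_projIcc

theorem lineExtend_coe {E : Type*} [TopologicalSpace E] (g : C(unitInterval, E)) (ρ : unitInterval) :
    lineExtend g ρ = g ρ := by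
  rw [lineExtend, projIcc_val]

theorem continuous_rpow_mul_lineExtend {ι : Type} [Fintype ι] {a : ℝ} (ha : 0 ≤ a)
    (g : C(unitInterval, ι → ℝ)) (i : ι) : Continuous fun σ : ℝ => σ ^ a * lineExtend g σ i :=
  (Real.continuous_rpow_const ha).mul ((continuous_apply i).comp (continuous_lineExtend g))

/-- The weighted average `∫₀¹ τᵃ g(ρ τ) dτ`. -/
noncomputable def weightedAverage {ι : Type} [Fintype ι] (a : ι → ℝ) (g : C(unitInterval, ι → ℝ)) (ρ : ℝ)
    (i : ι) : ℝ :=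
  ∫ τ in (0 : ℝ)..1, τ ^ a i * lineExtend g (ρ * τ) i

theorem continuous_weightedAverage {ι : Type} [Fintype ι] {a : ι → ℝ} (ha : ∀ i, 0 ≤ a i)
    (g : C(unitInterval, ι → ℝ)) : Continuous (weightedAverage a g) := by
  refine continuous_pi fun i => ?_
  refine intervalIntegral.continuous_parametric_intervalIntegral_of_continuous' (μ := MeasureTheory.volume)
    (f := fun ρ τ => τ ^ a i * lineExtend g (ρ * τ) i) ?_ 0 1
  refine ((Real.continuous_rpow_const (ha i)).comp continuous_snd).mul ?_
  exact ((continuous_apply i).comp (continuous_lineExtend g)).comp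
    (continuous_fst.mul continuous_snd)

theorem intervalIntegrable_weightedAverage {ι : Type} [Fintype ι] {a : ι → ℝ} (ha : ∀ i, 0 ≤ a i)
    (g : C(unitInterval, ι → ℝ)) (ρ : ℝ) (i : ι) :
    IntervalIntegrable (fun τ => τ ^ a i * lineExtend g (ρ * τ) i) MeasureTheory.volume 0 1 := by
  refine Continuous.intervalIntegrable ?_ _ _
  exact (Real.continuous_rpow_const (ha i)).mul (((continuous_apply i).comp
    (continuous_lineExtend g)).comp (continuous_const.mul continuous_id))

theorem norm_weightedAverage_le {ι : Type} [Fintype ι] {a : ι → ℝ} (ha : ∀ i, 0 ≤ a i)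
    (g : C(unitInterval, ι → ℝ)) (ρ : ℝ) (i : ι) : ‖weightedAverage a g ρ i‖ ≤ ‖g‖ := by
  have := intervalIntegral.norm_integral_le_of_norm_le_const (a := 0) (b := 1) (C := ‖g‖)
    (f := fun τ => τ ^ a i * lineExtend g (ρ * τ) i) fun τ hτ => by
      rw [uIoc_of_le zero_le_one] at hτ
      rw [norm_mul, Real.norm_of_nonneg (Real.rpow_nonneg hτ.1.le _)]
      calc τ ^ a i * ‖lineExtend g (ρ * τ) i‖ ≤ 1 * ‖g‖ :=
            mul_le_mul (Real.rpow_le_one hτ.1.le hτ.2 (ha i))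
              ((norm_le_pi_norm _ i).trans (g.norm_coe_le_norm _)) (norm_nonneg _) zero_le_one
        _ = ‖g‖ := one_mul _
  simpa [weightedAverage] using this

/-- Substitution σ = ρτ. The average is visibly continuous up to ρ = 0, whereas the integral over
[0, ρ] is the form that can be differentiated in ρ. -/
theorem rpow_mul_weightedAverage {ι : Type} [Fintype ι] (a : ι → ℝ) (g : C(unitInterval, ι → ℝ)) {ρ : ℝ}
    (hρ : 0 < ρ) (i : ι) :
    ρ ^ (a i + 1) * weightedAverage a g ρ i = ∫ σ in (0 : ℝ)..ρ, σ ^ a i * lineExtend g σ i := by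
  have h1 := intervalIntegral.mul_integral_comp_mul_left (a := 0) (b := 1) (c := ρ)
    (f := fun σ => σ ^ a i * lineExtend g σ i)
  rw [mul_zero, mul_one] at h1
  rw [← h1, Real.rpow_add hρ, Real.rpow_one, mul_comm (ρ ^ a i), mul_assoc, weightedAverage,
    ← intervalIntegral.integral_const_mul]
  congr 1
  refine intervalIntegral.integral_congr fun τ hτ => ?_
  rw [uIcc_of_le zero_le_one] at hτ
  rw [Real.mul_rpow hρ.le hτ.1, mul_assoc]

/-- The linear operator inverting the linearized equation in the variable `ρ = e^{-αt}`. -/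
noncomputable def fuchsOperator {ι : Type} [Fintype ι] (α : ℝ) (M : ℕ) (a : ι → ℝ)
    (ha : ∀ i, 0 ≤ a i) : C(unitInterval, ι → ℝ) →L[ℝ] C(unitInterval, ι → ℝ) :=
  LinearMap.mkContinuous (E := C(unitInterval, ι → ℝ)) (F := C(unitInterval, ι → ℝ))
    { toFun := fun g => ⟨fun ρ => (-((ρ : ℝ) ^ (M - 1) / α)) • weightedAverage a g ρ,
        (by fun_prop : Continuous fun ρ : unitInterval => -((ρ : ℝ) ^ (M - 1) / α)).smul
          ((continuous_weightedAverage ha g).comp continuous_subtype_val)⟩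
      map_add' := fun g g' => by
        ext ρ i
        have := intervalIntegral.integral_add (intervalIntegrable_weightedAverage ha g ρ i)
          (intervalIntegrable_weightedAverage ha g' ρ i)
        simp only [weightedAverage, lineExtend, ContinuousMap.coe_mk, ContinuousMap.add_apply,
          Pi.add_apply, Pi.smul_apply, smul_eq_mul, mul_add] at this ⊢
        rw [this, mul_add]
      map_smul' := fun c g => by
        ext ρ i
        have := intervalIntegral.integral_const_mul (a := 0) (b := 1) c
          (fun τ => τ ^ a i * lineExtend g (ρ * τ) i) (μ := MeasureTheory.volume)
        simp only [weightedAverage, lineExtend, ContinuousMap.coe_mk, ContinuousMap.smul_apply,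
          Pi.smul_apply, smul_eq_mul, RingHom.id_apply, mul_left_comm _ c] at this ⊢
        rw [this]; ring }
    |α|⁻¹ fun g => by
      rw [ContinuousMap.norm_le _ (by positivity)]
      intro ρ
      refine (pi_norm_le_iff_of_nonneg (by positivity)).2 fun i => ?_
      simp only [LinearMap.coe_mk, AddHom.coe_mk, ContinuousMap.coe_mk, Pi.smul_apply]
      rw [norm_smul, norm_neg, norm_div, Real.norm_eq_abs α, norm_pow]
      have h1 : ‖(ρ : ℝ)‖ ^ (M - 1) ≤ 1 :=
        pow_le_one₀ (norm_nonneg _) (by rw [Real.norm_of_nonneg ρ.2.1]; exact ρ.2.2)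
      calc ‖(ρ : ℝ)‖ ^ (M - 1) / |α| * ‖weightedAverage a g ρ i‖
          ≤ 1 / |α| * ‖g‖ := by
            gcongr
            exact norm_weightedAverage_le ha g ρ i
        _ = _ := by rw [one_div]

theorem fuchsOperator_apply {ι : Type} [Fintype ι] (α : ℝ) (M : ℕ) (a : ι → ℝ)
    (ha : ∀ i, 0 ≤ a i) (g : C(unitInterval, ι → ℝ)) (ρ : unitInterval) (i : ι) :
    fuchsOperator α M a ha g ρ i = -((ρ : ℝ) ^ (M - 1) / α) * weightedAverage a g ρ i :=
  rfl

/-- The linear part of a solution with prescribed asymptotic data. -/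
noncomputable def asymptoticTerm {ι κ : Type} [Fintype ι] [Fintype κ]
    (J : (κ → ℝ) →L[ℝ] (ι → ℝ)) (b : κ → ℝ) (hb : ∀ c, 0 ≤ b c) :
    (κ → ℝ) →L[ℝ] C(unitInterval, ι → ℝ) :=
  LinearMap.toContinuousLinearMap
    { toFun := fun η => ⟨fun ρ => J fun c => (ρ : ℝ) ^ b c * η c,
        J.continuous.comp (continuous_pi fun c => ((Real.continuous_rpow_const (hb c)).comp
          continuous_subtype_val).mul continuous_const)⟩
      map_add' := fun η η' => by
        refine ContinuousMap.ext fun ρ => ?_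
        change J _ = J _ + J _
        rw [← map_add]
        congr 1
        ext c
        simp [mul_add]
      map_smul' := fun r η => by
        refine ContinuousMap.ext fun ρ => ?_
        change J _ = r • J _
        rw [← map_smul]
        congr 1
        ext c
        simp [mul_left_comm] }

/-- The graph `ρ ↦ (ρ, w ρ)`. -/
def graphMap {E : Type*} [TopologicalSpace E] (w : C(unitInterval, E)) : C(unitInterval, ℝ × E) :=
  ⟨fun ρ => (ρ, w ρ), continuous_subtype_val.prodMk w.continuous⟩

theorem contDiff_graphMap {E : Type*} [NormedAddCommGroup E] [NormedSpace ℝ E] :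
    ContDiff ℝ ∞ (graphMap : C(unitInterval, E) → C(unitInterval, ℝ × E)) := by
  have : (graphMap : C(unitInterval, E) → C(unitInterval, ℝ × E)) = fun w => graphMap 0 +
      ContinuousLinearMap.compLeftContinuous ℝ unitInterval (ContinuousLinearMap.inr ℝ ℝ E) w := by
    funext w
    ext ρ <;> simp [graphMap]
  rw [this]
  exact contDiff_const.add (ContinuousLinearMap.contDiff _)

theorem hasFDerivAt_graphMap {E : Type*} [NormedAddCommGroup E] [NormedSpace ℝ E] (w : C(unitInterval, E)) :
    HasFDerivAt (graphMap : C(unitInterval, E) → C(unitInterval, ℝ × E))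
      (ContinuousLinearMap.compLeftContinuous ℝ unitInterval (ContinuousLinearMap.inr ℝ ℝ E)) w := by
  have : (graphMap : C(unitInterval, E) → C(unitInterval, ℝ × E)) = fun w => graphMap 0 +
      ContinuousLinearMap.compLeftContinuous ℝ unitInterval (ContinuousLinearMap.inr ℝ ℝ E) w := by
    funext w
    ext ρ <;> simp [graphMap]
  rw [this]
  exact (ContinuousLinearMap.hasFDerivAt _).const_add _

/-- The nonlinear term `ρ ↦ ρ⁻ᴹ h(ρ w(ρ))`. -/
noncomputable def rescaledTerm {E : Type} [NormedAddCommGroup E] [NormedSpace ℝ E] {h : E → E}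
    (hs : ContDiff ℝ ∞ h) (hh : IsFlat h) (M : ℕ) (w : C(unitInterval, E)) : C(unitInterval, E) :=
  superposition unitInterval ⟨rescale h M, (contDiff_rescale hs hh M).continuous⟩ (graphMap w)

theorem rescaledTerm_apply {E : Type} [NormedAddCommGroup E] [NormedSpace ℝ E] {h : E → E}
    (hs : ContDiff ℝ ∞ h) (hh : IsFlat h) (M : ℕ) (w : C(unitInterval, E)) (ρ : unitInterval) :
    rescaledTerm hs hh M w ρ = ((ρ : ℝ) ^ M)⁻¹ • h ((ρ : ℝ) • w ρ) :=
  rfl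

theorem contDiff_rescaledTerm {E : Type} [NormedAddCommGroup E] [NormedSpace ℝ E] {h : E → E}
    (hs : ContDiff ℝ ∞ h) (hh : IsFlat h) (M : ℕ) : ContDiff ℝ ∞ (rescaledTerm hs hh M) :=
  (contDiff_superposition _ (contDiff_rescale hs hh M)).comp contDiff_graphMap

/-- Along the curve w = 0 only the derivative of `h` at the origin enters, and it vanishes by
flatness. Hence the fixed point map has the identity as its derivative at 0. -/
theorem hasFDerivAt_rescaledTerm_zero {E : Type} [NormedAddCommGroup E] [NormedSpace ℝ E]
    {h : E → E} (hs : ContDiff ℝ ∞ h) (hh : IsFlat h) (M : ℕ) :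
    HasFDerivAt (rescaledTerm hs hh M) (0 : C(unitInterval, E) →L[ℝ] C(unitInterval, E)) 0 := by
  have hk := contDiff_rescale hs hh M
  have h1 := (hasFDerivAt_superposition (K := unitInterval) ⟨rescale h M, hk.continuous⟩
    ⟨fderiv ℝ (rescale h M), (hk.fderiv_right (m := ∞) (by simp)).continuous⟩
    (fun x => (hk.differentiable (by simp) x).hasFDerivAt) (graphMap (0 : C(unitInterval, E)))).comp
    (0 : C(unitInterval, E)) (hasFDerivAt_graphMap 0)
  refine h1.congr_fderiv ?_
  ext v ρ
  have h2 : rescale (fderiv ℝ h) M ((ρ : ℝ), (0 : E)) = 0 := by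
    simp [rescale, (hh.fderiv (hs.contDiffAt.of_le (by norm_cast))).apply_zero]
  simp [superposition, graphMap, (hasFDerivAt_rescale hs hh M _).fderiv, h2]

/-- The fixed point equation `w - K N(w)` for solutions with prescribed asymptotic data. -/
noncomputable def asymptoticEquation {ι : Type} [Fintype ι] (α : ℝ) (M : ℕ) (a : ι → ℝ)
    (ha : ∀ i, 0 ≤ a i) {h : (ι → ℝ) → ι → ℝ} (hs : ContDiff ℝ ∞ h) (hh : IsFlat h)
    (w : C(unitInterval, ι → ℝ)) : C(unitInterval, ι → ℝ) :=
  w - fuchsOperator α M a ha (rescaledTerm hs hh M w)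

/-- The restriction of a curve to `[0, c]`, rescaled to `[0, 1]`; in the variable `ρ = e^{-αt}`
this is a time shift. -/
noncomputable def shiftCurve {E : Type*} [NormedAddCommGroup E] [NormedSpace ℝ E] (c : unitInterval)
    (w : C(unitInterval, E)) : C(unitInterval, E) :=
  ⟨fun ρ => (c : ℝ) • w (c * ρ), by fun_prop⟩

theorem norm_shiftCurve_le {E : Type*} [NormedAddCommGroup E] [NormedSpace ℝ E] (c : unitInterval)
    (w : C(unitInterval, E)) : ‖shiftCurve c w‖ ≤ ‖w‖ := by
  rw [ContinuousMap.norm_le _ (norm_nonneg _)]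
  intro ρ
  change ‖(c : ℝ) • w (c * ρ)‖ ≤ _
  rw [norm_smul, Real.norm_of_nonneg c.2.1]
  exact (mul_le_of_le_one_left (norm_nonneg _) c.2.2).trans (w.norm_coe_le_norm _)

/-- This expresses that the differential equation is autonomous: t ↦ t + T multiplies ρ = e^{-αt} by
the constant c = e^{-αT}, and the powers of c produced by N and K combine to the single factor c of
`shiftCurve`. -/
theorem asymptoticEquation_shiftCurve {ι : Type} [Fintype ι] {α : ℝ} {M : ℕ} (hM : 1 ≤ M)
    {a : ι → ℝ} (ha : ∀ i, 0 ≤ a i) {h : (ι → ℝ) → ι → ℝ} (hs : ContDiff ℝ ∞ h) (hh : IsFlat h)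
    (w : C(unitInterval, ι → ℝ)) {c : unitInterval} (hc : 0 < (c : ℝ)) :
    asymptoticEquation α M a ha hs hh (shiftCurve c w) =
      shiftCurve c (asymptoticEquation α M a ha hs hh w) := by
  have hN : ∀ ρ : unitInterval, rescaledTerm hs hh M (shiftCurve c w) ρ =
      (c : ℝ) ^ M • rescaledTerm hs hh M w (c * ρ) := by
    intro ρ
    have hc' : (c : ℝ) ^ M ≠ 0 := pow_ne_zero _ hc.ne'
    rw [rescaledTerm_apply, rescaledTerm_apply]
    change ((ρ : ℝ) ^ M)⁻¹ • h ((ρ : ℝ) • ((c : ℝ) • w (c * ρ))) = _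
    rw [smul_smul, smul_smul, Set.Icc.coe_mul, mul_comm (c : ℝ) ρ, mul_pow, mul_inv,
      mul_left_comm, mul_inv_cancel₀ hc', mul_one]
  refine ContinuousMap.ext fun ρ => funext fun i => ?_
  have hA : weightedAverage a (rescaledTerm hs hh M (shiftCurve c w)) ρ i =
      (c : ℝ) ^ M * weightedAverage a (rescaledTerm hs hh M w) (c * ρ) i := by
    rw [weightedAverage, weightedAverage, ← intervalIntegral.integral_const_mul]
    refine intervalIntegral.integral_congr fun τ hτ => ?_
    rw [uIcc_of_le zero_le_one] at hτ
    have e1 : lineExtend (rescaledTerm hs hh M (shiftCurve c w)) (ρ * τ) =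
        rescaledTerm hs hh M (shiftCurve c w) (ρ * ⟨τ, hτ⟩) := lineExtend_coe _ (ρ * ⟨τ, hτ⟩)
    have e2 : lineExtend (rescaledTerm hs hh M w) (c * ρ * τ) =
        rescaledTerm hs hh M w (c * (ρ * ⟨τ, hτ⟩)) := by
      rw [← lineExtend_coe]; congr 1; push_cast; ring
    simp only [e1, e2, hN, Pi.smul_apply, smul_eq_mul]
    ring
  change (c : ℝ) * w (c * ρ) i - fuchsOperator α M a ha _ ρ i =
    (c : ℝ) * (w (c * ρ) i - fuchsOperator α M a ha _ (c * ρ) i)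
  rw [fuchsOperator_apply, fuchsOperator_apply, hA, Set.Icc.coe_mul, mul_pow]
  obtain ⟨m, rfl⟩ : ∃ m, M = m + 1 := ⟨M - 1, by omega⟩
  rw [Nat.add_sub_cancel, pow_succ (c : ℝ)]
  ring

theorem asymptoticTerm_shift {ι κ : Type} [Fintype ι] [Fintype κ]
    (J : (κ → ℝ) →L[ℝ] (ι → ℝ)) {b : κ → ℝ} (hb : ∀ c, 0 ≤ b c) (η : κ → ℝ) {c : unitInterval}
    (hc : 0 < (c : ℝ)) :
    asymptoticTerm J b hb (fun j => (c : ℝ) ^ (b j + 1) * η j) =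
      shiftCurve c (asymptoticTerm J b hb η) := by
  refine ContinuousMap.ext fun ρ => ?_
  change J _ = (c : ℝ) • J _
  rw [← map_smul]
  congr 1
  funext j
  change (ρ : ℝ) ^ b j * ((c : ℝ) ^ (b j + 1) * η j) = _
  rw [Pi.smul_apply, smul_eq_mul, Set.Icc.coe_mul, Real.mul_rpow c.2.1 ρ.2.1,
    Real.rpow_add hc, Real.rpow_one]
  ring

/-- A matrix coefficient of `J` can be nonzero only between equal eigenvalues, so `J` intertwines
arbitrary functions of the eigenvalues, in particular their exponentials. -/
theorem intertwining_rpow {ι κ : Type} [Fintype ι] [Fintype κ] {lam : ι → ℝ} {mu : κ → ℝ}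
    {J : (κ → ℝ) →L[ℝ] (ι → ℝ)} (hJ : ∀ x i, J (fun c => mu c * x c) i = lam i * J x i)
    (φ : ℝ → ℝ) (x : κ → ℝ) (i : ι) : J (fun c => φ (mu c) * x c) i = φ (lam i) * J x i := by
  classical
  have hsum : ∀ y : κ → ℝ, J y i = ∑ c, y c * J (Pi.single c 1) i := by
    intro y
    conv_lhs => rw [pi_eq_sum_univ' y, map_sum, Finset.sum_apply]
    refine Finset.sum_congr rfl fun c _ => ?_
    rw [map_smul, Pi.smul_apply, smul_eq_mul]
  have hc : ∀ c, J (Pi.single c 1) i = 0 ∨ mu c = lam i := by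
    intro c
    have h1 := hJ (Pi.single c 1) i
    have h2 : (fun j => mu j * (Pi.single c 1 : κ → ℝ) j) = mu c • Pi.single c 1 := by
      funext j
      by_cases hj : j = c
      · subst hj; simp
      · simp [hj]
    rw [h2, map_smul, Pi.smul_apply, smul_eq_mul] at h1
    rcases eq_or_ne (J (Pi.single c 1) i) 0 with h0 | h0
    · exact Or.inl h0
    · exact Or.inr (mul_right_cancel₀ h0 h1)
  rw [hsum, hsum x, Finset.mul_sum]
  refine Finset.sum_congr rfl fun c _ => ?_
  rcases hc c with h0 | h0
  · simp [h0]
  · rw [h0, mul_assoc]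

/-- Each η prescribes the linear solution J(e^{μt}η) to which the nonlinear one is asymptotic. No
sign is imposed on `lam`: the error h(x) decays faster than any given exponential along x =
O(e^{-αt}), so the variation of constants integral converges even against contracting factors. -/
theorem exists_asymptotic_parametrization {ι κ : Type} [Fintype ι] [Fintype κ] (lam : ι → ℝ)
    (mu : κ → ℝ) (hmu : ∀ c, mu c < 0) (J : (κ → ℝ) →L[ℝ] (ι → ℝ))
    (hJ : ∀ x i, J (fun c => mu c * x c) i = lam i * J x i) {h : (ι → ℝ) → ι → ℝ}
    (hs : ContDiff ℝ ∞ h) (hh : IsFlat h) :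
    ∃ (e : (κ → ℝ) → ι → ℝ) (O : Set (κ → ℝ)), IsOpen O ∧ 0 ∈ O ∧ ContDiffOn ℝ ∞ e O ∧ e 0 = 0 ∧
      HasFDerivAt e J 0 ∧ ∀ η ∈ O,
        (fderiv ℝ e η (fun c => mu c * η c) = (fun i => lam i * e η i) + h (e η)) ∧
        ∀ i, Tendsto (fun t => Real.exp (-lam i * t) * e (fun c => Real.exp (mu c * t) * η c) i)
          atTop (𝓝 (J η i)) := by
  -- The rate α is at most every -μ_c, so the linear solutions are O(ρ) and the exponents b_c =
  -- -μ_c/α - 1 of the curve w = x/ρ are nonnegative.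
  obtain ⟨α, hα, hαmu⟩ : ∃ α : ℝ, 0 < α ∧ ∀ c, α ≤ -mu c := by
    have : ∀ᶠ α in 𝓝[>] (0 : ℝ), ∀ c, α ≤ -mu c := by
      rw [eventually_all]
      intro c
      exact (eventually_le_nhds (by linarith [hmu c])).filter_mono nhdsWithin_le_nhds
    obtain ⟨α, h1, h2⟩ := (this.and self_mem_nhdsWithin).exists
    exact ⟨α, h2, h1⟩
  -- With σ = e^{-αs} one has e^{-λs} h ds = -α⁻¹ σ^{λ/α - 1} h dσ. Extracting σ^M from h leaves the
  -- exponent a = λ/α + M - 1, which is made nonnegative.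
  obtain ⟨M, hM⟩ : ∃ M : ℕ, 1 ≤ M ∧ ∀ i, 0 ≤ lam i / α + M - 1 := by
    have : ∀ᶠ M : ℕ in atTop, ∀ i, 0 ≤ lam i / α + M - 1 := by
      rw [eventually_all]
      intro i
      filter_upwards [(tendsto_natCast_atTop_atTop (R := ℝ)).eventually_ge_atTop
        (1 - lam i / α)] with M hM
      linarith
    exact ((eventually_ge_atTop 1).and this).exists
  obtain ⟨hM1, ha⟩ := hM
  set a : ι → ℝ := fun i => lam i / α + M - 1 with ha_def
  have hb : ∀ c, 0 ≤ -mu c / α - 1 := fun c => by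
    rw [sub_nonneg, one_le_div hα]; exact hαmu c
  set b : κ → ℝ := fun c => -mu c / α - 1 with hb_def
  set N := rescaledTerm hs hh M with hN_def
  set G := asymptoticEquation α M a ha hs hh with hG_def
  set ℓ := asymptoticTerm J b hb with hℓ_def
  have hGs : ContDiff ℝ ∞ G :=
    contDiff_id.sub ((fuchsOperator α M a ha).contDiff.comp (contDiff_rescaledTerm hs hh M))
  have hG' : HasFDerivAt G
      ((ContinuousLinearEquiv.refl ℝ C(unitInterval, ι → ℝ) :
        C(unitInterval, ι → ℝ) ≃L[ℝ] C(unitInterval, ι → ℝ)) :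
        C(unitInterval, ι → ℝ) →L[ℝ] C(unitInterval, ι → ℝ)) 0 := by
    have := (hasFDerivAt_id (𝕜 := ℝ) (0 : C(unitInterval, ι → ℝ))).sub
      ((fuchsOperator α M a ha).hasFDerivAt.comp (0 : C(unitInterval, ι → ℝ))
        (hasFDerivAt_rescaledTerm_zero hs hh M))
    refine this.congr_fderiv ?_
    simp
  have hN0 : N 0 = 0 := by
    refine ContinuousMap.ext fun ρ => ?_
    rw [hN_def, rescaledTerm_apply]
    simp [hh.apply_zero]
  have hG0 : G 0 = 0 := by
    change 0 - fuchsOperator α M a ha (N 0) = 0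
    rw [hN0, map_zero, sub_zero]
  obtain ⟨E, hE0, -, hEG, hEs, -⟩ := exists_openPartialHomeomorph_of_contDiffOn isOpen_univ
    (mem_univ _) hGs.contDiffOn hG'
  obtain ⟨r, hr, hball⟩ := Metric.isOpen_iff.1 E.open_source 0 hE0
  have hEsymm0 : E.symm 0 = 0 := by
    have := E.left_inv hE0
    rwa [hEG, hG0] at this
  have h0t : (0 : C(unitInterval, ι → ℝ)) ∈ E.target := by
    have := E.map_source hE0
    rwa [hEG, hG0] at this
  set U : (κ → ℝ) → C(unitInterval, ι → ℝ) := fun η => E.symm (ℓ η) with hU_def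
  set O : Set (κ → ℝ) := ℓ ⁻¹' (E.target ∩ E.symm ⁻¹' Metric.ball 0 r) with hO_def
  have hO : IsOpen O := (E.symm.continuousOn.isOpen_inter_preimage E.open_target
    Metric.isOpen_ball).preimage ℓ.continuous
  have h0O : (0 : κ → ℝ) ∈ O := by
    simp only [hO_def, mem_preimage, map_zero, mem_inter_iff, hEsymm0]
    exact ⟨h0t, Metric.mem_ball_self hr⟩
  have hUs : ContDiffOn ℝ ∞ U O := hEs.comp ℓ.contDiff.contDiffOn fun η hη => hη.1
  set ev : C(unitInterval, ι → ℝ) →L[ℝ] (ι → ℝ) := ContinuousMap.evalCLM ℝ 1 with hev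
  -- Uniqueness: the shifted curve solves the equation with shifted data, and since its norm has not
  -- increased it stays in the ball on which `E` is injective.
  have hshift : ∀ η ∈ O, ∀ c : unitInterval, 0 < (c : ℝ) →
      U (fun j => (c : ℝ) ^ (b j + 1) * η j) = shiftCurve c (U η) := by
    intro η hη c hc
    have h1 : G (shiftCurve c (U η)) = ℓ (fun j => (c : ℝ) ^ (b j + 1) * η j) := by
      rw [hG_def, asymptoticEquation_shiftCurve hM1 ha hs hh _ hc, hℓ_def,
        asymptoticTerm_shift J hb η hc]
      congr 1
      have := E.right_inv hη.1
      rwa [hEG] at this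
    have h2 : shiftCurve c (U η) ∈ E.source := hball (by
      rw [mem_ball_zero_iff]
      exact (norm_shiftCurve_le _ _).trans_lt (mem_ball_zero_iff.1 hη.2))
    have h3 := E.left_inv h2
    rw [hEG, h1] at h3
    exact h3
  -- Variation of constants from t = ∞, written in the variable σ = e^{-αs}. Both the differential
  -- equation and the limit are read off from this formula.
  have hkey : ∀ η ∈ O, ∀ i, ∀ t : ℝ, 0 ≤ t → U (fun j => Real.exp (mu j * t) * η j) 1 i =
      Real.exp (lam i * t) * (J η i - α⁻¹ * ∫ σ in (0 : ℝ)..Real.exp (-α * t),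
        σ ^ a i * lineExtend (N (U η)) σ i) := by
    intro η hη i t ht
    have hc1 : Real.exp (-α * t) ≤ 1 := Real.exp_le_one_iff.2 (by nlinarith)
    set c : unitInterval := ⟨Real.exp (-α * t), (Real.exp_pos _).le, hc1⟩ with hc_def
    have hc : 0 < (c : ℝ) := Real.exp_pos _
    have hcc : (c : ℝ) = Real.exp (-α * t) := rfl
    have hpow : ∀ x : ℝ, (c : ℝ) ^ x = Real.exp (-α * t * x) := fun x => by
      rw [hcc, ← Real.exp_mul]
    have e1 : (fun j => Real.exp (mu j * t) * η j) = fun j => (c : ℝ) ^ (b j + 1) * η j := by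
      funext j
      rw [hpow]
      congr 2
      simp only [hb_def]
      field_simp
      ring
    rw [e1, hshift η hη c hc]
    change (c : ℝ) * U η (c * 1) i = _
    rw [mul_one]
    have h1 : U η c i = J (fun j => (c : ℝ) ^ b j * η j) i +
        -((c : ℝ) ^ (M - 1) / α) * weightedAverage a (N (U η)) c i := by
      have h2 : G (U η) = ℓ η := by
        have := E.right_inv hη.1
        rwa [hEG] at this
      have h3 := congrArg (fun w : C(unitInterval, ι → ℝ) => w c i) h2
      change U η c i - -((c : ℝ) ^ (M - 1) / α) * weightedAverage a (N (U η)) c i =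
        J (fun j => (c : ℝ) ^ b j * η j) i at h3
      linarith
    have h4 : J (fun j => (c : ℝ) ^ b j * η j) i = (c : ℝ) ^ (-lam i / α - 1) * J η i :=
      intertwining_rpow hJ (fun m => (c : ℝ) ^ (-m / α - 1)) η i
    rw [← hcc, ← rpow_mul_weightedAverage a (N (U η)) hc i, h1, h4]
    have e2 : (c : ℝ) * (c : ℝ) ^ (-lam i / α - 1) = Real.exp (lam i * t) := by
      rw [hpow, hcc, ← Real.exp_add]
      congr 1
      field_simp
      ring
    have e3 : Real.exp (lam i * t) * (c : ℝ) ^ (a i + 1) = (c : ℝ) * (c : ℝ) ^ (M - 1) := by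
      rw [← Real.rpow_natCast, hpow, hpow, hcc, ← Real.exp_add, ← Real.exp_add, Nat.cast_sub hM1]
      congr 1
      simp only [ha_def]
      push_cast
      field_simp
      ring
    calc (c : ℝ) * ((c : ℝ) ^ (-lam i / α - 1) * J η i +
          -((c : ℝ) ^ (M - 1) / α) * weightedAverage a (N (U η)) c i)
        = (c : ℝ) * (c : ℝ) ^ (-lam i / α - 1) * J η i -
          α⁻¹ * (c * (c : ℝ) ^ (M - 1)) * weightedAverage a (N (U η)) c i := by
            rw [div_eq_mul_inv]; ring
      _ = _ := by rw [e2, ← e3]; ring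
  have hint : ∀ η i, Continuous fun x : ℝ => ∫ σ in (0 : ℝ)..x, σ ^ a i * lineExtend (N (U η)) σ i :=
    fun η i => intervalIntegral.continuous_primitive (fun x y =>
      (continuous_rpow_mul_lineExtend (ha i) _ i).intervalIntegrable x y) 0
  have heO : ContDiffOn ℝ ∞ (fun η => U η 1) O := ev.contDiff.comp_contDiffOn hUs
  refine ⟨fun η => U η 1, O, hO, h0O, heO, ?_, ?_, ?_⟩
  · simp only [hU_def, map_zero, hEsymm0]
    rfl
  · have h1 : HasFDerivAt E.symm
        ((ContinuousLinearEquiv.refl ℝ C(unitInterval, ι → ℝ)).symm :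
          C(unitInterval, ι → ℝ) →L[ℝ] C(unitInterval, ι → ℝ)) (ℓ 0) := by
      rw [map_zero]
      exact E.hasFDerivAt_symm h0t (by rw [hEsymm0, hEG]; exact hG')
    have h2 := ev.hasFDerivAt.comp (0 : κ → ℝ) (h1.comp (0 : κ → ℝ) ℓ.hasFDerivAt)
    refine h2.congr_fderiv ?_
    ext1 η
    change J (fun j => ((1 : unitInterval) : ℝ) ^ b j * η j) = J η
    simp
  · intro η hη
    refine ⟨?_, fun i => ?_⟩
    · have hd1 : HasDerivAt (fun t : ℝ => fun j => Real.exp (mu j * t) * η j)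
          (fun j => mu j * η j) 0 := by
        rw [hasDerivAt_pi]
        intro j
        have := (((hasDerivAt_id (0 : ℝ)).const_mul (mu j)).exp).mul_const (η j)
        simpa using this
      have hη0 : (fun j => Real.exp (mu j * 0) * η j) = η := by funext j; simp
      have hd2 : HasDerivAt (fun t : ℝ => U (fun j => Real.exp (mu j * t) * η j) 1)
          (fderiv ℝ (fun η => U η 1) η (fun j => mu j * η j)) 0 := by
        have h3 : HasFDerivAt (fun η => U η 1) (fderiv ℝ (fun η => U η 1) η)
            (fun j => Real.exp (mu j * 0) * η j) := by
          rw [hη0]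
          exact ((heO.contDiffAt (hO.mem_nhds hη)).differentiableAt (by simp)).hasFDerivAt
        exact h3.comp_hasDerivAt (0 : ℝ) hd1
      funext i
      -- The integral formula is available for t ≥ 0 only, so the two expressions for the derivative
      -- are compared as one-sided derivatives at 0.
      have hd3 := (hasDerivAt_pi.1 hd2 i).hasDerivWithinAt (s := Ici 0)
      have hd4 : HasDerivWithinAt (fun t : ℝ => U (fun j => Real.exp (mu j * t) * η j) 1 i)
          (lam i * U η 1 i + h (U η 1) i) (Ici 0) 0 := by
        have hF : HasDerivAt (fun x : ℝ => ∫ σ in (0 : ℝ)..x, σ ^ a i * lineExtend (N (U η)) σ i)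
            (h (U η 1) i) (Real.exp (-α * 0)) := by
          have := (continuous_rpow_mul_lineExtend (ha i) (N (U η)) i).integral_hasStrictDerivAt 0
            (Real.exp (-α * 0)) |>.hasDerivAt
          refine this.congr_deriv ?_
          rw [mul_zero, Real.exp_zero, Real.one_rpow, one_mul]
          have e5 : lineExtend (N (U η)) 1 = N (U η) 1 := lineExtend_coe _ 1
          rw [e5, hN_def, rescaledTerm_apply]
          simp
        have hE1 : HasDerivAt (fun t : ℝ => Real.exp (-α * t)) (-α) 0 := by
          simpa using ((hasDerivAt_id (0 : ℝ)).const_mul (-α)).exp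
        have hE2 : HasDerivAt (fun t : ℝ => Real.exp (lam i * t)) (lam i) 0 := by
          simpa using ((hasDerivAt_id (0 : ℝ)).const_mul (lam i)).exp
        have hF2 := hE2.mul (((hF.comp (0 : ℝ) hE1).const_mul α⁻¹).const_sub (J η i))
        have hF3 := hF2.hasDerivWithinAt (s := Ici 0)
        refine (hF3.congr (fun t ht => hkey η hη i t ht) (hkey η hη i 0 le_rfl)).congr_deriv ?_
        have h6 := hkey η hη i 0 le_rfl
        rw [hη0] at h6
        rw [h6]
        simp only [Function.comp, mul_zero, Real.exp_zero, one_mul]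
        field_simp
      exact (uniqueDiffOn_Ici (0 : ℝ) 0 self_mem_Ici).eq_deriv _ hd3 hd4
    · have hlim : Tendsto (fun t : ℝ => J η i - α⁻¹ * ∫ σ in (0 : ℝ)..Real.exp (-α * t),
          σ ^ a i * lineExtend (N (U η)) σ i) atTop (𝓝 (J η i)) := by
        have h1 : Tendsto (fun t : ℝ => Real.exp (-α * t)) atTop (𝓝 0) :=
          Real.tendsto_exp_atBot.comp (tendsto_id.const_mul_atTop_of_neg (neg_lt_zero.2 hα))
        have h2 := (((hint η i).tendsto 0).comp h1).const_mul α⁻¹ |>.const_sub (J η i)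
        simpa using h2
      refine hlim.congr' ?_
      filter_upwards [eventually_ge_atTop 0] with t ht
      rw [hkey η hη i t ht, ← mul_assoc, ← Real.exp_add]
      simp

end Asymptotic

/-! ### Borel's lemma and formal linearization -/

section Borel

theorem norm_le_mul_pow_of_homogeneous {E F : Type*} [NormedAddCommGroup E] [NormedSpace ℝ E]
    [FiniteDimensional ℝ E] [NormedAddCommGroup F] [NormedSpace ℝ F] {Q : E → F} {d : ℕ}
    (hQ : Continuous Q) (hom : ∀ (c : ℝ) x, Q (c • x) = c ^ d • Q x) :
    ∃ B, ∀ x, ‖Q x‖ ≤ B * ‖x‖ ^ d := by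
  have : ProperSpace E := FiniteDimensional.proper ℝ E
  obtain ⟨B, hB⟩ := (isCompact_closedBall (0 : E) 1).exists_bound_of_continuousOn hQ.continuousOn
  refine ⟨B, fun x => ?_⟩
  rcases eq_or_ne x 0 with rfl | hx
  · rcases Nat.eq_zero_or_pos d with rfl | hd
    · simpa using hB 0 (by simp)
    · have := hom 0 0
      rw [zero_pow hd.ne', zero_smul, zero_smul] at this
      simp [this, hd.ne']
  · have hx' : 0 < ‖x‖ := norm_pos_iff.2 hx
    have h1 : x = ‖x‖ • (‖x‖⁻¹ • x) := by rw [smul_smul, mul_inv_cancel₀ hx'.ne', one_smul]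
    conv_lhs => rw [h1, hom, norm_smul, norm_pow, norm_norm]
    rw [mul_comm B]
    gcongr
    refine hB _ ?_
    rw [mem_closedBall_zero_iff, norm_smul, norm_inv, norm_norm, inv_mul_cancel₀ hx'.ne']

/-- **Borel's lemma**: every formal power series is the Taylor series of a smooth function. -/
theorem exists_contDiff_of_homogeneous_series {E F : Type*} [NormedAddCommGroup E]
    [NormedSpace ℝ E] [FiniteDimensional ℝ E] [NormedAddCommGroup F] [NormedSpace ℝ F]
    [CompleteSpace F] {Q : ℕ → E → F} (hQ : ∀ d, ContDiff ℝ ∞ (Q d))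
    (hom : ∀ d (c : ℝ) x, Q d (c • x) = c ^ d • Q d x) :
    ∃ P : E → F, ContDiff ℝ ∞ P ∧ ∀ N : ℕ,
      (fun x => P x - ∑ d ∈ Finset.range (N + 1), Q d x) =O[𝓝 0] fun x => ‖x‖ ^ N := by
  let χ : ContDiffBump (0 : E) := ⟨1 / 2, 1, by norm_num, by norm_num⟩
  set g : ℕ → E → F := fun d y => χ y • Q d y with hg
  have hgs : ∀ d, ContDiff ℝ ∞ (g d) := fun d => χ.contDiff.smul (hQ d)
  have hgc : ∀ d, HasCompactSupport (g d) := fun d => χ.hasCompactSupport.smul_right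
  have hC : ∀ d, ∃ C : ℝ, 0 < C ∧ (∀ k ≤ d, ∀ y, ‖iteratedFDeriv ℝ k (g d) y‖ ≤ C) ∧
      ∀ y, ‖Q d y‖ ≤ C * ‖y‖ ^ d := by
    intro d
    have h1 : ∀ k, ∃ C, ∀ y, ‖iteratedFDeriv ℝ k (g d) y‖ ≤ C := fun k =>
      ((hgs d).continuous_iteratedFDeriv (mod_cast le_top)).bounded_above_of_compact_support
        ((hgc d).iteratedFDeriv k)
    choose C hC using h1
    obtain ⟨B, hB⟩ := norm_le_mul_pow_of_homogeneous (hQ d).continuous (hom d)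
    have hnn : ∀ k, 0 ≤ C k := fun k => (norm_nonneg _).trans (hC k 0)
    refine ⟨∑ k ∈ Finset.range (d + 1), C k + |B| + 1, ?_, fun k hk y => ?_, fun y => ?_⟩
    · have := Finset.sum_nonneg fun k (_ : k ∈ Finset.range (d + 1)) => hnn k
      positivity
    · have := Finset.single_le_sum (fun k _ => hnn k) (Finset.mem_range.2 (Nat.lt_succ_of_le hk))
      have h2 := abs_nonneg B
      linarith [hC k y]
    · refine (hB y).trans ?_
      gcongr
      have := Finset.sum_nonneg fun k (_ : k ∈ Finset.range (d + 1)) => hnn k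
      linarith [le_abs_self B]
  choose C hCpos hCd hCQ using hC
  -- Rescaling the cutoff to radius ε multiplies the k-th derivative of the d-th term by ε^{d-k}.
  -- For k < d this is at most ε, so ε C_d ≤ 2^{-d} bounds all these derivatives by a summable
  -- sequence.
  have hε : ∀ d, ∃ ε : ℝ, 0 < ε ∧ ε ≤ 1 ∧ ε * C d ≤ (1 / 2) ^ d := fun d =>
    ⟨min 1 ((1 / 2) ^ d / C d), lt_min one_pos (div_pos (by positivity) (hCpos d)),
      min_le_left _ _, by
        rw [← le_div_iff₀ (hCpos d)]; exact min_le_right _ _⟩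
  choose ε hε0 hε1 hεC using hε
  set f : ℕ → E → F := fun d x => ε d ^ d • g d ((ε d)⁻¹ • x) with hf
  have hfQ : ∀ d x, f d x = χ ((ε d)⁻¹ • x) • Q d x := by
    intro d x
    simp only [hf, hg]
    rw [hom, smul_comm (ε d ^ d), smul_smul (ε d ^ d), ← mul_pow, mul_inv_cancel₀ (hε0 d).ne',
      one_pow, one_smul]
  have hfs : ∀ d, ContDiff ℝ ∞ (f d) := fun d =>
    ((hgs d).comp (contDiff_const_smul _)).const_smul _
  have hfb : ∀ k d, k < d → ∀ x, ‖iteratedFDeriv ℝ k (f d) x‖ ≤ (1 / 2) ^ d := by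
    intro k d hkd x
    have h1 : iteratedFDeriv ℝ k (f d) x =
        ε d ^ d • ((ε d)⁻¹ ^ k • iteratedFDeriv ℝ k (g d) ((ε d)⁻¹ • x)) := by
      have h2 : ContDiff ℝ k (g d) := (hgs d).of_le (mod_cast le_top)
      simp only [hf]
      have h3 : ContDiff ℝ k fun y => g d ((ε d)⁻¹ • y) := h2.comp (contDiff_const_smul _)
      rw [iteratedFDeriv_const_smul_apply' h3.contDiffAt,
        iteratedFDeriv_comp_const_smul _ h2]
    rw [h1, norm_smul, norm_smul, norm_pow, norm_pow, norm_inv, Real.norm_of_nonneg (hε0 d).le]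
    obtain ⟨m, rfl⟩ : ∃ m, d = k + 1 + m := ⟨d - k - 1, by omega⟩
    have hne : ε (k + 1 + m) ≠ 0 := (hε0 _).ne'
    calc ε (k + 1 + m) ^ (k + 1 + m) * ((ε (k + 1 + m))⁻¹ ^ k * _)
        = ε (k + 1 + m) ^ m * (ε (k + 1 + m) *
            ‖iteratedFDeriv ℝ k (g (k + 1 + m)) ((ε (k + 1 + m))⁻¹ • x)‖) := by
          have h3 : ε (k + 1 + m) ^ (k + 1 + m) * (ε (k + 1 + m))⁻¹ ^ k =
              ε (k + 1 + m) ^ m * ε (k + 1 + m) := by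
            rw [inv_pow, ← div_eq_mul_inv, div_eq_iff (pow_ne_zero _ hne)]
            ring
          rw [← mul_assoc, h3, mul_assoc]
      _ ≤ 1 * (ε (k + 1 + m) * C (k + 1 + m)) := by
          gcongr
          · exact mul_nonneg (hε0 _).le (norm_nonneg _)
          · exact pow_le_one₀ (hε0 _).le (hε1 _)
          · exact (hε0 _).le
          · exact hCd _ _ (by omega) _
      _ ≤ _ := by rw [one_mul]; exact hεC _
  have hgeo : Summable fun d : ℕ => (1 / 2 : ℝ) ^ d := summable_geometric_two
  have hfsum : ∀ x, Summable fun d => f d x := by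
    intro x
    refine Summable.of_norm_bounded_eventually_nat hgeo ?_
    filter_upwards [eventually_gt_atTop 0] with d hd
    simpa using hfb 0 d hd x
  refine ⟨fun x => ∑' d, f d x, ?_, fun N => ?_⟩
  · refine contDiff_tsum_of_eventually (N := ⊤) (v := fun _ d => (1 / 2 : ℝ) ^ d) hfs
      (fun _ _ => hgeo) fun k _ => ?_
    rw [Nat.cofinite_eq_atTop]
    filter_upwards [eventually_gt_atTop k] with d hd x using hfb k d hd x
  · refine IsBigO.of_bound 2 ?_
    have hev : ∀ᶠ x in 𝓝 (0 : E), ∀ d ∈ Finset.range (N + 1), f d x = Q d x := by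
      rw [eventually_all_finset]
      intro d _
      have hc : Tendsto (fun x : E => (ε d)⁻¹ • x) (𝓝 0) (𝓝 0) := by
        have : Continuous fun x : E => (ε d)⁻¹ • x := by fun_prop
        simpa using this.tendsto 0
      filter_upwards [hc.eventually χ.eventuallyEq_one] with x hx
      rw [hfQ, hx]; simp
    filter_upwards [hev] with x hx
    rw [← (hfsum x).sum_add_tsum_nat_add (N + 1), Finset.sum_congr rfl hx, add_sub_cancel_left]
    -- Outside the ball of radius ε_D the cutoff vanishes. Inside it one factor |x| ≤ ε_D absorbs
    -- the constant C_D and N other factors are kept, which is possible because D ≥ N + 1.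
    have hterm : ∀ d, ‖f (d + (N + 1)) x‖ ≤ ‖x‖ ^ N * (1 / 2) ^ d := by
      intro d
      set D := d + (N + 1) with hD
      rw [hfQ, norm_smul, Real.norm_of_nonneg χ.nonneg]
      by_cases hxe : ε D ≤ ‖x‖
      · rw [χ.zero_of_le_dist (by
          rw [dist_zero_right, norm_smul, norm_inv, Real.norm_of_nonneg (hε0 D).le]
          change (1 : ℝ) ≤ _
          rw [le_inv_mul_iff₀ (hε0 D)]; simpa using hxe), zero_mul]
        positivity
      · push Not at hxe
        calc χ ((ε D)⁻¹ • x) * ‖Q D x‖ ≤ 1 * (C D * ‖x‖ ^ D) :=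
              mul_le_mul χ.le_one (hCQ D x) (norm_nonneg _) zero_le_one
          _ = ‖x‖ ^ N * (‖x‖ ^ d * (‖x‖ * C D)) := by rw [hD]; ring
          _ ≤ ‖x‖ ^ N * (1 * (ε D * C D)) := by
              have := (hCpos D).le
              gcongr
              exact pow_le_one₀ (norm_nonneg _) (hxe.le.trans (hε1 D))
          _ ≤ ‖x‖ ^ N * (1 / 2) ^ d := by
              rw [one_mul]
              gcongr
              refine (hεC D).trans ?_
              exact pow_le_pow_of_le_one (by norm_num) (by norm_num) (by omega)
    have := tsum_of_norm_bounded (hasSum_geometric_two.mul_left (‖x‖ ^ N)) hterm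
    rw [norm_pow, norm_norm]
    linarith

/-- The monomial `x ↦ ∏ⱼ x_{s j}`. -/
def monomialFun {ι : Type} {d : ℕ} (s : Fin d → ι) (x : ι → ℝ) : ℝ :=
  ∏ j, x (s j)

theorem contDiff_monomialFun {ι : Type} [Fintype ι] {d : ℕ} (s : Fin d → ι) :
    ContDiff ℝ ∞ (monomialFun s) :=
  contDiff_prod fun j _ => contDiff_apply ℝ ℝ (s j)

theorem monomialFun_smul {ι : Type} {d : ℕ} (s : Fin d → ι) (c : ℝ) (x : ι → ℝ) :
    monomialFun s (c • x) = c ^ d • monomialFun s x := by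
  simp [monomialFun, Finset.prod_mul_distrib]

theorem fderiv_monomialFun_apply {ι : Type} [Fintype ι] {d : ℕ} (s : Fin d → ι) (x v : ι → ℝ) :
    fderiv ℝ (monomialFun s) x v = ∑ j, (∏ l ∈ Finset.univ.erase j, x (s l)) * v (s j) := by
  have h : HasFDerivAt (monomialFun s) _ x :=
    HasFDerivAt.finsetProd (u := Finset.univ) (g := fun j (x : ι → ℝ) => x (s j))
      (g' := fun j => (ContinuousLinearMap.proj (s j) : (ι → ℝ) →L[ℝ] ℝ)) fun j _ =>
        (ContinuousLinearMap.proj (s j) : (ι → ℝ) →L[ℝ] ℝ).hasFDerivAt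
  rw [h.fderiv]
  simp

theorem fderiv_monomialFun_diag {ι : Type} [Fintype ι] {d : ℕ} (s : Fin d → ι) (lam x : ι → ℝ) :
    fderiv ℝ (monomialFun s) x (fun i => lam i * x i) = (∑ j, lam (s j)) * monomialFun s x := by
  rw [fderiv_monomialFun_apply, Finset.sum_mul]
  refine Finset.sum_congr rfl fun j hj => ?_
  rw [monomialFun, ← Finset.prod_erase_mul _ _ hj]
  ring

theorem norm_fderiv_monomialFun_apply_le {ι : Type} [Fintype ι] {d : ℕ} (s : Fin d → ι)
    (x v : ι → ℝ) : ‖fderiv ℝ (monomialFun s) x v‖ ≤ d * (‖x‖ ^ (d - 1) * ‖v‖) := by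
  rw [fderiv_monomialFun_apply]
  refine (norm_sum_le_of_le _ (f := fun j => (∏ l ∈ Finset.univ.erase j, x (s l)) * v (s j))
    (n := fun _ => ‖x‖ ^ (d - 1) * ‖v‖) fun j hj => ?_).trans (by simp)
  rw [norm_mul, norm_prod]
  gcongr
  · refine (Finset.prod_le_prod (fun _ _ => norm_nonneg _)
      fun l _ => norm_le_pi_norm x (s l)).trans ?_
    simp [Finset.card_erase_of_mem hj]
  · exact norm_le_pi_norm v _

/-! ### Taylor remainders and leading homogeneous terms. -/

theorem isBigO_taylor_remainder {E F : Type*} [NormedAddCommGroup E] [NormedSpace ℝ E]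
    [NormedAddCommGroup F] [NormedSpace ℝ F] [CompleteSpace F] {r : E → F}
    (hr : ContDiff ℝ ∞ r) (n : ℕ) :
    (fun y => r y - ∑ k ∈ Finset.range (n + 1), ((k.factorial : ℝ)⁻¹) •
      iteratedFDeriv ℝ k r 0 fun _ => y) =O[𝓝 0] fun y => ‖y‖ ^ (n + 1) := by
  have hc : Continuous (iteratedFDeriv ℝ (n + 1) r) :=
    hr.continuous_iteratedFDeriv (mod_cast le_top)
  set B := ‖iteratedFDeriv ℝ (n + 1) r 0‖ + 1 with hB
  obtain ⟨δ, hδ, hball⟩ := Metric.eventually_nhds_iff_ball.1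
    ((hc.norm.tendsto 0).eventually_lt_const (lt_add_one ‖iteratedFDeriv ℝ (n + 1) r 0‖))
  refine IsBigO.of_bound (((n.factorial : ℝ)⁻¹) * B) ?_
  filter_upwards [Metric.ball_mem_nhds (0 : E) hδ] with y hy
  rw [mem_ball_zero_iff] at hy
  have h1 := map_add_eq_sum_add_integral_iteratedFDeriv (f := r) (x := 0) (y := y) (n := n)
    fun t _ => (hr.of_le (mod_cast le_top)).contDiffAt
  rw [zero_add] at h1
  rw [h1, add_sub_cancel_left, norm_smul, norm_inv, Real.norm_natCast, norm_pow, norm_norm,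
    mul_assoc]
  gcongr
  have := intervalIntegral.norm_integral_le_of_norm_le_const (a := 0) (b := 1)
    (C := B * ‖y‖ ^ (n + 1))
    (f := fun t : ℝ => (1 - t) ^ n • iteratedFDeriv ℝ (n + 1) r (0 + t • y) fun _ => y)
    fun t ht => by
      rw [uIoc_of_le zero_le_one] at ht
      have hty : ‖(0 : E) + t • y‖ < δ := by
        rw [zero_add, norm_smul, Real.norm_of_nonneg ht.1.le]
        exact (mul_le_of_le_one_left (norm_nonneg _) ht.2).trans_lt hy
      rw [norm_smul, norm_pow, Real.norm_of_nonneg (by linarith [ht.2])]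
      calc (1 - t) ^ n * ‖_‖ ≤ 1 * (B * ‖y‖ ^ (n + 1)) := by
            refine mul_le_mul (pow_le_one₀ (by linarith [ht.2]) (by linarith [ht.1])) ?_
              (norm_nonneg _) zero_le_one
            refine ((iteratedFDeriv ℝ (n + 1) r (0 + t • y)).le_opNorm _).trans ?_
            simp only [Finset.prod_const, Finset.card_univ, Fintype.card_fin]
            gcongr
            exact (hball _ (mem_ball_zero_iff.2 hty)).le
        _ = _ := one_mul _
  simpa using this

/-- Along the ray t ↦ t y the lower Taylor terms vanish by induction, so t^k a is O(t^{k+1}), where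
a is the k-th derivative on the diagonal up to a factorial. Dividing by t^k and letting t → 0 gives
a = 0. -/
theorem iteratedFDeriv_diag_eq_zero_of_isBigO {E F : Type*} [NormedAddCommGroup E]
    [NormedSpace ℝ E] [NormedAddCommGroup F] [NormedSpace ℝ F] [CompleteSpace F] {r : E → F}
    (hr : ContDiff ℝ ∞ r) {N : ℕ} (hO : r =O[𝓝 0] fun x => ‖x‖ ^ N) {k : ℕ} (hk : k < N) (y : E) :
    (iteratedFDeriv ℝ k r 0 fun _ => y) = 0 := by
  induction k using Nat.strong_induction_on with
  | _ k ih =>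
    have h1 := isBigO_taylor_remainder hr k
    have h2 : r =O[𝓝 0] fun x => ‖x‖ ^ (k + 1) := hO.trans (by
      refine IsBigO.of_bound 1 ?_
      filter_upwards [Metric.ball_mem_nhds (0 : E) one_pos] with x hx
      rw [mem_ball_zero_iff] at hx
      simp only [norm_pow, norm_norm, one_mul]
      exact pow_le_pow_of_le_one (norm_nonneg _) hx.le hk)
    have h3 := h2.sub h1
    simp only [sub_sub_cancel] at h3
    have hcont : Tendsto (fun t : ℝ => t • y) (𝓝 0) (𝓝 0) := by
      have : Continuous fun t : ℝ => t • y := by fun_prop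
      simpa using this.tendsto 0
    have h4 := h3.comp_tendsto hcont
    set a := iteratedFDeriv ℝ k r 0 fun _ => y with ha
    have h5 : ((fun x => ∑ j ∈ Finset.range (k + 1), ((j.factorial : ℝ)⁻¹) •
        iteratedFDeriv ℝ j r 0 fun _ => x) ∘ fun t : ℝ => t • y) =
        fun t => t ^ k • (((k.factorial : ℝ)⁻¹) • a) := by
      funext t
      have hmul : ∀ j, (iteratedFDeriv ℝ j r 0 fun _ => t • y) =
          t ^ j • iteratedFDeriv ℝ j r 0 fun _ => y := fun j => by
        have := (iteratedFDeriv ℝ j r 0).map_smul_univ (fun _ => t) (fun _ => y)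
        simpa using this
      simp only [Function.comp]
      rw [Finset.sum_range_succ, Finset.sum_eq_zero, zero_add, hmul, smul_comm]
      intro j hj
      rw [Finset.mem_range] at hj
      rw [hmul, ih j hj (hj.trans hk), smul_zero, smul_zero]
    rw [h5] at h4
    obtain ⟨c, hc⟩ := h4.bound
    have h6 : ∀ᶠ t : ℝ in 𝓝[≠] 0, ‖((k.factorial : ℝ)⁻¹) • a‖ ≤ c * (‖t‖ * ‖y‖ ^ (k + 1)) := by
      filter_upwards [hc.filter_mono nhdsWithin_le_nhds, self_mem_nhdsWithin] with t ht ht0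
      have htp : 0 < ‖t‖ ^ k := pow_pos (norm_pos_iff.2 ht0) _
      simp only [Function.comp, norm_smul t y, norm_pow, norm_mul, norm_norm] at ht
      rw [norm_smul, norm_pow] at ht
      refine le_of_mul_le_mul_left (ht.trans (le_of_eq ?_)) htp
      rw [mul_pow]; ring
    have h7 : Tendsto (fun t : ℝ => c * (‖t‖ * ‖y‖ ^ (k + 1))) (𝓝[≠] 0) (𝓝 0) := by
      have : Continuous fun t : ℝ => c * (‖t‖ * ‖y‖ ^ (k + 1)) := by fun_prop
      have := this.tendsto 0
      simp only [norm_zero, zero_mul, mul_zero] at this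
      exact this.mono_left nhdsWithin_le_nhds
    have h8 := le_of_tendsto_of_tendsto tendsto_const_nhds h7 h6
    have h9 : ((k.factorial : ℝ)⁻¹) • a = 0 := norm_le_zero_iff.1 h8
    exact (smul_eq_zero.1 h9).resolve_left (by positivity)

/-- Expanding the symmetric multilinear form of order N in the standard basis gives the
coefficients. Monomials are indexed by maps `Fin N → ι` instead of multi-indices; repetitions do no
harm. -/
theorem exists_leading_homogeneous {ι : Type} [Fintype ι] {r : (ι → ℝ) → ℝ}
    (hr : ContDiff ℝ ∞ r) {N : ℕ} (hO : r =O[𝓝 0] fun x => ‖x‖ ^ N) :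
    ∃ c : (Fin N → ι) → ℝ,
      (fun x => r x - ∑ s, c s * monomialFun s x) =O[𝓝 0] fun x => ‖x‖ ^ (N + 1) := by
  classical
  refine ⟨fun s => ((N.factorial : ℝ)⁻¹) * iteratedFDeriv ℝ N r 0 fun j => Pi.single (s j) 1,
    (isBigO_taylor_remainder hr N).congr_left fun x => ?_⟩
  rw [Finset.sum_range_succ, Finset.sum_eq_zero, zero_add]
  · congr 1
    have h1 : x = ∑ i, x i • (Pi.single i 1 : ι → ℝ) := pi_eq_sum_univ' x
    conv_lhs => rw [h1, ContinuousMultilinearMap.map_sum]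
    rw [Finset.smul_sum]
    refine Finset.sum_congr rfl fun s _ => ?_
    rw [ContinuousMultilinearMap.map_smul_univ, monomialFun, smul_eq_mul, smul_eq_mul]
    ring
  · intro k hk
    rw [iteratedFDeriv_diag_eq_zero_of_isBigO hr hO (Finset.mem_range.1 hk), smul_zero]

theorem isBigO_pow_of_le {E F : Type*} [NormedAddCommGroup E] [NormedAddCommGroup F] {f : E → F}
    {m n : ℕ} (hf : f =O[𝓝 0] fun x => ‖x‖ ^ n) (hmn : m ≤ n) : f =O[𝓝 0] fun x => ‖x‖ ^ m := by
  refine hf.trans (IsBigO.of_bound 1 ?_)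
  filter_upwards [Metric.ball_mem_nhds (0 : E) one_pos] with x hx
  rw [mem_ball_zero_iff] at hx
  simp only [norm_pow, norm_norm, one_mul]
  exact pow_le_pow_of_le_one (norm_nonneg _) hx.le hmn

/-- The monomial with indices s is an eigenvector of P ↦ dP(Λx) - λ_i P with eigenvalue Σ_j λ_{s j}
- λ_i, which is nonzero by nonresonance. Dividing the leading error term by it raises the order of
the error by one. -/
theorem exists_homological_correction {ι : Type} [Fintype ι] {lam : ι → ℝ} {i : ι}
    {V : (ι → ℝ) → ι → ℝ} (hV : ContDiff ℝ ∞ V)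
    (h2 : (fun x => V x - fun j => lam j * x j) =O[𝓝 0] fun x => ‖x‖ ^ 2) {N : ℕ} (hN : 1 ≤ N)
    (hres : ∀ s : Fin N → ι, ∑ j, lam (s j) ≠ lam i) {P : (ι → ℝ) → ℝ} (hP : ContDiff ℝ ∞ P)
    (hPN : (fun x => fderiv ℝ P x (V x) - lam i * P x) =O[𝓝 0] fun x => ‖x‖ ^ N) :
    ∃ Q : (ι → ℝ) → ℝ, ContDiff ℝ ∞ Q ∧ (∀ (c : ℝ) x, Q (c • x) = c ^ N • Q x) ∧
      (fun x => fderiv ℝ (P + Q) x (V x) - lam i * (P + Q) x) =O[𝓝 0] fun x => ‖x‖ ^ (N + 1) := by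
  obtain ⟨c, hc⟩ := exists_leading_homogeneous
    (((hP.fderiv_right (m := ∞) (by simp)).clm_apply hV).sub (contDiff_const.mul hP)) hPN
  set q : (Fin N → ι) → ℝ := fun s => c s / (lam i - ∑ j, lam (s j)) with hq
  have hqs : ContDiff ℝ ∞ fun x => ∑ s, q s * monomialFun s x :=
    ContDiff.sum fun s _ => contDiff_const.mul (contDiff_monomialFun s)
  refine ⟨fun x => ∑ s, q s * monomialFun s x, hqs, fun r x => ?_, ?_⟩
  · rw [Finset.smul_sum]
    refine Finset.sum_congr rfl fun s _ => ?_
    rw [monomialFun_smul, smul_eq_mul, smul_eq_mul]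
    ring
  · have hdq : ∀ x v, fderiv ℝ (fun x => ∑ s, q s * monomialFun s x) x v =
        ∑ s, q s * fderiv ℝ (monomialFun s) x v := by
      intro x v
      have h : HasFDerivAt (fun x => ∑ s, q s * monomialFun s x)
          (∑ s, q s • fderiv ℝ (monomialFun s) x) x :=
        HasFDerivAt.fun_sum fun s _ =>
          (((contDiff_monomialFun s).differentiable (by simp) x).hasFDerivAt).const_mul (q s)
      rw [h.fderiv]
      simp
    -- The nonlinear part of `V` does not disturb degree N: dQ has degree N - 1 and V - Λ has order
    -- 2.
    have hrem : (fun x => ∑ s, q s * fderiv ℝ (monomialFun s) x (V x - fun j => lam j * x j))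
        =O[𝓝 0] fun x => ‖x‖ ^ (N + 1) := by
      refine IsBigO.fun_sum fun s _ => IsBigO.const_mul_left ?_ _
      have h3 : (fun x => fderiv ℝ (monomialFun s) x (V x - fun j => lam j * x j)) =O[𝓝 0]
          fun x => ‖x‖ ^ (N - 1) * ‖V x - fun j => lam j * x j‖ := by
        refine IsBigO.of_bound N (Eventually.of_forall fun x => ?_)
        rw [norm_mul, norm_pow, norm_norm, norm_norm]
        exact norm_fderiv_monomialFun_apply_le s x _
      refine (h3.trans ((isBigO_refl _ _).mul h2.norm_left)).congr_right fun x => ?_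
      rw [← pow_add]
      congr 1
      omega
    refine (hc.add hrem).congr_left fun x => ?_
    have hd : fderiv ℝ (P + fun x => ∑ s, q s * monomialFun s x) x =
        fderiv ℝ P x + fderiv ℝ (fun x => ∑ s, q s * monomialFun s x) x :=
      fderiv_add (hP.differentiable (by simp) x) (hqs.differentiable (by simp) x)
    rw [hd, add_apply, hdq, Pi.add_apply, mul_add, Finset.mul_sum]
    have hs : ∀ s, q s * fderiv ℝ (monomialFun s) x (V x - fun j => lam j * x j) =
        q s * fderiv ℝ (monomialFun s) x (V x) - lam i * (q s * monomialFun s x) +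
          c s * monomialFun s x := by
      intro s
      have hne : lam i - ∑ j, lam (s j) ≠ 0 := sub_ne_zero.2 (hres s).symm
      have hcq : c s = q s * (lam i - ∑ j, lam (s j)) := by
        rw [hq]; field_simp
      rw [map_sub, fderiv_monomialFun_diag, hcq]
      ring
    rw [Finset.sum_congr rfl fun s _ => hs s, Finset.sum_add_distrib, Finset.sum_sub_distrib]
    ring

/-- Starting from x_i, the homological correction is applied in degrees 2, 3, …, and Borel's lemma
sums the corrections to one smooth function with flat defect. -/
theorem exists_formal_eigenfunction {ι : Type} [Fintype ι] {lam : ι → ℝ} {i : ι}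
    (hres : ∀ d, 2 ≤ d → ∀ s : Fin d → ι, ∑ j, lam (s j) ≠ lam i)
    {V : (ι → ℝ) → ι → ℝ} (hV : ContDiff ℝ ∞ V)
    (h2 : (fun x => V x - fun j => lam j * x j) =O[𝓝 0] fun x => ‖x‖ ^ 2) :
    ∃ P : (ι → ℝ) → ℝ, ContDiff ℝ ∞ P ∧ (fun x => P x - x i) =O[𝓝 0] (fun x => ‖x‖ ^ 2) ∧
      IsFlat fun x => fderiv ℝ P x (V x) - lam i * P x := by
  have hx : ContDiff ℝ ∞ fun x : ι → ℝ => x i := contDiff_apply ℝ ℝ i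
  have hdx : ∀ x : ι → ℝ, HasFDerivAt (fun x : ι → ℝ => x i)
      (ContinuousLinearMap.proj i : (ι → ℝ) →L[ℝ] ℝ) x := fun x =>
    (ContinuousLinearMap.proj i : (ι → ℝ) →L[ℝ] ℝ).hasFDerivAt
  have hx2 : (fun x => fderiv ℝ (fun x : ι → ℝ => x i) x (V x) - lam i * x i) =O[𝓝 0]
      fun x => ‖x‖ ^ 2 := by
    refine (IsBigO.of_bound 1 (Eventually.of_forall fun x => ?_)).trans h2
    rw [(hdx x).fderiv, one_mul]
    exact norm_le_pi_norm (V x - fun j => lam j * x j) i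
  let S : ℕ → Type := fun n => {P : (ι → ℝ) → ℝ // ContDiff ℝ ∞ P ∧
    (fun x => fderiv ℝ P x (V x) - lam i * P x) =O[𝓝 0] fun x => ‖x‖ ^ (n + 2)}
  have hstep : ∀ n (P : S n), ∃ Q : (ι → ℝ) → ℝ, ContDiff ℝ ∞ Q ∧
      (∀ (c : ℝ) x, Q (c • x) = c ^ (n + 2) • Q x) ∧
      (fun x => fderiv ℝ (P.1 + Q) x (V x) - lam i * (P.1 + Q) x) =O[𝓝 0]
        fun x => ‖x‖ ^ (n + 3) := fun n P =>
    exists_homological_correction hV h2 (by omega) (hres (n + 2) (by omega)) P.2.1 P.2.2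
  choose step hstep1 hstep2 hstep3 using hstep
  -- `p n` is the partial sum through degree n + 1, with defect of order n + 2; the shift by two is
  -- due to the recursion starting at the linear function x_i.
  let p : ∀ n, S n := fun n => Nat.rec ⟨fun x => x i, hx, hx2⟩
    (fun n P => ⟨P.1 + step n P, P.2.1.add (hstep1 n P), hstep3 n P⟩) n
  let Q : ℕ → (ι → ℝ) → ℝ
    | 0 => fun _ => 0
    | 1 => fun x => x i
    | n + 2 => step n (p n)
  have hQs : ∀ d, ContDiff ℝ ∞ (Q d) := by
    rintro (_ | _ | n)
    · exact contDiff_const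
    · exact hx
    · exact hstep1 n (p n)
  have hQh : ∀ d (c : ℝ) x, Q d (c • x) = c ^ d • Q d x := by
    rintro (_ | _ | n) c x
    · simp [Q]
    · simp [Q]
    · exact hstep2 n (p n) c x
  have hsum : ∀ n x, ∑ d ∈ Finset.range (n + 2), Q d x = (p n).1 x := by
    intro n x
    induction n with
    | zero => simp [Finset.sum_range_succ, Q, p]
    | succ n ih =>
      rw [Finset.sum_range_succ, ih]
      rfl
  obtain ⟨P, hP, hPQ⟩ := exists_contDiff_of_homogeneous_series hQs hQh
  have hPp : ∀ n, (fun x => P x - (p n).1 x) =O[𝓝 0] fun x => ‖x‖ ^ (n + 1) := fun n =>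
    (hPQ (n + 1)).congr_left fun x => by rw [hsum]
  refine ⟨P, hP, ?_, fun N => ?_⟩
  · have h3 : (fun x => (p 1).1 x - x i) =O[𝓝 0] fun x : ι → ℝ => ‖x‖ ^ 2 := by
      obtain ⟨B, hB⟩ := norm_le_mul_pow_of_homogeneous (hQs 2).continuous (hQh 2)
      refine IsBigO.of_bound B (Eventually.of_forall fun x => ?_)
      rw [← hsum, Finset.sum_range_succ, hsum 0, norm_pow, norm_norm]
      have : (p 0).1 x = x i := rfl
      rw [this, add_sub_cancel_left]
      exact hB x
    exact ((hPp 1).add h3).congr_left fun x => by ring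
  · rcases Nat.eq_zero_or_pos N with rfl | hN
    · have hc : Continuous fun x => fderiv ℝ P x (V x) - lam i * P x :=
        ((hP.continuous_fderiv (by simp)).clm_apply hV.continuous).sub
          (continuous_const.mul hP.continuous)
      simpa using hc.continuousAt.isBigO_one ℝ
    -- Comparison with the partial sum of index 2N, not N, since passing to the derivative halves
    -- the order of the remainder.
    set R : (ι → ℝ) → ℝ := fun x => P x - (p (2 * N)).1 x with hR
    have hRs : ContDiff ℝ ∞ R := hP.sub (p (2 * N)).2.1
    have hRO : R =O[𝓝 0] fun x => ‖x‖ ^ (2 * N) := isBigO_pow_of_le (hPp (2 * N)) (by omega)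
    have hRd := fderiv_isBigO_of_isBigO (hRs.contDiffAt.of_le (by norm_cast)) hN hRO
    have hV1 : V =O[𝓝 0] fun _ => (1 : ℝ) := hV.continuous.continuousAt.isBigO_one ℝ
    have h4 : (fun x => fderiv ℝ R x (V x)) =O[𝓝 0] fun x => ‖x‖ ^ N := by
      refine (IsBigO.of_bound 1 (Eventually.of_forall fun x => ?_) :
        _ =O[𝓝 0] fun x => ‖fderiv ℝ R x‖ * ‖V x‖).trans
        ((hRd.norm_left.mul hV1.norm_left).congr_right fun x => mul_one _)
      rw [one_mul, norm_mul, norm_norm, norm_norm]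
      exact (fderiv ℝ R x).le_opNorm _
    have h5 := (isBigO_pow_of_le hRO (by omega : N ≤ 2 * N)).const_mul_left (lam i)
    have h6 := isBigO_pow_of_le (p (2 * N)).2.2 (by omega : N ≤ 2 * N + 2)
    refine ((h4.sub h5).add h6).congr_left fun x => ?_
    have hd : fderiv ℝ R x = fderiv ℝ P x - fderiv ℝ (p (2 * N)).1 x :=
      fderiv_sub (hP.differentiable (by simp) x) ((p (2 * N)).2.1.differentiable (by simp) x)
    rw [hd, sub_apply, hR]
    ring

/-- A nonresonant vector field is linear, up to a flat remainder, in suitable coordinates `P`. -/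
theorem exists_formal_linearization {ι : Type} [Fintype ι] {lam : ι → ℝ}
    (hres : ∀ d, 2 ≤ d → ∀ (s : Fin d → ι) (i : ι), ∑ j, lam (s j) ≠ lam i)
    {V : (ι → ℝ) → ι → ℝ} (hV : ContDiff ℝ ∞ V)
    (h2 : (fun x => V x - fun j => lam j * x j) =O[𝓝 0] fun x => ‖x‖ ^ 2) :
    ∃ P : (ι → ℝ) → ι → ℝ, ContDiff ℝ ∞ P ∧ P 0 = 0 ∧
      HasFDerivAt P (ContinuousLinearMap.id ℝ (ι → ℝ)) 0 ∧
      IsFlat fun x => fderiv ℝ P x (V x) - fun i => lam i * P x i := by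
  choose P hP hPx hflat using fun i =>
    exists_formal_eigenfunction (i := i) (fun d hd s => hres d hd s i) hV h2
  have hPs : ContDiff ℝ ∞ fun x i => P i x := contDiff_pi.2 hP
  have hO : (fun x => (fun i => P i x) - x) =O[𝓝 0] fun x : ι → ℝ => ‖x‖ ^ 2 :=
    isBigO_pi.2 fun i => hPx i
  have h0 : (fun i => P i 0) = (0 : ι → ℝ) := by
    obtain ⟨C, hC⟩ := hO.bound
    simpa using hC.self_of_nhds
  refine ⟨fun x i => P i x, hPs, h0, ?_, fun N => ?_⟩
  · have h1 : HasFDerivAt (fun x => (fun i => P i x) - x) (0 : (ι → ℝ) →L[ℝ] (ι → ℝ)) 0 :=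
      IsBigO.hasFDerivAt (n := 2) (by simpa using hO) one_lt_two
    have h3 := h1.add (hasFDerivAt_id (𝕜 := ℝ) (0 : ι → ℝ))
    simp only [zero_add] at h3
    refine h3.congr_of_eventuallyEq (Eventually.of_forall fun x => ?_)
    simp
  · refine isBigO_pi.2 fun i => (hflat i N).congr_left fun x => ?_
    have h1 : HasFDerivAt (fun x i => P i x) (ContinuousLinearMap.pi fun i => fderiv ℝ (P i) x) x :=
      hasFDerivAt_pi.2 fun i => ((hP i).differentiable (by simp) x).hasFDerivAt
    rw [h1.fderiv]
    rfl

end Borel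

/-! ### Straightening the invariant manifolds -/

section Straightening

theorem IsFlat.comp_of_differentiableAt {E F G : Type*} [NormedAddCommGroup E] [NormedSpace ℝ E]
    [NormedAddCommGroup F] [NormedSpace ℝ F] [NormedAddCommGroup G] {h : F → G} (hh : IsFlat h)
    {g : E → F} (hg : DifferentiableAt ℝ g 0) (hg0 : g 0 = 0) : IsFlat fun x => h (g x) := by
  intro N
  have h1 : Tendsto g (𝓝 0) (𝓝 0) := by simpa [hg0] using hg.continuousAt.tendsto
  have h2 : g =O[𝓝 0] fun x => x := by simpa [hg0] using hg.hasFDerivAt.isBigO_sub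
  exact ((hh N).comp_tendsto h1).trans (h2.norm_norm.pow N)

theorem IsFlat.clm_apply {E F G : Type*} [NormedAddCommGroup E] [NormedAddCommGroup F]
    [NormedSpace ℝ F] [NormedAddCommGroup G] [NormedSpace ℝ G] {r : E → F} (hr : IsFlat r)
    {A : E → F →L[ℝ] G} (hA : ContinuousAt A 0) : IsFlat fun x => A x (r x) := by
  intro N
  have h1 : A =O[𝓝 0] fun _ => (1 : ℝ) := hA.isBigO_one ℝ
  refine (IsBigO.of_bound 1 (Eventually.of_forall fun x => ?_) :
    _ =O[𝓝 0] fun x => ‖A x‖ * ‖r x‖).trans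
      ((h1.norm_left.mul (hr N).norm_left).congr_right fun x => one_mul _)
  rw [one_mul, norm_mul, norm_norm, norm_norm]
  exact (A x).le_opNorm _

theorem IsFlat.sub {E F : Type*} [NormedAddCommGroup E] [NormedAddCommGroup F] {f g : E → F}
    (hf : IsFlat f) (hg : IsFlat g) : IsFlat fun x => f x - g x := fun N => (hf N).sub (hg N)

theorem IsFlat.congr {E F : Type*} [NormedAddCommGroup E] [NormedAddCommGroup F] {f g : E → F}
    (hf : IsFlat f) (h : f =ᶠ[𝓝 0] g) : IsFlat g := fun N => (hf N).congr' h EventuallyEq.rfl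

/-- Multiplication of coordinates by `lam`. -/
noncomputable def diagCLM {ι : Type} [Fintype ι] (lam : ι → ℝ) : (ι → ℝ) →L[ℝ] (ι → ℝ) :=
  ContinuousLinearMap.pi fun i => lam i • ContinuousLinearMap.proj i

@[simp]
theorem diagCLM_apply {ι : Type} [Fintype ι] (lam x : ι → ℝ) :
    diagCLM lam x = fun i => lam i * x i :=
  rfl

/-- Coordinates in which the vector field is linear up to a flat remainder. -/
theorem exists_flat_coordinates {ι : Type} [Fintype ι] {lam : ι → ℝ}
    (hres : ∀ d, 2 ≤ d → ∀ (s : Fin d → ι) (i : ι), ∑ j, lam (s j) ≠ lam i)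
    {V : (ι → ℝ) → ι → ℝ} {O : Set (ι → ℝ)} (hO : O ∈ 𝓝 0) (hV : ContDiffOn ℝ ∞ V O)
    (h2 : (fun x => V x - diagCLM lam x) =O[𝓝 0] fun x => ‖x‖ ^ 2) :
    ∃ (θ : OpenPartialHomeomorph (ι → ℝ) (ι → ℝ)) (h : (ι → ℝ) → ι → ℝ),
      0 ∈ θ.source ∧ θ 0 = 0 ∧ θ.target ⊆ O ∧ ContDiffOn ℝ ∞ θ θ.source ∧
      ContDiffOn ℝ ∞ θ.symm θ.target ∧ ContDiff ℝ ∞ h ∧ IsFlat h ∧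
      ∀ y ∈ θ.source, V (θ y) = fderiv ℝ θ y (diagCLM lam y + h y) := by
  obtain ⟨W, hW, hWV⟩ := exists_contDiff_eventuallyEq hO hV
  have hW2 : (fun x => W x - fun i => lam i * x i) =O[𝓝 0] fun x => ‖x‖ ^ 2 :=
    h2.congr' (hWV.mono fun x hx => by simp [hx]) EventuallyEq.rfl
  obtain ⟨P, hP, hP0, hP', hPflat⟩ := exists_formal_linearization hres hW hW2
  obtain ⟨O', hO'sub, hO', h0O'⟩ := _root_.mem_nhds_iff.1 (inter_mem hO hWV)
  obtain ⟨e, h0e, heO, heP, hes, hder⟩ := exists_openPartialHomeomorph_of_contDiffOn hO' h0O'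
    hP.contDiffOn (f' := ContinuousLinearEquiv.refl ℝ (ι → ℝ)) hP'
  have h0t : (0 : ι → ℝ) ∈ e.target := by
    have := e.map_source h0e
    rwa [heP, hP0] at this
  have hs0 : e.symm 0 = 0 := by
    have := e.left_inv h0e
    rwa [heP, hP0] at this
  -- The push-forward of the field under `P`, minus its linear part. It is extended to a global
  -- smooth function, and the chart is then shrunk to where both agree.
  have hk : ContDiffOn ℝ ∞ (fun y => fderiv ℝ P (e.symm y) (W (e.symm y)) - diagCLM lam y)
      e.target :=
    (((hP.fderiv_right (m := ∞) (by simp)).comp_contDiffOn hes).clm_apply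
      (hW.comp_contDiffOn hes)).sub (diagCLM lam).contDiff.contDiffOn
  obtain ⟨h, hh, hhk⟩ := exists_contDiff_eventuallyEq (e.open_target.mem_nhds h0t) hk
  have hflat : IsFlat h := by
    have h1 : IsFlat fun y => fderiv ℝ P (e.symm y) (W (e.symm y)) -
        fun i => lam i * P (e.symm y) i :=
      hPflat.comp_of_differentiableAt (g := e.symm)
        ((hes.contDiffAt (e.open_target.mem_nhds h0t)).differentiableAt (by simp)) hs0
    refine h1.congr ?_
    filter_upwards [hhk, e.open_target.mem_nhds h0t] with y hy hyt
    have := e.right_inv hyt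
    rw [heP] at this
    rw [hy, diagCLM_apply, this]
  obtain ⟨T, hTsub, hT, h0T⟩ := _root_.mem_nhds_iff.1 (inter_mem (e.open_target.mem_nhds h0t) hhk)
  refine ⟨e.symm.restrOpen T hT, h, ⟨h0t, h0T⟩, hs0, ?_, hes.mono fun y hy => hy.1, ?_, hh, hflat,
    ?_⟩
  · intro x hx
    exact (hO'sub (heO hx.1)).1
  · refine (hP.contDiffOn (s := univ)).mono (subset_univ _) |>.congr fun x _ => ?_
    exact congrFun heP x
  · rintro y ⟨hyt, hyT⟩
    have hyt' : y ∈ e.target := hyt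
    have hsy := e.map_target hyt'
    obtain ⟨A, hA⟩ := hder _ hsy
    have hinv : HasFDerivAt e.symm (A.symm : (ι → ℝ) →L[ℝ] (ι → ℝ)) y :=
      e.hasFDerivAt_symm hyt' (by rw [heP]; exact hA)
    change V (e.symm y) = fderiv ℝ e.symm y _
    rw [(hTsub hyT).2, hinv.fderiv, add_sub_cancel, hA.fderiv]
    have : W (e.symm y) = V (e.symm y) := (hO'sub (heO hsy)).2
    rw [this]
    simp

/-- Projection to the coordinates satisfying a predicate. -/
noncomputable def selectCLM {ι : Type} [Fintype ι] (p : ι → Prop) [DecidablePred p] :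
    (ι → ℝ) →L[ℝ] (ι → ℝ) :=
  diagCLM fun i => if p i then 1 else 0

theorem selectCLM_apply {ι : Type} [Fintype ι] (p : ι → Prop) [DecidablePred p] (x : ι → ℝ)
    (i : ι) : selectCLM p x i = if p i then x i else 0 := by
  simp [selectCLM]

/-- The asymptotic parametrization is taken with `J` the projection to the contracting coordinates,
and precomposed with that projection. Using all of ι → ℝ as parameter space lets the stable and
unstable maps be added. -/
theorem exists_stable_parametrization {ι : Type} [Fintype ι] (lam : ι → ℝ)
    {h : (ι → ℝ) → ι → ℝ} (hs : ContDiff ℝ ∞ h) (hh : IsFlat h) :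
    ∃ (E : (ι → ℝ) → ι → ℝ) (O : Set (ι → ℝ)), IsOpen O ∧ 0 ∈ O ∧ ContDiffOn ℝ ∞ E O ∧ E 0 = 0 ∧
      HasFDerivAt E (selectCLM fun i => lam i < 0) 0 ∧
      (∀ z, E (selectCLM (fun i => lam i < 0) z) = E z) ∧
      ∀ z ∈ O, fderiv ℝ E z (diagCLM lam z) = diagCLM lam (E z) + h (E z) := by
  set J := selectCLM fun i => lam i < 0 with hJ
  set mu : ι → ℝ := fun i => if lam i < 0 then lam i else -1 with hmu
  have hJJ : ∀ z, J (J z) = J z := fun z => by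
    funext i
    simp only [hJ, selectCLM_apply]
    split_ifs <;> rfl
  have hmuJ : ∀ z, J (diagCLM lam z) = fun i => mu i * J z i := fun z => by
    funext i
    simp only [hJ, hmu, selectCLM_apply, diagCLM_apply]
    split_ifs <;> simp
  obtain ⟨e, O, hO, h0O, he, he0, he', heO⟩ := exists_asymptotic_parametrization lam mu
    (fun i => by simp only [hmu]; split_ifs with h <;> linarith) J
    (fun x i => by
      simp only [hJ, hmu, selectCLM_apply]
      split_ifs <;> simp) hs hh
  have hpre : IsOpen (J ⁻¹' O) := hO.preimage J.continuous
  refine ⟨fun z => e (J z), J ⁻¹' O, hpre, by simpa using h0O,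
    he.comp J.contDiff.contDiffOn fun z hz => hz, by simp [he0], ?_, fun z => congrArg e (hJJ z),
    fun z hz => ?_⟩
  · have h1 : HasFDerivAt e J (J 0) := by rw [map_zero]; exact he'
    refine (h1.comp (0 : ι → ℝ) J.hasFDerivAt).congr_fderiv ?_
    ext1 z
    exact hJJ z
  · have h1 : HasFDerivAt e (fderiv ℝ e (J z)) (J z) :=
      ((he.contDiffAt (hO.mem_nhds hz)).differentiableAt (by simp)).hasFDerivAt
    have h2 := h1.comp z J.hasFDerivAt
    change HasFDerivAt (fun z => e (J z)) _ z at h2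
    rw [h2.fderiv, ContinuousLinearMap.comp_apply, hmuJ, (heO _ hz).1]
    rfl

/-- Both E_s and E_u carry the linear field to Λ + h along their images. Their sum is therefore a
coordinate change with derivative the identity at 0, and its only defect is the failure of h to be
additive, h(E_s + E_u) - h(E_s) - h(E_u). This is flat, and it is zero where E_s or E_u vanishes,
that is on the two planes. -/
theorem exists_straightening {ι : Type} [Fintype ι] {lam : ι → ℝ} (hne : ∀ i, lam i ≠ 0)
    (hres : ∀ d, 2 ≤ d → ∀ (s : Fin d → ι) (i : ι), ∑ j, lam (s j) ≠ lam i)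
    {V : (ι → ℝ) → ι → ℝ} {O : Set (ι → ℝ)} (hO : O ∈ 𝓝 0) (hV : ContDiffOn ℝ ∞ V O)
    (h2 : (fun x => V x - diagCLM lam x) =O[𝓝 0] fun x => ‖x‖ ^ 2) :
    ∃ θ : OpenPartialHomeomorph (ι → ℝ) (ι → ℝ), 0 ∈ θ.source ∧ θ 0 = 0 ∧ θ.target ⊆ O ∧
      ContDiffOn ℝ ∞ θ θ.source ∧ ContDiffOn ℝ ∞ θ.symm θ.target ∧
      (IsFlat fun z => V (θ z) - fderiv ℝ θ z (diagCLM lam z)) ∧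
      ∀ z ∈ θ.source, ((∀ i, lam i < 0 → z i = 0) ∨ ∀ i, 0 < lam i → z i = 0) →
        V (θ z) = fderiv ℝ θ z (diagCLM lam z) := by
  obtain ⟨θ, h, h0θ, hθ0, hθO, hθs, hθs', hh, hflat, hθV⟩ := exists_flat_coordinates hres hO hV h2
  obtain ⟨Es, Os, hOs, h0s, hEs, hEs0, hEs', hEsJ, hEsO⟩ := exists_stable_parametrization lam hh hflat
  -- The expanding directions of Λ + h are the contracting ones of -Λ - h; the sign disappears again
  -- from the intertwining equation in `hEuO'`.
  obtain ⟨Eu, Ou, hOu, h0u, hEu, hEu0, hEu', hEuJ, hEuO⟩ :=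
    exists_stable_parametrization (fun i => -lam i) (h := fun x => -h x) hh.neg
      fun N => (hflat N).neg_left
  have hneg : ∀ z, diagCLM (fun i => -lam i) z = -diagCLM lam z := fun z => by
    funext i; simp
  have hEuO' : ∀ z ∈ Ou, fderiv ℝ Eu z (diagCLM lam z) = diagCLM lam (Eu z) + h (Eu z) := by
    intro z hz
    have := hEuO z hz
    rw [hneg, hneg, map_neg, ← neg_add, neg_inj] at this
    exact this
  have hid : (selectCLM fun i => lam i < 0) + (selectCLM fun i => -lam i < 0) =
      ContinuousLinearMap.id ℝ (ι → ℝ) := by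
    ext1 z
    funext i
    simp only [add_apply, Pi.add_apply, selectCLM_apply, ContinuousLinearMap.id_apply]
    rcases lt_or_gt_of_ne (hne i) with h | h
    · simp [h, h.le]
    · simp [h, h.le]
  have hκ' : HasFDerivAt (fun z => Es z + Eu z)
      ((ContinuousLinearEquiv.refl ℝ (ι → ℝ) : (ι → ℝ) ≃L[ℝ] (ι → ℝ)) : (ι → ℝ) →L[ℝ] (ι → ℝ)) 0 :=
    (hEs'.add hEu').congr_fderiv hid
  have hκ0 : Es 0 + Eu 0 = 0 := by rw [hEs0, hEu0, add_zero]
  have hκs : ContDiffOn ℝ ∞ (fun z => Es z + Eu z) (Os ∩ Ou) :=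
    (hEs.mono inter_subset_left).add (hEu.mono inter_subset_right)
  obtain ⟨e, h0e, heO, heκ, hes, -⟩ := exists_openPartialHomeomorph_of_contDiffOn
    (hOs.inter hOu) ⟨h0s, h0u⟩ hκs hκ'
  have hesrc : ContDiffOn ℝ ∞ e e.source := by rw [heκ]; exact hκs.mono heO
  set Θ := e.trans θ with hΘ
  have hΘsrc : ∀ z ∈ Θ.source, z ∈ e.source ∧ e z ∈ θ.source := fun z hz => by
    rw [hΘ, OpenPartialHomeomorph.trans_source] at hz; exact hz
  have h0Θ : (0 : ι → ℝ) ∈ Θ.source := by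
    rw [hΘ, OpenPartialHomeomorph.trans_source]
    refine ⟨h0e, ?_⟩
    have he0 : e 0 = 0 := by rw [heκ]; exact hκ0
    rw [mem_preimage, he0]
    exact h0θ
  have hrem : ∀ z ∈ Θ.source, V (Θ z) - fderiv ℝ Θ z (diagCLM lam z) =
      fderiv ℝ θ (e z) (h (Es z + Eu z) - h (Es z) - h (Eu z)) := by
    intro z hz
    obtain ⟨hz1, hz2⟩ := hΘsrc z hz
    have d1 : HasFDerivAt θ (fderiv ℝ θ (e z)) (e z) :=
      ((hθs.contDiffAt (θ.open_source.mem_nhds hz2)).differentiableAt (by simp)).hasFDerivAt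
    have dEs : HasFDerivAt Es (fderiv ℝ Es z) z :=
      ((hEs.contDiffAt (hOs.mem_nhds (heO hz1).1)).differentiableAt (by simp)).hasFDerivAt
    have dEu : HasFDerivAt Eu (fderiv ℝ Eu z) z :=
      ((hEu.contDiffAt (hOu.mem_nhds (heO hz1).2)).differentiableAt (by simp)).hasFDerivAt
    have d2 : HasFDerivAt e (fderiv ℝ Es z + fderiv ℝ Eu z) z := by
      rw [heκ]; exact dEs.add dEu
    have d3 : HasFDerivAt Θ _ z := d1.comp z d2
    have d4 : V (Θ z) = fderiv ℝ θ (e z) (diagCLM lam (e z) + h (e z)) := hθV _ hz2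
    rw [d3.fderiv, ContinuousLinearMap.comp_apply, d4, ← map_sub, add_apply,
      hEsO z (heO hz1).1, hEuO' z (heO hz1).2, heκ, map_add (diagCLM lam)]
    congr 1
    abel
  refine ⟨Θ, h0Θ, ?_, ?_, ?_, ?_, ?_, ?_⟩
  · change θ (e 0) = 0
    have he0 : e 0 = 0 := by rw [heκ]; exact hκ0
    rw [he0, hθ0]
  · intro x hx
    rw [hΘ, OpenPartialHomeomorph.trans_target] at hx
    exact hθO hx.1
  · exact hθs.comp (hesrc.mono fun z hz => (hΘsrc z hz).1) fun z hz => (hΘsrc z hz).2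
  · rw [hΘ, OpenPartialHomeomorph.trans_target]
    exact hes.comp (hθs'.mono inter_subset_left) fun x hx => hx.2
  · have hfl : IsFlat fun z => h (Es z + Eu z) - h (Es z) - h (Eu z) :=
      ((hflat.comp_of_differentiableAt hκ'.differentiableAt hκ0).sub
        (hflat.comp_of_differentiableAt hEs'.differentiableAt hEs0)).sub
        (hflat.comp_of_differentiableAt hEu'.differentiableAt hEu0)
    have hc : ContinuousAt (fun z => fderiv ℝ θ (e z)) 0 := by
      have h1 : ContinuousAt (fderiv ℝ θ) (e 0) :=
        (hθs.continuousOn_fderiv_of_isOpen θ.open_source (by simp)).continuousAt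
          (θ.open_source.mem_nhds (hΘsrc 0 h0Θ).2)
      exact ContinuousAt.comp h1 (e.continuousAt h0e)
    refine (hfl.clm_apply hc).congr ?_
    filter_upwards [Θ.open_source.mem_nhds h0Θ] with z hz
    exact (hrem z hz).symm
  · intro z hz hplane
    rw [← sub_eq_zero, hrem z hz]
    have hh0 := hflat.apply_zero
    rcases hplane with hp | hp
    -- E_s depends only on the contracting coordinates, all of which vanish here.
    · have : Es z = 0 := by
        rw [← hEsJ, ← hEs0]
        congr 1
        funext i
        rw [selectCLM_apply]
        split_ifs with hi
        · exact hp i hi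
        · rfl
      rw [this]; simp [hh0]
    · have : Eu z = 0 := by
        rw [← hEuJ, ← hEu0]
        congr 1
        funext i
        rw [selectCLM_apply]
        split_ifs with hi
        · exact hp i (by linarith)
        · rfl
      rw [this]; simp [hh0]

end Straightening

/-! ### Smooth dependence of solutions on the initial point -/

section Flow

/-- `u` solves `u' = v(u)` on `s`, staying in `S`. -/
def IsSolutionIn {E : Type*} [NormedAddCommGroup E] [NormedSpace ℝ E] (v : E → E) (S : Set E)
    (u : ℝ → E) (s : Set ℝ) : Prop :=
  ∀ t ∈ s, HasDerivWithinAt u (v (u t)) s t ∧ u t ∈ S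

theorem IsSolutionIn.mono {E : Type*} [NormedAddCommGroup E] [NormedSpace ℝ E] {v : E → E}
    {S : Set E} {u : ℝ → E} {s s' : Set ℝ} (h : IsSolutionIn v S u s) (hs : s' ⊆ s) :
    IsSolutionIn v S u s' := fun t ht => ⟨(h t (hs ht)).1.mono hs, (h t (hs ht)).2⟩

theorem IsSolutionIn.continuousOn {E : Type*} [NormedAddCommGroup E] [NormedSpace ℝ E] {v : E → E}
    {S : Set E} {u : ℝ → E} {s : Set ℝ} (h : IsSolutionIn v S u s) : ContinuousOn u s :=
  fun t ht => (h t ht).1.continuousWithinAt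

theorem IsSolutionIn.shift {E : Type*} [NormedAddCommGroup E] [NormedSpace ℝ E] {v : E → E}
    {S : Set E} {u : ℝ → E} (h : IsSolutionIn v S u (Ici 0)) {a : ℝ} (ha : 0 ≤ a) :
    IsSolutionIn v S (fun t => u (a + t)) (Ici 0) := by
  intro t ht
  have hat : a + t ∈ Ici (0 : ℝ) := add_nonneg ha ht
  refine ⟨?_, (h _ hat).2⟩
  have h1 := (h _ hat).1
  have h2 : HasDerivWithinAt (fun t : ℝ => a + t) 1 (Ici 0) t :=
    ((hasDerivAt_id t).const_add a).hasDerivWithinAt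
  have := h1.scomp (t' := Ici 0) t h2 fun s hs => add_nonneg ha hs
  simpa [Function.comp_def] using this

/-- The field is only locally Lipschitz on `S`, so uniqueness is propagated: the set of agreement is
closed, and local uniqueness extends it to the right of each of its points. -/
theorem IsSolutionIn.eqOn {E : Type*} [NormedAddCommGroup E] [NormedSpace ℝ E] {v : E → E}
    {S : Set E} (hS : IsOpen S) (hv : ContDiffOn ℝ 1 v S) {u₁ u₂ : ℝ → E} {b : ℝ}
    (h₁ : IsSolutionIn v S u₁ (Icc 0 b)) (h₂ : IsSolutionIn v S u₂ (Icc 0 b))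
    (h0 : u₁ 0 = u₂ 0) : EqOn u₁ u₂ (Icc 0 b) := by
  have hclosed : IsClosed ({t | u₁ t = u₂ t} ∩ Icc 0 b) := by
    have : {t | u₁ t = u₂ t} ∩ Icc 0 b = Icc 0 b ∩ (fun t => u₁ t - u₂ t) ⁻¹' {0} := by
      ext t
      simp [sub_eq_zero, and_comm]
    rw [this]
    exact (h₁.continuousOn.sub h₂.continuousOn).preimage_isClosed_of_isClosed isClosed_Icc
      isClosed_singleton
  refine hclosed.Icc_subset_of_forall_exists_gt h0 fun t ht y hy => ?_
  obtain ⟨hteq, ht⟩ := ht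
  have hteq : u₁ t = u₂ t := hteq
  have htb : t ∈ Icc 0 b := ⟨ht.1, ht.2.le⟩
  obtain ⟨K, N, hN, hK⟩ := ((hv.contDiffAt (hS.mem_nhds (h₁ t htb).2))).exists_lipschitzOnWith
  have hN1 : ∀ᶠ s in 𝓝[Icc 0 b] t, u₁ s ∈ N := (h₁.continuousOn t htb).eventually_mem hN
  have hN2 : ∀ᶠ s in 𝓝[Icc 0 b] t, u₂ s ∈ N :=
    (h₂.continuousOn t htb).eventually_mem (by rw [← hteq]; exact hN)
  obtain ⟨δ, hδ, hball⟩ :=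
    Metric.eventually_nhds_iff.1 (eventually_nhdsWithin_iff.1 (hN1.and hN2))
  set c := min (min y b) (t + δ / 2) with hc
  have htc : t < c := lt_min (lt_min hy ht.2) (by linarith)
  have hcb : c ≤ b := (min_le_left _ _).trans (min_le_right _ _)
  have hcδ : c ≤ t + δ / 2 := min_le_right _ _
  have hsub : Icc t c ⊆ Icc 0 b := Icc_subset_Icc ht.1 hcb
  have hmem : ∀ s ∈ Ico t c, u₁ s ∈ N ∧ u₂ s ∈ N := fun s hs =>
    hball (by rw [Real.dist_eq, abs_of_nonneg (by linarith [hs.1])]; linarith [hs.2])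
      (hsub ⟨hs.1, hs.2.le⟩)
  have hderiv : ∀ {u : ℝ → E}, IsSolutionIn v S u (Icc 0 b) → ∀ s ∈ Ico t c,
      HasDerivWithinAt u (v (u s)) (Ici s) s := by
    intro u hu s hs
    have hsb : s < b := hs.2.trans_le hcb
    have h3 := (hu s (hsub ⟨hs.1, hs.2.le⟩)).1
    exact (h3.mono (Icc_subset_Icc (ht.1.trans hs.1) le_rfl)).mono_of_mem_nhdsWithin
      (Icc_mem_nhdsGE hsb)
  have := ODE_solution_unique_of_mem_Icc_right (v := fun _ => v) (s := fun _ => N)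
    (fun _ _ => hK) (h₁.continuousOn.mono hsub) (hderiv h₁) (fun s hs => (hmem s hs).1)
    (h₂.continuousOn.mono hsub) (hderiv h₂) (fun s hs => (hmem s hs).2) hteq
  exact ⟨c, this (right_mem_Icc.2 htc.le), htc, (min_le_left _ _).trans (min_le_left _ _)⟩

theorem IsSolutionIn.eqOn_Ici {E : Type*} [NormedAddCommGroup E] [NormedSpace ℝ E] {v : E → E}
    {S : Set E} (hS : IsOpen S) (hv : ContDiffOn ℝ 1 v S) {u₁ u₂ : ℝ → E}
    (h₁ : IsSolutionIn v S u₁ (Ici 0)) (h₂ : IsSolutionIn v S u₂ (Ici 0))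
    (h0 : u₁ 0 = u₂ 0) : EqOn u₁ u₂ (Ici 0) := fun _ ht =>
  IsSolutionIn.eqOn hS hv (h₁.mono Icc_subset_Ici_self) (h₂.mono Icc_subset_Ici_self) h0
    (right_mem_Icc.2 ht)

theorem IsSolutionIn.concat {E : Type*} [NormedAddCommGroup E] [NormedSpace ℝ E] {v : E → E}
    {S : Set E} {u₁ u₂ : ℝ → E} {a : ℝ} (ha : 0 ≤ a) (h₁ : IsSolutionIn v S u₁ (Icc 0 a))
    (h₂ : IsSolutionIn v S u₂ (Ici 0)) (h : u₁ a = u₂ 0) :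
    IsSolutionIn v S (fun t => if t ≤ a then u₁ t else u₂ (t - a)) (Ici 0) := by
  set u : ℝ → E := fun t => if t ≤ a then u₁ t else u₂ (t - a) with hu
  have hu1 : ∀ t ≤ a, u t = u₁ t := fun t ht => if_pos ht
  have hu2 : ∀ t, a ≤ t → u t = u₂ (t - a) := by
    intro t ht
    rcases ht.eq_or_lt with rfl | ht
    · rw [hu1 a le_rfl, h, sub_self]
    · exact if_neg (not_le.2 ht)
  have hd1 : ∀ t ∈ Icc 0 a, HasDerivWithinAt u (v (u t)) (Icc 0 a) t := fun t ht => by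
    rw [hu1 t ht.2]
    exact (h₁ t ht).1.congr (fun s hs => hu1 s hs.2) (hu1 t ht.2)
  have hd2 : ∀ t ∈ Ici a, HasDerivWithinAt u (v (u t)) (Ici a) t := fun t ht => by
    rw [hu2 t ht]
    refine HasDerivWithinAt.congr ?_ (fun s hs => hu2 s hs) (hu2 t ht)
    have h2 : HasDerivWithinAt (fun t : ℝ => t - a) 1 (Ici a) t :=
      ((hasDerivAt_id t).sub_const a).hasDerivWithinAt
    have h1 := (h₂ (t - a) (mem_Ici.2 (sub_nonneg.2 (mem_Ici.1 ht)))).1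
    have := h1.scomp (t' := Ici 0) t h2 fun s hs => mem_Ici.2 (sub_nonneg.2 (mem_Ici.1 hs))
    simpa [Function.comp_def] using this
  intro t ht
  rcases lt_trichotomy t a with hta | rfl | hta
  · refine ⟨(hd1 t ⟨ht, hta.le⟩).mono_of_mem_nhdsWithin ?_, ?_⟩
    · rw [← Ici_inter_Iic]
      exact inter_mem self_mem_nhdsWithin (mem_nhdsWithin_of_mem_nhds (Iic_mem_nhds hta))
    · rw [hu1 t hta.le]; exact (h₁ t ⟨ht, hta.le⟩).2
  · refine ⟨?_, by rw [hu1 t le_rfl]; exact (h₁ t ⟨ht, le_rfl⟩).2⟩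
    rw [← Icc_union_Ici_eq_Ici ht]
    exact (hd1 t ⟨ht, le_rfl⟩).union (hd2 t self_mem_Ici)
  · refine ⟨(hd2 t hta.le).mono_of_mem_nhdsWithin
      (mem_nhdsWithin_of_mem_nhds (Ici_mem_nhds hta)), ?_⟩
    rw [hu2 t hta.le]; exact (h₂ _ (mem_Ici.2 (sub_nonneg.2 hta.le))).2

/-- The integration operator `u ↦ ∫₀ˢ u`. -/
noncomputable def integrationOperator (E : Type*) [NormedAddCommGroup E] [NormedSpace ℝ E]
    [CompleteSpace E] : C(unitInterval, E) →L[ℝ] C(unitInterval, E) :=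
  LinearMap.mkContinuous (E := C(unitInterval, E)) (F := C(unitInterval, E))
    { toFun := fun g => ⟨fun s => ∫ σ in (0 : ℝ)..s, lineExtend g σ,
        (intervalIntegral.continuous_primitive (fun a b =>
          (continuous_lineExtend g).intervalIntegrable a b) 0).comp continuous_subtype_val⟩
      map_add' := fun g g' => by
        ext s
        exact intervalIntegral.integral_add ((continuous_lineExtend g).intervalIntegrable _ _)
          ((continuous_lineExtend g').intervalIntegrable _ _)
      map_smul' := fun c g => by
        ext s
        exact intervalIntegral.integral_smul c (lineExtend g) }
    1 fun g => by
      rw [ContinuousMap.norm_le _ (by positivity), one_mul]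
      intro s
      have := intervalIntegral.norm_integral_le_of_norm_le_const (a := 0) (b := (s : ℝ))
        (C := ‖g‖) (f := lineExtend g) fun σ _ => g.norm_coe_le_norm _
      refine this.trans ?_
      rw [sub_zero, abs_of_nonneg s.2.1]
      exact mul_le_of_le_one_right (norm_nonneg _) s.2.2

theorem integrationOperator_apply {E : Type*} [NormedAddCommGroup E] [NormedSpace ℝ E]
    [CompleteSpace E] (g : C(unitInterval, E)) (s : unitInterval) :
    integrationOperator E g s = ∫ σ in (0 : ℝ)..s, lineExtend g σ :=
  rfl

/-- The shear `(τ, u) ↦ (τ, u - τ w)`. -/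
noncomputable def shearEquiv {C : Type*} [NormedAddCommGroup C] [NormedSpace ℝ C] (w : C) :
    (ℝ × C) ≃L[ℝ] (ℝ × C) :=
  ContinuousLinearEquiv.equivOfInverse
    ((ContinuousLinearMap.fst ℝ ℝ C).prod
      (ContinuousLinearMap.snd ℝ ℝ C - (ContinuousLinearMap.fst ℝ ℝ C).smulRight w))
    ((ContinuousLinearMap.fst ℝ ℝ C).prod
      (ContinuousLinearMap.snd ℝ ℝ C + (ContinuousLinearMap.fst ℝ ℝ C).smulRight w))
    (fun x => by ext <;> simp) (fun x => by ext <;> simp)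

/-- With time scaled to [0, 1], the curve solves u = z + τ ∫ v(u). The inverse function theorem on ℝ
× C([0,1]) at τ = 0 makes the solution smooth in (τ, z) jointly. The time τ map is the identity near
`x₀` for τ = 0, so its derivative at `x₀` stays invertible for small τ. -/
theorem exists_local_flow {E : Type} [NormedAddCommGroup E] [NormedSpace ℝ E]
    [FiniteDimensional ℝ E] {v : E → E} {S : Set E} (hS : IsOpen S) (hv : ContDiffOn ℝ ∞ v S)
    {x₀ : E} (hx₀ : x₀ ∈ S) :
    ∃ ε > 0, ∀ τ ∈ Ioo 0 ε, ∃ e : OpenPartialHomeomorph E E, x₀ ∈ e.source ∧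
      ContDiffOn ℝ ∞ e e.source ∧ ContDiffOn ℝ ∞ e.symm e.target ∧
      ∀ z ∈ e.source, ∃ γ : ℝ → E, γ 0 = z ∧ γ τ = e z ∧ IsSolutionIn v S γ (Icc 0 τ) := by
  have : CompleteSpace E := FiniteDimensional.complete ℝ E
  obtain ⟨v₁, hv₁, hv₁v⟩ := exists_contDiff_eventuallyEq (hS.mem_nhds hx₀) hv
  obtain ⟨r, hr, hball⟩ := Metric.mem_nhds_iff.1 (inter_mem (hS.mem_nhds hx₀) hv₁v)
  let C := C(unitInterval, E)
  set N : C → C := superposition unitInterval ⟨v₁, hv₁.continuous⟩ with hN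
  have hNs : ContDiff ℝ ∞ N := contDiff_superposition _ hv₁
  set K := integrationOperator E with hK
  set F : ℝ × C → ℝ × C := fun p => (p.1, p.2 - p.1 • K (N p.2)) with hF
  have hKN : ContDiff ℝ ∞ fun p : ℝ × C => K (N p.2) :=
    K.contDiff.comp (hNs.comp contDiff_snd)
  have hFs : ContDiff ℝ ∞ F :=
    contDiff_fst.prodMk (contDiff_snd.sub (contDiff_fst.smul hKN))
  let const : E →L[ℝ] C := ContinuousLinearMap.const ℝ unitInterval
  set c₀ : C := const x₀ with hc₀
  -- At τ = 0 the integral term contributes only through its factor τ, whence a shear, which is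
  -- invertible.
  have hF' : HasFDerivAt F (shearEquiv (K (N c₀)) : ℝ × C →L[ℝ] ℝ × C) (0, c₀) := by
    have h1 : HasFDerivAt (fun p : ℝ × C => p.1) (ContinuousLinearMap.fst ℝ ℝ C) (0, c₀) :=
      hasFDerivAt_fst
    have h2 : HasFDerivAt (fun p : ℝ × C => p.2) (ContinuousLinearMap.snd ℝ ℝ C) (0, c₀) :=
      hasFDerivAt_snd
    have h3 := (hKN.differentiable (by simp) (0, c₀)).hasFDerivAt
    refine (h1.prodMk (h2.sub (h1.smul h3))).congr_fderiv ?_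
    refine ContinuousLinearMap.ext fun p => ?_
    simp [shearEquiv]
  obtain ⟨e, h0e, -, heF, hes, -⟩ := exists_openPartialHomeomorph_of_contDiffOn isOpen_univ
    (mem_univ _) hFs.contDiffOn hF'
  have hF0 : F (0, c₀) = (0, c₀) := by simp [hF]
  have h0t : ((0 : ℝ), c₀) ∈ e.target := by
    have := e.map_source h0e
    rwa [heF, hF0] at this
  have hs0 : e.symm (0, c₀) = (0, c₀) := by
    have := e.left_inv h0e
    rwa [heF, hF0] at this
  have hright : ∀ p ∈ e.target, (e.symm p).1 = p.1 ∧
      (e.symm p).2 - p.1 • K (N (e.symm p).2) = p.2 := by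
    intro p hp
    have h1 := e.right_inv hp
    rw [heF] at h1
    have h2 : (F (e.symm p)).1 = p.1 := congrArg Prod.fst h1
    change (e.symm p).1 = p.1 at h2
    refine ⟨h2, ?_⟩
    have h3 : (F (e.symm p)).2 = p.2 := congrArg Prod.snd h1
    change (e.symm p).2 - (e.symm p).1 • K (N (e.symm p).2) = p.2 at h3
    rwa [h2] at h3
  let inc : ℝ × E →L[ℝ] ℝ × C :=
    (ContinuousLinearMap.fst ℝ ℝ E).prod (const.comp (ContinuousLinearMap.snd ℝ ℝ E))
  set U : ℝ × E → C := fun p => (e.symm (inc p)).2 with hU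
  set Ω : Set (ℝ × E) :=
    inc ⁻¹' (e.target ∩ e.symm ⁻¹' (Prod.snd ⁻¹' Metric.ball c₀ r)) with hΩ
  have hΩo : IsOpen Ω := (e.symm.continuousOn.isOpen_inter_preimage e.open_target
    (Metric.isOpen_ball.preimage continuous_snd)).preimage inc.continuous
  have hinc0 : inc (0, x₀) = (0, c₀) := rfl
  have h0Ω : ((0 : ℝ), x₀) ∈ Ω := by
    simp only [hΩ, mem_preimage, mem_inter_iff, hinc0, hs0]
    exact ⟨h0t, Metric.mem_ball_self hr⟩
  let ev : C →L[ℝ] E := ContinuousMap.evalCLM ℝ (1 : unitInterval)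
  set φ : ℝ × E → E := fun p => U p 1 with hφ
  have hφs : ContDiffOn ℝ ∞ φ Ω := by
    have h1 : ContDiffOn ℝ ∞ (fun p => e.symm (inc p)) Ω :=
      hes.comp inc.contDiff.contDiffOn fun p hp => hp.1
    exact ev.contDiff.comp_contDiffOn h1.snd
  have hpart : ∀ p ∈ Ω, HasFDerivAt (fun x => φ (p.1, x))
      ((fderiv ℝ φ p).comp (ContinuousLinearMap.inr ℝ ℝ E)) p.2 := by
    intro p hp
    have h1 : HasFDerivAt φ (fderiv ℝ φ p) (p.1, p.2) :=
      ((hφs.contDiffAt (hΩo.mem_nhds hp)).differentiableAt (by simp)).hasFDerivAt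
    have h2 : HasFDerivAt (fun x : E => (p.1, x)) (ContinuousLinearMap.inr ℝ ℝ E) p.2 :=
      hasFDerivAt_prodMk_right p.1 p.2
    exact h1.comp p.2 h2
  have hslice0 : ∀ᶠ x in 𝓝 x₀, φ (0, x) = x := by
    have h1 : Continuous fun x : E => ((0 : ℝ), x) := by fun_prop
    filter_upwards [(hΩo.preimage h1).mem_nhds h0Ω] with x hx
    have h2 := (hright _ hx.1).2
    have h3 : (inc (0, x)).1 = 0 := rfl
    rw [h3, zero_smul, sub_zero] at h2
    change (e.symm (inc (0, x))).2 1 = x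
    rw [h2]
    rfl
  have hid : (fderiv ℝ φ (0, x₀)).comp (ContinuousLinearMap.inr ℝ ℝ E) =
      ((ContinuousLinearEquiv.refl ℝ E : E ≃L[ℝ] E) : E →L[ℝ] E) :=
    (hpart _ h0Ω).unique ((hasFDerivAt_id x₀).congr_of_eventuallyEq hslice0)
  have hopen : IsOpen (Ω ∩ (fun p => (fderiv ℝ φ p).comp (ContinuousLinearMap.inr ℝ ℝ E)) ⁻¹'
      range ((↑) : (E ≃L[ℝ] E) → E →L[ℝ] E)) :=
    ((hφs.continuousOn_fderiv_of_isOpen hΩo (by simp)).clm_comp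
      continuousOn_const).isOpen_inter_preimage hΩo ContinuousLinearEquiv.isOpen
  have h0Ω' : ((0 : ℝ), x₀) ∈ (Ω ∩ (fun p => (fderiv ℝ φ p).comp (ContinuousLinearMap.inr ℝ ℝ E)) ⁻¹'
      range ((↑) : (E ≃L[ℝ] E) → E →L[ℝ] E)) := ⟨h0Ω, _, hid.symm⟩
  have hτ : ∀ᶠ τ : ℝ in 𝓝 0, (τ, x₀) ∈ (Ω ∩ (fun p => (fderiv ℝ φ p).comp
      (ContinuousLinearMap.inr ℝ ℝ E)) ⁻¹' range ((↑) : (E ≃L[ℝ] E) → E →L[ℝ] E)) := by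
    have h1 : Continuous fun τ : ℝ => (τ, x₀) := by fun_prop
    exact (hopen.preimage h1).mem_nhds h0Ω'
  obtain ⟨ε, hε, hεball⟩ := Metric.eventually_nhds_iff.1 hτ
  refine ⟨ε, hε, fun τ hτ => ?_⟩
  -- From here τ is fixed; the inverse function theorem in z alone gives a neighbourhood of `x₀`
  -- that may depend on τ.
  have hτε := hεball (y := τ) (by rw [dist_zero_right, Real.norm_of_nonneg hτ.1.le]; exact hτ.2)
  obtain ⟨hτΩ, A, hA⟩ := hτε
  have hslice : IsOpen {x : E | (τ, x) ∈ Ω} := hΩo.preimage (by fun_prop)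
  have hφτ : ContDiffOn ℝ ∞ (fun x => φ (τ, x)) {x : E | (τ, x) ∈ Ω} :=
    hφs.comp (contDiff_prodMk_right τ).contDiffOn fun x hx => hx
  obtain ⟨g, hg0, hgΩ, hgφ, hgs, -⟩ := exists_openPartialHomeomorph_of_contDiffOn hslice hτΩ hφτ
    (f' := A) (by rw [hA]; exact hpart _ hτΩ)
  refine ⟨g, hg0, by rw [hgφ]; exact hφτ.mono hgΩ, hgs, fun z hz => ?_⟩
  have hzΩ : (τ, z) ∈ Ω := hgΩ hz
  set w : C := U (τ, z) with hw
  have hweq : ∀ s : unitInterval, w s = z + τ • ∫ σ in (0 : ℝ)..s, lineExtend (N w) σ := by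
    intro s
    have h1 := (hright _ hzΩ.1).2
    have h2 := congrArg (fun u : C => u s) h1
    change w s - τ • K (N w) s = z at h2
    rw [← integrationOperator_apply, ← hK, ← h2]
    abel
  have hγ : ∀ t ∈ Icc 0 τ, ∃ s : unitInterval, (s : ℝ) = t / τ := fun t ht =>
    ⟨⟨t / τ, div_nonneg ht.1 hτ.1.le, (div_le_one hτ.1).2 ht.2⟩, rfl⟩
  refine ⟨fun t => z + τ • ∫ σ in (0 : ℝ)..t / τ, lineExtend (N w) σ, by simp, ?_, ?_⟩
  · have h1 := hweq 1
    rw [hgφ]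
    simp only [div_self hτ.1.ne']
    exact h1.symm
  · intro t ht
    obtain ⟨s, hs⟩ := hγ t ht
    have hval : z + τ • ∫ σ in (0 : ℝ)..t / τ, lineExtend (N w) σ = w s := by
      rw [← hs, ← hweq]
    have hmem : w s ∈ Metric.ball x₀ r := by
      have h1 : w ∈ Metric.ball c₀ r := hzΩ.2
      exact (ContinuousMap.dist_apply_le_dist s).trans_lt h1
    beta_reduce
    rw [hval]
    refine ⟨HasDerivAt.hasDerivWithinAt ?_, (hball hmem).1⟩
    have h2 : HasDerivAt (fun x : ℝ => ∫ σ in (0 : ℝ)..x, lineExtend (N w) σ)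
        (lineExtend (N w) (t / τ)) (t / τ) :=
      ((continuous_lineExtend _).integral_hasStrictDerivAt 0 (t / τ)).hasDerivAt
    have h3 : HasDerivAt (fun t : ℝ => t / τ) (1 / τ) t := (hasDerivAt_id t).div_const τ
    have h4 := ((h2.scomp t h3).const_smul τ).const_add z
    refine h4.congr_deriv ?_
    rw [smul_smul, mul_one_div_cancel hτ.1.ne', one_smul, ← hs, lineExtend_coe]
    have h5 : v₁ (w s) = v (w s) := (hball hmem).2
    exact h5

end Flow

/-! ### Linearization of a contracting field along its flow -/

section Conjugation

/-- Multiplication of the coordinates of Euclidean space by `mu`. -/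
noncomputable def euclDiag {ι : Type} [Fintype ι] (mu : ι → ℝ) :
    EuclideanSpace ℝ ι →L[ℝ] EuclideanSpace ℝ ι :=
  ((EuclideanSpace.equiv ι ℝ).symm : (ι → ℝ) →L[ℝ] EuclideanSpace ℝ ι).comp
    ((diagCLM mu).comp (EuclideanSpace.equiv ι ℝ : EuclideanSpace ℝ ι →L[ℝ] ι → ℝ))

@[simp]
theorem euclDiag_apply {ι : Type} [Fintype ι] (mu : ι → ℝ) (x : EuclideanSpace ℝ ι) (i : ι) :
    euclDiag mu x i = mu i * x i :=
  rfl

/-- The flow `x ↦ e^{t mu} x` of the diagonal field. -/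
noncomputable def euclExp {ι : Type} [Fintype ι] (mu : ι → ℝ) (t : ℝ) :
    EuclideanSpace ℝ ι →L[ℝ] EuclideanSpace ℝ ι :=
  euclDiag fun i => Real.exp (mu i * t)

@[simp]
theorem euclExp_apply {ι : Type} [Fintype ι] (mu : ι → ℝ) (t : ℝ) (x : EuclideanSpace ℝ ι)
    (i : ι) : euclExp mu t x i = Real.exp (mu i * t) * x i :=
  rfl

theorem euclExp_add {ι : Type} [Fintype ι] (mu : ι → ℝ) (s t : ℝ) (x : EuclideanSpace ℝ ι) :
    euclExp mu (s + t) x = euclExp mu s (euclExp mu t x) := by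
  ext i
  simp [mul_add, Real.exp_add, mul_assoc]

@[simp]
theorem euclExp_zero {ι : Type} [Fintype ι] (mu : ι → ℝ) (x : EuclideanSpace ℝ ι) :
    euclExp mu 0 x = x := by
  ext i
  simp

@[simp]
theorem euclExp_neg_self {ι : Type} [Fintype ι] (mu : ι → ℝ) (t : ℝ) (x : EuclideanSpace ℝ ι) :
    euclExp mu (-t) (euclExp mu t x) = x := by
  rw [← euclExp_add, neg_add_cancel, euclExp_zero]

@[simp]
theorem euclExp_self_neg {ι : Type} [Fintype ι] (mu : ι → ℝ) (t : ℝ) (x : EuclideanSpace ℝ ι) :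
    euclExp mu t (euclExp mu (-t) x) = x := by
  rw [← euclExp_add, add_neg_cancel, euclExp_zero]

/-- The diagonal flow as a linear equivalence. -/
noncomputable def euclExpEquiv {ι : Type} [Fintype ι] (mu : ι → ℝ) (t : ℝ) :
    EuclideanSpace ℝ ι ≃L[ℝ] EuclideanSpace ℝ ι :=
  ContinuousLinearEquiv.equivOfInverse (euclExp mu t) (euclExp mu (-t))
    (euclExp_neg_self mu t) (euclExp_self_neg mu t)

theorem hasDerivAt_euclExp {ι : Type} [Fintype ι] (mu : ι → ℝ) (t : ℝ) (x : EuclideanSpace ℝ ι) :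
    HasDerivAt (fun t => euclExp mu t x) (euclDiag mu (euclExp mu t x)) t := by
  have h1 : HasDerivAt (fun t i => Real.exp (mu i * t) * x i)
      (fun i => mu i * (Real.exp (mu i * t) * x i)) t := by
    rw [hasDerivAt_pi]
    intro i
    have h2 : HasDerivAt (fun t => mu i * t) (mu i) t := by
      simpa using (hasDerivAt_id t).const_mul (mu i)
    refine (h2.exp.mul_const (x i)).congr_deriv ?_
    ring
  exact ((EuclideanSpace.equiv ι ℝ).symm : (ι → ℝ) →L[ℝ] EuclideanSpace ℝ ι).hasFDerivAt.comp_hasDerivAt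
    t h1

theorem norm_euclExp_le {ι : Type} [Fintype ι] {mu : ι → ℝ} (hmu : ∀ i, mu i ≤ 0) {t : ℝ}
    (ht : 0 ≤ t) (x : EuclideanSpace ℝ ι) : ‖euclExp mu t x‖ ≤ ‖x‖ := by
  rw [EuclideanSpace.norm_eq, EuclideanSpace.norm_eq]
  refine Real.sqrt_le_sqrt (Finset.sum_le_sum fun i _ => ?_)
  rw [euclExp_apply, norm_mul, Real.norm_of_nonneg (Real.exp_pos _).le]
  refine pow_le_pow_left₀ (by positivity) (mul_le_of_le_one_left (norm_nonneg _) ?_) 2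
  exact Real.exp_le_one_iff.2 (mul_nonpos_of_nonpos_of_nonneg (hmu i) ht)

theorem tendsto_euclExp_atTop {ι : Type} [Fintype ι] {mu : ι → ℝ} (hmu : ∀ i, mu i < 0)
    (x : EuclideanSpace ℝ ι) : Tendsto (fun t => euclExp mu t x) atTop (𝓝 0) := by
  have h1 : Tendsto (fun t i => Real.exp (mu i * t) * x i) atTop (𝓝 (0 : ι → ℝ)) := by
    rw [tendsto_pi_nhds]
    intro i
    have h2 : Tendsto (fun t => mu i * t) atTop atBot := tendsto_id.const_mul_atTop_of_neg (hmu i)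
    simpa using (Real.tendsto_exp_atBot.comp h2).mul_const (x i)
  exact (((EuclideanSpace.equiv ι ℝ).symm.continuous.tendsto 0).comp h1).trans
    (by rw [_root_.map_zero])

/-- The asymptotic parametrization with J the identity: e conjugates the linear flow to that of `w`,
and its normalization at infinity says that the limit e^{-μt} e(e^{μt} η) is η. Hence the inverse of
e is the limit map near 0. -/
theorem exists_local_conjugation {ι : Type} [Fintype ι] {mu : ι → ℝ} (hmu : ∀ i, mu i < 0)
    {S : Set (EuclideanSpace ℝ ι)} (hS : IsOpen S) (h0 : 0 ∈ S)
    {w : EuclideanSpace ℝ ι → EuclideanSpace ℝ ι} (hw : ContDiffOn ℝ ∞ w S)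
    (hflat : IsFlat fun x => w x - euclDiag mu x) :
    ∃ (e : OpenPartialHomeomorph (EuclideanSpace ℝ ι) (EuclideanSpace ℝ ι)) (r : ℝ), 0 < r ∧
      e.source = Metric.ball 0 r ∧ e 0 = 0 ∧ e.target ⊆ S ∧ ContDiffOn ℝ ∞ e e.source ∧
      ContDiffOn ℝ ∞ e.symm e.target ∧
      ∀ η ∈ e.source, fderiv ℝ e η (euclDiag mu η) = w (e η) ∧
        Tendsto (fun t => euclExp mu (-t) (e (euclExp mu t η))) atTop (𝓝 η) := by
  let T := EuclideanSpace.equiv ι ℝ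
  obtain ⟨w₁, hw₁, hw₁w⟩ := exists_contDiff_eventuallyEq (hS.mem_nhds h0) hw
  set h : (ι → ℝ) → ι → ℝ := fun x => T (w₁ (T.symm x) - euclDiag mu (T.symm x)) with hh
  have hhs : ContDiff ℝ ∞ h := T.contDiff.comp
    ((hw₁.comp T.symm.contDiff).sub ((euclDiag mu).contDiff.comp T.symm.contDiff))
  have hhf : IsFlat h := by
    have h1 : IsFlat fun x => w₁ x - euclDiag mu x :=
      hflat.congr (hw₁w.mono fun x hx => by simp only [hx])
    have h2 : IsFlat fun x => w₁ (T.symm x) - euclDiag mu (T.symm x) :=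
      h1.comp_of_differentiableAt (g := T.symm) T.symm.differentiableAt (_root_.map_zero _)
    exact h2.clm_apply (A := fun _ => (T : EuclideanSpace ℝ ι →L[ℝ] ι → ℝ)) continuousAt_const
  obtain ⟨e₀, O, hO, h0O, he₀, he₀0, he₀', heq⟩ := exists_asymptotic_parametrization mu mu hmu
    (ContinuousLinearMap.id ℝ (ι → ℝ)) (fun x i => rfl) hhs hhf
  set e₁ : EuclideanSpace ℝ ι → EuclideanSpace ℝ ι := fun x => T.symm (e₀ (T x)) with he₁
  have he₁0 : e₁ 0 = 0 := by
    simp only [he₁, _root_.map_zero, he₀0]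
  have he₁s : ContDiffOn ℝ ∞ e₁ (T ⁻¹' O) :=
    T.symm.contDiff.comp_contDiffOn (he₀.comp T.contDiff.contDiffOn fun x hx => hx)
  have hTO : IsOpen (T ⁻¹' O) := hO.preimage T.continuous
  have h0TO : (0 : EuclideanSpace ℝ ι) ∈ T ⁻¹' O := by
    rw [mem_preimage, _root_.map_zero]; exact h0O
  have hder : ∀ x ∈ T ⁻¹' O, HasFDerivAt e₁ ((T.symm : (ι → ℝ) →L[ℝ] EuclideanSpace ℝ ι).comp
      ((fderiv ℝ e₀ (T x)).comp (T : EuclideanSpace ℝ ι →L[ℝ] ι → ℝ))) x := fun x hx =>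
    T.symm.hasFDerivAt.comp x (((he₀.contDiffAt (hO.mem_nhds hx)).differentiableAt
      (by simp)).hasFDerivAt.comp x T.hasFDerivAt)
  have he₁' : HasFDerivAt e₁ ((ContinuousLinearEquiv.refl ℝ (EuclideanSpace ℝ ι) :
      EuclideanSpace ℝ ι ≃L[ℝ] EuclideanSpace ℝ ι) :
      EuclideanSpace ℝ ι →L[ℝ] EuclideanSpace ℝ ι) 0 := by
    refine (hder 0 h0TO).congr_fderiv ?_
    rw [_root_.map_zero, he₀'.fderiv]
    exact ContinuousLinearMap.ext fun x => T.symm_apply_apply x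
  have hgood : ∀ᶠ x in 𝓝 (0 : EuclideanSpace ℝ ι), e₁ x ∈ S ∧ w₁ (e₁ x) = w (e₁ x) := by
    have h1 : Tendsto e₁ (𝓝 0) (𝓝 0) := by
      simpa [he₁0] using he₁'.continuousAt.tendsto
    exact (h1.eventually (hS.eventually_mem h0)).and (h1.eventually hw₁w)
  obtain ⟨e, h0e, heO, hee₁, hes, -⟩ := exists_openPartialHomeomorph_of_contDiffOn hTO h0TO he₁s
    he₁'
  -- The domain is cut down to a Euclidean ball, which the contracting linear flow maps into itself.
  obtain ⟨r, hr, hball⟩ := Metric.mem_nhds_iff.1 (inter_mem hgood (e.open_source.mem_nhds h0e))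
  have hsrc : (e.restrOpen (Metric.ball 0 r) Metric.isOpen_ball).source = Metric.ball 0 r := by
    rw [OpenPartialHomeomorph.restrOpen_source]
    exact inter_eq_right.2 fun x hx => (hball hx).2
  refine ⟨e.restrOpen (Metric.ball 0 r) Metric.isOpen_ball, r, hr, hsrc, ?_, ?_, ?_, ?_, ?_⟩
  · rw [OpenPartialHomeomorph.coe_restrOpen, hee₁, he₁0]
  · intro y hy
    have h1 := (e.restrOpen (Metric.ball 0 r) Metric.isOpen_ball).map_target hy
    have h2 := (e.restrOpen (Metric.ball 0 r) Metric.isOpen_ball).right_inv hy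
    rw [hsrc] at h1
    rw [← h2, OpenPartialHomeomorph.coe_restrOpen, hee₁]
    exact (hball h1).1.1
  · rw [hsrc, OpenPartialHomeomorph.coe_restrOpen, hee₁]
    exact he₁s.mono fun x hx => heO (hball hx).2
  · exact hes.mono fun x hx => hx.1
  · intro η hη
    rw [hsrc] at hη
    have hηO : η ∈ T ⁻¹' O := heO (hball hη).2
    obtain ⟨h1, h2⟩ := heq (T η) hηO
    rw [OpenPartialHomeomorph.coe_restrOpen, hee₁]
    refine ⟨?_, ?_⟩
    · rw [(hder η hηO).fderiv]
      change T.symm (fderiv ℝ e₀ (T η) fun c => mu c * T η c) = w (e₁ η)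
      rw [h1, ← (hball hη).1.2, ContinuousLinearEquiv.symm_apply_eq]
      ext i
      change mu i * e₀ (T η) i + (w₁ (e₁ η) i - mu i * e₀ (T η) i) = w₁ (e₁ η) i
      ring
    · have h3 := (T.symm.continuous.tendsto (T η)).comp (tendsto_pi_nhds.2 h2)
      rw [T.symm_apply_apply] at h3
      refine h3.congr fun t => ?_
      ext i
      change Real.exp (-mu i * t) * _ = Real.exp (mu i * -t) * _
      rw [mul_neg, neg_mul]
      rfl

/-- The points from which a solution exists for all positive times and tends to `0`. -/
def basin {E : Type*} [NormedAddCommGroup E] [NormedSpace ℝ E] (v : E → E) (S : Set E) : Set E :=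
  {x | ∃ u : ℝ → E, u 0 = x ∧ IsSolutionIn v S u (Ici 0) ∧ Tendsto u atTop (𝓝 0)}

/-- Every solution in the basin eventually enters the image of the local conjugation, where the
limit is known. The equivariance Ψ(u(T)) = e^{μT} Ψ(u(0)) then transports existence, smoothness and
local invertibility of Ψ backwards along the solution, and its derivative at T = 0 is the
conjugation equation. -/
theorem exists_conjugation {ι : Type} [Fintype ι] {mu : ι → ℝ} (hmu : ∀ i, mu i < 0)
    {S : Set (EuclideanSpace ℝ ι)} (hS : IsOpen S) (h0 : 0 ∈ S)
    {w : EuclideanSpace ℝ ι → EuclideanSpace ℝ ι} (hw : ContDiffOn ℝ ∞ w S)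
    (hflat : IsFlat fun x => w x - euclDiag mu x) :
    0 ∈ basin w S ∧ ∃ Ψ : EuclideanSpace ℝ ι → EuclideanSpace ℝ ι, Ψ 0 = 0 ∧
      (∀ x ∈ basin w S, ∃ g : OpenPartialHomeomorph (EuclideanSpace ℝ ι) (EuclideanSpace ℝ ι),
        x ∈ g.source ∧ g.source ⊆ basin w S ∧ EqOn Ψ g g.source ∧
        ContDiffOn ℝ ∞ g g.source ∧ ContDiffOn ℝ ∞ g.symm g.target) ∧
      (∀ x ∈ basin w S, fderiv ℝ Ψ x (w x) = euclDiag mu (Ψ x)) ∧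
      ∀ u : ℝ → EuclideanSpace ℝ ι, IsSolutionIn w S u (Ici 0) → Tendsto u atTop (𝓝 0) →
        Tendsto (fun t => euclExp mu (-t) (u t)) atTop (𝓝 (Ψ (u 0))) := by
  have hw1 : ContDiffOn ℝ 1 w S := hw.of_le (by simp)
  obtain ⟨e, r, hr, hsrc, he0, heS, hes, hes', he⟩ := exists_local_conjugation hmu hS h0 hw hflat
  have h0e : (0 : EuclideanSpace ℝ ι) ∈ e.source := by rw [hsrc]; exact Metric.mem_ball_self hr
  have hinv : ∀ η ∈ e.source, ∀ t, 0 ≤ t → euclExp mu t η ∈ e.source := by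
    intro η hη t ht
    rw [hsrc, mem_ball_zero_iff] at *
    exact (norm_euclExp_le (fun i => (hmu i).le) ht η).trans_lt hη
  have hsol : ∀ η ∈ e.source, IsSolutionIn w S (fun t => e (euclExp mu t η)) (Ici 0) := by
    intro η hη t ht
    have h1 := hinv η hη t ht
    refine ⟨HasDerivAt.hasDerivWithinAt ?_, heS (e.map_source h1)⟩
    rw [← (he _ h1).1]
    exact ((hes.contDiffAt (e.open_source.mem_nhds h1)).differentiableAt
      (by simp)).hasFDerivAt.comp_hasDerivAt t (hasDerivAt_euclExp mu t η)
  have hto : ∀ η ∈ e.source, Tendsto (fun t => e (euclExp mu t η)) atTop (𝓝 0) := by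
    intro η hη
    have h1 := (e.continuousAt h0e).tendsto.comp (tendsto_euclExp_atTop hmu η)
    rwa [he0] at h1
  have htarget : e.target ∈ 𝓝 (0 : EuclideanSpace ℝ ι) := by
    have h1 := e.map_source h0e
    rw [he0] at h1
    exact e.open_target.mem_nhds h1
  -- From time T on, u is the image of a linear solution, so the limit is computed from the local
  -- normalization and shifted back by e^{-μT}.
  have hnear : ∀ u : ℝ → EuclideanSpace ℝ ι, IsSolutionIn w S u (Ici 0) → ∀ T, 0 ≤ T →
      u T ∈ e.target → Tendsto (fun t => euclExp mu (-t) (u t)) atTop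
        (𝓝 (euclExp mu (-T) (e.symm (u T)))) := by
    intro u hu T hT huT
    set η := e.symm (u T) with hη
    have hηe : η ∈ e.source := e.map_target huT
    have heq := IsSolutionIn.eqOn_Ici hS hw1 (hu.shift hT) (hsol η hηe)
      (by simp [hη, e.right_inv huT])
    have h1 := ((euclExp mu (-T)).continuous.tendsto η).comp (he η hηe).2
    have h2 := h1.comp (tendsto_atTop_add_const_right atTop (-T) tendsto_id)
    refine h2.congr' ?_
    filter_upwards [eventually_ge_atTop T] with t ht
    have h3 : u (T + (t - T)) = e (euclExp mu (t - T) η) := heq (sub_nonneg.2 ht)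
    rw [add_sub_cancel] at h3
    simp only [Function.comp_apply, id_eq]
    rw [← euclExp_add, ← sub_eq_add_neg t T, ← h3]
    congr 2
    ring
  have hlim : ∀ u : ℝ → EuclideanSpace ℝ ι, IsSolutionIn w S u (Ici 0) → Tendsto u atTop (𝓝 0) →
      ∃ L, Tendsto (fun t => euclExp mu (-t) (u t)) atTop (𝓝 L) := by
    intro u hu hu0
    obtain ⟨T, hT, hT0⟩ := ((hu0.eventually htarget).and (eventually_ge_atTop 0)).exists
    exact ⟨_, hnear u hu T hT0 hT⟩
  -- Uniqueness of solutions makes the limit depend on the starting point only; off the basin the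
  -- value 0 is arbitrary.
  have hexists : ∀ x, ∃ L, ∀ u : ℝ → EuclideanSpace ℝ ι, u 0 = x → IsSolutionIn w S u (Ici 0) →
      Tendsto u atTop (𝓝 0) → Tendsto (fun t => euclExp mu (-t) (u t)) atTop (𝓝 L) := by
    intro x
    by_cases hx : x ∈ basin w S
    · obtain ⟨u, hux, hu, hu0⟩ := hx
      obtain ⟨L, hL⟩ := hlim u hu hu0
      refine ⟨L, fun u' hux' hu' _ => hL.congr' ?_⟩
      filter_upwards [eventually_ge_atTop 0] with t ht
      rw [IsSolutionIn.eqOn_Ici hS hw1 hu hu' (hux.trans hux'.symm) ht]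
    · exact ⟨0, fun u hux hu hu0 => absurd ⟨u, hux, hu, hu0⟩ hx⟩
  choose Ψ hΨ using hexists
  have hΨe : ∀ η ∈ e.source, Ψ (e η) = η := fun η hη =>
    tendsto_nhds_unique (hΨ (e η) _ (by simp) (hsol η hη) (hto η hη)) (he η hη).2
  have hΨu : ∀ u : ℝ → EuclideanSpace ℝ ι, IsSolutionIn w S u (Ici 0) → Tendsto u atTop (𝓝 0) →
      ∀ T, 0 ≤ T → Ψ (u T) = euclExp mu T (Ψ (u 0)) := by
    intro u hu hu0 T hT
    have hu0' : Tendsto (fun t => u (T + t)) atTop (𝓝 0) :=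
      hu0.comp (tendsto_atTop_add_const_left atTop T tendsto_id)
    have h1 := hΨ (u T) (fun t => u (T + t)) (by simp) (hu.shift hT) hu0'
    have h2 := ((euclExp mu T).continuous.tendsto _).comp
      ((hΨ (u 0) u rfl hu hu0).comp (tendsto_atTop_add_const_left atTop T tendsto_id))
    refine tendsto_nhds_unique h1 (h2.congr fun t => ?_)
    simp only [Function.comp_apply, id_eq]
    rw [← euclExp_add]
    congr 2
    ring
  set 𝒢 : Set (EuclideanSpace ℝ ι) := {x | ∃ g : OpenPartialHomeomorph (EuclideanSpace ℝ ι)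
    (EuclideanSpace ℝ ι), x ∈ g.source ∧ g.source ⊆ basin w S ∧ EqOn Ψ g g.source ∧
        ContDiffOn ℝ ∞ g g.source ∧ ContDiffOn ℝ ∞ g.symm g.target} with h𝒢
  have h𝒢o : IsOpen 𝒢 := by
    refine isOpen_iff_mem_nhds.2 fun x hx => ?_
    obtain ⟨g, hxg, hg⟩ := hx
    exact mem_of_superset (g.open_source.mem_nhds hxg) fun y hy => ⟨g, hy, hg⟩
  have htarget𝒢 : e.target ⊆ 𝒢 := by
    intro x hx
    refine ⟨e.symm, hx, ?_, ?_, hes', by simpa using hes⟩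
    · intro y hy
      have hy' : e.symm y ∈ e.source := e.map_target hy
      exact ⟨_, by simp [e.right_inv hy], hsol _ hy', hto _ hy'⟩
    · intro y hy
      have h1 := hΨe _ (e.map_target hy)
      rwa [e.right_inv hy] at h1
  -- If g is a local inverse branch at u(τ) and φ is the time τ flow map near u(0), then e^{-μτ} ∘ g
  -- ∘ φ represents Ψ near u(0). Points near u(0) belong to the basin by concatenating the short
  -- flow line with the given one.
  have hstep : ∀ u : ℝ → EuclideanSpace ℝ ι, IsSolutionIn w S u (Ici 0) → ∃ ε > 0,
      ∀ τ ∈ Ioo 0 ε, u τ ∈ 𝒢 → u 0 ∈ 𝒢 := by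
    intro u hu
    obtain ⟨ε, hε, hflow⟩ := exists_local_flow hS hw (hu 0 self_mem_Ici).2
    refine ⟨ε, hε, fun τ hτ huτ => ?_⟩
    obtain ⟨φ, h0φ, hφs, hφs', hφ⟩ := hflow τ hτ
    obtain ⟨g, hug, hgW, hgΨ, hgs, hgs'⟩ := huτ
    have hu0φ : φ (u 0) = u τ := by
      obtain ⟨γ, hγ0, hγτ, hγ⟩ := hφ _ h0φ
      rw [← hγτ]
      exact IsSolutionIn.eqOn hS hw1 hγ (hu.mono Icc_subset_Ici_self) hγ0
        (right_mem_Icc.2 hτ.1.le)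
    have hpt : ∀ z ∈ (φ.trans g).source, z ∈ basin w S ∧ Ψ z = euclExp mu (-τ) (g (φ z)) := by
      intro z hz
      rw [OpenPartialHomeomorph.trans_source] at hz
      obtain ⟨γ, hγ0, hγτ, hγ⟩ := hφ z hz.1
      obtain ⟨u₂, hu₂0, hu₂, hu₂lim⟩ := hgW hz.2
      have hc := hγ.concat hτ.1.le hu₂ (hγτ.trans hu₂0.symm)
      set c : ℝ → EuclideanSpace ℝ ι := fun t => if t ≤ τ then γ t else u₂ (t - τ) with hcdef
      have hc0 : c 0 = z := by rw [← hγ0]; exact if_pos hτ.1.le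
      have hcτ : c τ = φ z := by rw [← hγτ]; exact if_pos le_rfl
      have hclim : Tendsto c atTop (𝓝 0) := by
        refine (hu₂lim.comp (tendsto_atTop_add_const_right atTop (-τ) tendsto_id)).congr' ?_
        filter_upwards [eventually_gt_atTop τ] with t ht
        exact (if_neg (not_le.2 ht)).symm
      refine ⟨⟨c, hc0, hc, hclim⟩, ?_⟩
      have h1 := hΨu c hc hclim τ hτ.1.le
      rw [hcτ, hc0] at h1
      rw [← hgΨ hz.2, h1, euclExp_neg_self]
    refine ⟨(φ.trans g).transHomeomorph (euclExpEquiv mu (-τ)).toHomeomorph, ?_,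
      fun z hz => (hpt z hz).1, fun z hz => (hpt z hz).2, ?_, ?_⟩
    · change u 0 ∈ (φ.trans g).source
      rw [OpenPartialHomeomorph.trans_source]
      exact ⟨h0φ, by rw [mem_preimage, hu0φ]; exact hug⟩
    · have h1 : ContDiffOn ℝ ∞ (g ∘ φ) (φ.trans g).source := by
        rw [OpenPartialHomeomorph.trans_source]
        exact hgs.comp (hφs.mono inter_subset_left) fun z hz => hz.2
      exact (euclExpEquiv mu (-τ)).contDiff.comp_contDiffOn h1
    · have h1 : ContDiffOn ℝ ∞ (φ.symm ∘ g.symm) (φ.trans g).target := by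
        rw [OpenPartialHomeomorph.trans_target]
        exact hφs'.comp (hgs'.mono inter_subset_left) fun z hz => hz.2
      exact h1.comp (euclExpEquiv mu (-τ)).symm.contDiff.contDiffOn fun z hz => hz
  have hall : basin w S ⊆ 𝒢 := by
    rintro x ⟨u, rfl, hu, hu0⟩
    obtain ⟨T, hT, hT0⟩ := ((hu0.eventually htarget).and (eventually_ge_atTop 0)).exists
    have hT0 : 0 ≤ T := hT0
    by_contra hx
    -- The last bad time c before T: slightly later points are good, and the previous step makes
    -- u(c) good as well, a contradiction.
    set B := Icc 0 T ∩ u ⁻¹' 𝒢ᶜ with hB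
    have hBc : IsCompact B := isCompact_Icc.of_isClosed_subset
      ((hu.continuousOn.mono Icc_subset_Ici_self).preimage_isClosed_of_isClosed isClosed_Icc
        h𝒢o.isClosed_compl) inter_subset_left
    obtain ⟨c, ⟨hcI, hcB⟩, hcmax⟩ := hBc.exists_isGreatest ⟨0, left_mem_Icc.2 hT0, hx⟩
    have hcT : c < T := lt_of_le_of_ne hcI.2 fun h => hcB (by rw [h]; exact htarget𝒢 hT)
    obtain ⟨ε, hε, hst⟩ := hstep _ (hu.shift hcI.1)
    set τ := min (ε / 2) (T - c) with hτ
    have hτ0 : 0 < τ := lt_min (half_pos hε) (sub_pos.2 hcT)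
    have hτε : τ < ε := (min_le_left _ _).trans_lt (half_lt_self hε)
    have hτT : τ ≤ T - c := min_le_right _ _
    have h1 : u (c + τ) ∈ 𝒢 := by
      by_contra h2
      have h3 := hcmax (a := c + τ) ⟨⟨by linarith [hcI.1], by linarith⟩, h2⟩
      linarith
    have h4 := hst τ ⟨hτ0, hτε⟩ h1
    simp only [add_zero] at h4
    exact hcB h4
  have hΨ0 : Ψ 0 = 0 := by
    have := hΨe 0 h0e
    rwa [he0] at this
  refine ⟨?_, Ψ, hΨ0, fun x hx => hall hx, ?_, fun u hu hu0 => hΨ (u 0) u rfl hu hu0⟩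
  · obtain ⟨g, h0g, hg, -⟩ := htarget𝒢 (mem_of_mem_nhds htarget)
    exact hg h0g
  · rintro x ⟨u, rfl, hu, hu0⟩
    obtain ⟨g, hxg, -, hgΨ, hgs, -⟩ := hall ⟨u, rfl, hu, hu0⟩
    have h1 : DifferentiableAt ℝ Ψ (u 0) :=
      (((hgs.contDiffAt (g.open_source.mem_nhds hxg)).differentiableAt (by simp))).congr_of_eventuallyEq
        (hgΨ.eventuallyEq_of_mem (g.open_source.mem_nhds hxg))
    have h2 : HasDerivWithinAt (fun t => Ψ (u t)) (fderiv ℝ Ψ (u 0) (w (u 0))) (Ici 0) 0 :=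
      h1.hasFDerivAt.comp_hasDerivWithinAt 0 (hu 0 self_mem_Ici).1
    have h3 : HasDerivWithinAt (fun t => Ψ (u t)) (euclDiag mu (Ψ (u 0))) (Ici 0) 0 := by
      have h4 := (hasDerivAt_euclExp mu 0 (Ψ (u 0))).hasDerivWithinAt (s := Ici 0)
      rw [euclExp_zero] at h4
      exact h4.congr (fun t ht => hΨu u hu hu0 t ht) (hΨu u hu hu0 0 le_rfl)
    exact (uniqueDiffWithinAt_Ici (0 : ℝ)).eq_deriv _ h2 h3

end Conjugation

/-! ### Vector fields in local coordinates -/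

section CoordField

variable {k m : ℕ} {X : Type*} [TopologicalSpace X]
  [ChartedSpace (EuclideanSpace ℝ (Fin (k + m))) X]

/-- A diffeomorphism from an open set of coordinates onto an open set of the manifold. -/
structure IsSmoothChart (Φ : OpenPartialHomeomorph (Coord k m) X) : Prop where
  smooth : ContMDiffOn 𝓘(ℝ, Coord k m) (𝓡 (k + m)) ∞ Φ Φ.source
  smooth_symm : ContMDiffOn (𝓡 (k + m)) 𝓘(ℝ, Coord k m) ∞ Φ.symm Φ.target

theorem IsAdaptedChart.isSmoothChart [IsManifold (𝓡 (k + m)) ∞ X] {V : (x : X) → TangentSpace (𝓡 (k + m)) x} {p : X}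
    {lam : Fin (k + m) → ℝ} {Φ : OpenPartialHomeomorph (Coord k m) X}
    (h : IsAdaptedChart V p lam Φ) : IsSmoothChart Φ := ⟨h.smooth, h.smooth_symm⟩

/-- The derivative of local coordinates. -/
noncomputable def chartDeriv (Φ : OpenPartialHomeomorph (Coord k m) X) (z : Coord k m) :
    Coord k m →L[ℝ] EuclideanSpace ℝ (Fin (k + m)) :=
  mfderiv 𝓘(ℝ, Coord k m) (𝓡 (k + m)) Φ z

namespace IsSmoothChart

variable {Φ : OpenPartialHomeomorph (Coord k m) X}

theorem mdifferentiable (hΦ : IsSmoothChart Φ) :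
    Φ.MDifferentiable 𝓘(ℝ, Coord k m) (𝓡 (k + m)) :=
  ⟨hΦ.smooth.mdifferentiableOn (by simp), hΦ.smooth_symm.mdifferentiableOn (by simp)⟩

theorem exists_chartDeriv_eq (hΦ : IsSmoothChart Φ) {z : Coord k m} (hz : z ∈ Φ.source) :
    ∃ A : Coord k m ≃L[ℝ] EuclideanSpace ℝ (Fin (k + m)),
      chartDeriv Φ z = (A : Coord k m →L[ℝ] EuclideanSpace ℝ (Fin (k + m))) :=
  ⟨hΦ.mdifferentiable.mfderiv hz, rfl⟩

theorem chartDeriv_injective (hΦ : IsSmoothChart Φ) {z : Coord k m} (hz : z ∈ Φ.source) :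
    Function.Injective (chartDeriv Φ z) := by
  obtain ⟨A, hA⟩ := hΦ.exists_chartDeriv_eq hz
  rw [hA]
  exact A.injective

theorem hasMFDerivAt (hΦ : IsSmoothChart Φ) {z : Coord k m} (hz : z ∈ Φ.source) :
    HasMFDerivAt 𝓘(ℝ, Coord k m) (𝓡 (k + m)) Φ z (chartDeriv Φ z) :=
  (hΦ.mdifferentiable.mdifferentiableAt hz).hasMFDerivAt

theorem trans (hΦ : IsSmoothChart Φ) {κ : OpenPartialHomeomorph (Coord k m) (Coord k m)}
    (hκ : ContDiffOn ℝ ∞ κ κ.source) (hκ' : ContDiffOn ℝ ∞ κ.symm κ.target) :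
    IsSmoothChart (κ.trans Φ) := by
  refine ⟨?_, ?_⟩
  · rw [OpenPartialHomeomorph.trans_source]
    exact hΦ.smooth.comp (hκ.contMDiffOn.mono inter_subset_left) fun z hz => hz.2
  · rw [OpenPartialHomeomorph.trans_target]
    exact hκ'.contMDiffOn.comp (hΦ.smooth_symm.mono inter_subset_left) fun z hz => hz.2

theorem restrOpen (hΦ : IsSmoothChart Φ) {s : Set (Coord k m)} (hs : IsOpen s) :
    IsSmoothChart (Φ.restrOpen s hs) :=
  ⟨hΦ.smooth.mono inter_subset_left, hΦ.smooth_symm.mono inter_subset_left⟩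

theorem chartDeriv_trans (hΦ : IsSmoothChart Φ)
    {κ : OpenPartialHomeomorph (Coord k m) (Coord k m)}
    {z : Coord k m} (hκ : DifferentiableAt ℝ κ z) (hz : κ z ∈ Φ.source) :
    chartDeriv (κ.trans Φ) z = (chartDeriv Φ (κ z)).comp (fderiv ℝ κ z) :=
  ((hΦ.hasMFDerivAt hz).comp z hκ.hasFDerivAt.hasMFDerivAt).mfderiv

theorem chartDeriv_coordField (hΦ : IsSmoothChart Φ) (V : (x : X) → TangentSpace (𝓡 (k + m)) x)
    {z : Coord k m} (hz : z ∈ Φ.source) : chartDeriv Φ z (coordField V Φ z) = V (Φ z) := by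
  obtain ⟨A, hA⟩ := hΦ.exists_chartDeriv_eq hz
  change chartDeriv Φ z ((chartDeriv Φ z).inverse (V (Φ z))) = V (Φ z)
  rw [hA, ContinuousLinearMap.inverse_equiv]
  exact A.apply_symm_apply _

theorem coordField_eq (hΦ : IsSmoothChart Φ) {V : (x : X) → TangentSpace (𝓡 (k + m)) x}
    {z c : Coord k m} (hz : z ∈ Φ.source) (h : chartDeriv Φ z c = V (Φ z)) :
    coordField V Φ z = c :=
  hΦ.chartDeriv_injective hz ((hΦ.chartDeriv_coordField V hz).trans h.symm)

theorem fderiv_coordField_trans (hΦ : IsSmoothChart Φ)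
    {κ : OpenPartialHomeomorph (Coord k m) (Coord k m)}
    (hκ : ContDiffOn ℝ ∞ κ κ.source) (hκ' : ContDiffOn ℝ ∞ κ.symm κ.target)
    (V : (x : X) → TangentSpace (𝓡 (k + m)) x) {z : Coord k m} (hz : z ∈ (κ.trans Φ).source) :
    fderiv ℝ κ z (coordField V (κ.trans Φ) z) = coordField V Φ (κ z) := by
  have hz' := hz
  rw [OpenPartialHomeomorph.trans_source] at hz'
  have hd : DifferentiableAt ℝ κ z :=
    (hκ.contDiffAt (κ.open_source.mem_nhds hz'.1)).differentiableAt (by simp)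
  refine (hΦ.coordField_eq hz'.2 ?_).symm
  have h1 := (hΦ.trans hκ hκ').chartDeriv_coordField V hz
  rw [hΦ.chartDeriv_trans hd hz'.2] at h1
  exact h1

theorem isSolutionIn_of_isMIntegralCurveOn (hΦ : IsSmoothChart Φ)
    {V : (x : X) → TangentSpace (𝓡 (k + m)) x} {γ : ℝ → X} {s : Set ℝ}
    (hγ : IsMIntegralCurveOn γ V s) (hmem : ∀ t ∈ s, γ t ∈ Φ.target) :
    IsSolutionIn (coordField V Φ) Φ.source (fun t => Φ.symm (γ t)) s := by
  intro t ht
  have hsrc := Φ.map_target (hmem t ht)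
  refine ⟨?_, hsrc⟩
  have h1 := ((hΦ.mdifferentiable.mdifferentiableAt_symm (hmem t ht)).hasMFDerivAt).comp_hasMFDerivWithinAt
    t (hγ t ht)
  have h3 := hΦ.mdifferentiable.comp_symm_deriv (hmem t ht)
  have h4 := congrArg (fun L : EuclideanSpace ℝ (Fin (k + m)) →L[ℝ] EuclideanSpace ℝ (Fin (k + m)) =>
    L ((1 : ℝ) • V (γ t))) h3
  have h5 : V (Φ (Φ.symm (γ t))) = (1 : ℝ) • V (γ t) := by
    rw [one_smul]
    exact congrArg (fun x => (V x : EuclideanSpace ℝ (Fin (k + m)))) (Φ.right_inv (hmem t ht))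
  obtain ⟨L, hL, hL1⟩ : ∃ L : ℝ →L[ℝ] Coord k m, HasFDerivWithinAt (fun t => Φ.symm (γ t)) L s t ∧
      chartDeriv Φ (Φ.symm (γ t)) (L 1) = V (Φ (Φ.symm (γ t))) :=
    ⟨_, h1.hasFDerivWithinAt, h4.trans h5.symm⟩
  exact hL.hasDerivWithinAt.congr_deriv (hΦ.coordField_eq hsrc hL1).symm

theorem isMIntegralCurveOn_of_isSolutionIn (hΦ : IsSmoothChart Φ)
    {V : (x : X) → TangentSpace (𝓡 (k + m)) x} {u : ℝ → Coord k m} {s : Set ℝ}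
    (hu : IsSolutionIn (coordField V Φ) Φ.source u s) :
    IsMIntegralCurveOn (fun t => Φ (u t)) V s := by
  intro t ht
  obtain ⟨h1, h2⟩ := hu t ht
  refine ((hΦ.hasMFDerivAt h2).comp_hasMFDerivWithinAt t
    h1.hasFDerivWithinAt.hasMFDerivWithinAt).congr_mfderiv ?_
  refine ContinuousLinearMap.ext fun r => ?_
  have h3 := hΦ.chartDeriv_coordField V h2
  have h4 := (chartDeriv Φ (u t)).map_smul (show ℝ from r) (coordField V Φ (u t))
  rw [h3] at h4
  exact h4

theorem contDiffOn_comp (hΦ : IsSmoothChart Φ) {f : X → ℝ}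
    (hf : ContMDiff (𝓡 (k + m)) 𝓘(ℝ, ℝ) ∞ f) : ContDiffOn ℝ ∞ (fun z => f (Φ z)) Φ.source :=
  contMDiffOn_iff_contDiffOn.1 (hf.comp_contMDiffOn hΦ.smooth)

end IsSmoothChart

end CoordField

/-! ### The gradient in local coordinates -/

section GradientCoord

variable {k m : ℕ} {X : Type*} [TopologicalSpace X]
  [ChartedSpace (EuclideanSpace ℝ (Fin (k + m))) X] [IsManifold (𝓡 (k + m)) ∞ X]

/-- The metric at `x` as a bilinear form on the model space. -/
noncomputable def metricForm (g : SmoothMetric (k + m) X) (x : X) :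
    EuclideanSpace ℝ (Fin (k + m)) →L[ℝ] EuclideanSpace ℝ (Fin (k + m)) →L[ℝ] ℝ :=
  g.inner x

/-- The metric in local coordinates. -/
noncomputable def metricCoord (g : SmoothMetric (k + m) X)
    (Φ : OpenPartialHomeomorph (Coord k m) X) (z : Coord k m) :
    Coord k m →L[ℝ] Coord k m →L[ℝ] ℝ :=
  (metricForm g (Φ z)).bilinearComp (chartDeriv Φ z) (chartDeriv Φ z)

variable {Φ : OpenPartialHomeomorph (Coord k m) X}

theorem metricCoord_apply (g : SmoothMetric (k + m) X) (z v w : Coord k m) :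
    metricCoord g Φ z v w = metricForm g (Φ z) (chartDeriv Φ z v) (chartDeriv Φ z w) :=
  rfl

theorem metricCoord_pos (hΦ : IsSmoothChart Φ) (g : SmoothMetric (k + m) X) {z : Coord k m} (hz : z ∈ Φ.source)
    {v : Coord k m} (hv : v ≠ 0) : 0 < metricCoord g Φ z v v :=
  g.pos (Φ z) (chartDeriv Φ z v) fun h =>
    hv (hΦ.chartDeriv_injective hz (h.trans (_root_.map_zero (chartDeriv Φ z)).symm))

theorem contMDiffOn_chartDeriv_apply (hΦ : IsSmoothChart Φ) (v : Coord k m) :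
    ContMDiffOn 𝓘(ℝ, Coord k m) (𝓡 (k + m)).tangent ∞
      (fun z => (⟨Φ z, mfderiv 𝓘(ℝ, Coord k m) (𝓡 (k + m)) Φ z v⟩ : TangentBundle (𝓡 (k + m)) X))
      Φ.source := by
  have h1 := hΦ.smooth.contMDiffOn_tangentMapWithin (m := ∞) le_rfl
    Φ.open_source.uniqueMDiffOn
  have h2 : ContMDiffOn 𝓘(ℝ, Coord k m) 𝓘(ℝ, Coord k m).tangent ∞
      (fun z => (⟨z, v⟩ : TangentBundle 𝓘(ℝ, Coord k m) (Coord k m))) Φ.source :=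
    contMDiffOn_vectorSpace_iff_contDiffOn.2 contDiffOn_const
  refine (h1.comp h2 fun z hz => hz).congr fun z hz => ?_
  simp only [Function.comp_apply, tangentMapWithin]
  rw [mfderivWithin_of_isOpen Φ.open_source hz]

theorem contDiffOn_metricCoord (hΦ : IsSmoothChart Φ) (g : SmoothMetric (k + m) X) :
    ContDiffOn ℝ ∞ (metricCoord g Φ) Φ.source := by
  rw [contDiffOn_clm_apply]
  intro v
  rw [contDiffOn_clm_apply]
  intro w
  rw [← contMDiffOn_iff_contDiffOn]
  intro z hz
  have h1 : ContMDiffWithinAt 𝓘(ℝ, Coord k m) ((𝓡 (k + m)).prod 𝓘(ℝ)) ∞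
      (fun z => Bundle.TotalSpace.mk' ℝ (E := Bundle.Trivial X ℝ) (Φ z)
        (g.inner (Φ z) (mfderiv 𝓘(ℝ, Coord k m) (𝓡 (k + m)) Φ z v)
          (mfderiv 𝓘(ℝ, Coord k m) (𝓡 (k + m)) Φ z w))) Φ.source z := by
    apply ContMDiffWithinAt.clm_bundle_apply₂ (F₁ := EuclideanSpace ℝ (Fin (k + m)))
      (F₂ := EuclideanSpace ℝ (Fin (k + m)))
    · exact ContMDiffAt.comp_contMDiffWithinAt z g.contMDiff.contMDiffAt (hΦ.smooth z hz)
    · exact contMDiffOn_chartDeriv_apply hΦ v z hz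
    · exact contMDiffOn_chartDeriv_apply hΦ w z hz
  simp only [Bundle.contMDiffWithinAt_totalSpace] at h1
  exact h1.2

theorem metricCoord_coordField (hΦ : IsSmoothChart Φ) (g : SmoothMetric (k + m) X) {f : X → ℝ}
    (hf : ContMDiff (𝓡 (k + m)) 𝓘(ℝ, ℝ) ∞ f) {z : Coord k m} (hz : z ∈ Φ.source) :
    metricCoord g Φ z (coordField (riemGradient g f) Φ z) = fderiv ℝ (fun z => f (Φ z)) z := by
  refine ContinuousLinearMap.ext fun w => ?_
  rw [metricCoord_apply, hΦ.chartDeriv_coordField _ hz]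
  have h1 := inner_riemGradient g f (Φ z) (chartDeriv Φ z w)
  obtain ⟨L, hL, hLw⟩ : ∃ L : Coord k m →L[ℝ] ℝ, HasFDerivAt (fun z => f (Φ z)) L z ∧
      L w = mfderiv (𝓡 (k + m)) 𝓘(ℝ, ℝ) f (Φ z) (chartDeriv Φ z w) :=
    ⟨_, ((hf.mdifferentiable (by simp) (Φ z)).hasMFDerivAt.comp z
      (hΦ.hasMFDerivAt hz)).hasFDerivAt, rfl⟩
  rw [hL.fderiv, hLw]
  exact h1

/-- In coordinates the gradient is G⁻¹ dF, where G is the positive definite metric matrix; inversion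
of operators is smooth at invertible ones. -/
theorem contDiffOn_coordField_riemGradient (hΦ : IsSmoothChart Φ) (g : SmoothMetric (k + m) X) {f : X → ℝ}
    (hf : ContMDiff (𝓡 (k + m)) 𝓘(ℝ, ℝ) ∞ f) :
    ContDiffOn ℝ ∞ (coordField (riemGradient g f) Φ) Φ.source := by
  have hequiv : ∀ z ∈ Φ.source, ∃ A : Coord k m ≃L[ℝ] (Coord k m →L[ℝ] ℝ),
      (A : Coord k m →L[ℝ] Coord k m →L[ℝ] ℝ) = metricCoord g Φ z := by
    intro z hz
    have hinj : Function.Injective (metricCoord g Φ z).toLinearMap := by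
      rw [injective_iff_map_eq_zero]
      intro v hv
      by_contra hne
      refine (metricCoord_pos hΦ g hz hne).ne' ?_
      exact congrArg (fun L : Coord k m →L[ℝ] ℝ => L v) hv
    have hdim : Module.finrank ℝ (Coord k m) = Module.finrank ℝ (Coord k m →L[ℝ] ℝ) := by
      rw [← (LinearMap.toContinuousLinearMap : (Coord k m →ₗ[ℝ] ℝ) ≃ₗ[ℝ] _).finrank_eq]
      exact Subspace.dual_finrank_eq.symm
    refine ⟨(LinearEquiv.ofInjectiveOfFinrankEq (metricCoord g Φ z).toLinearMap hinj
      hdim).toContinuousLinearEquiv, ?_⟩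
    rfl
  have hG : ContDiffOn ℝ ∞ (fun z => (metricCoord g Φ z).inverse
      (fderiv ℝ (fun z => f (Φ z)) z)) Φ.source := by
    refine ContDiffOn.clm_apply ?_
      ((hΦ.contDiffOn_comp hf).fderiv_of_isOpen Φ.open_source le_rfl)
    intro z hz
    obtain ⟨A, hA⟩ := hequiv z hz
    have h1 := contDiffAt_map_inverse (n := ∞) A
    rw [hA] at h1
    exact h1.comp_contDiffWithinAt z (contDiffOn_metricCoord hΦ g z hz)
  refine hG.congr fun z hz => ?_
  obtain ⟨A, hA⟩ := hequiv z hz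
  rw [← metricCoord_coordField hΦ g hf hz, ← hA, ContinuousLinearMap.inverse_equiv]
  exact (A.symm_apply_apply _).symm

end GradientCoord

/-! ### Coordinates in which the linear part of the gradient is diagonal -/

section Diagonalization

/-- Both tuples have the same sorted rearrangement. -/
theorem exists_perm_of_ofFn_perm {n : ℕ} {a b : Fin n → ℝ}
    (h : (List.ofFn a).Perm (List.ofFn b)) : ∃ σ : Equiv.Perm (Fin n), a = b ∘ σ := by
  have h1 : a ∘ Tuple.sort a = b ∘ Tuple.sort b := List.ofFn_injective <|
    (((Tuple.sort a).ofFn_comp_perm a).trans (h.trans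
      ((Tuple.sort b).ofFn_comp_perm b).symm)).eq_of_pairwise'
        (Tuple.monotone_sort a).sortedLE_ofFn.pairwise
        (Tuple.monotone_sort b).sortedLE_ofFn.pairwise
  refine ⟨(Tuple.sort a).symm.trans (Tuple.sort b), funext fun i => ?_⟩
  have h2 := congrFun h1 ((Tuple.sort a).symm i)
  simpa using h2

/-- An operator which is symmetric for a positive definite form has a basis of eigenvectors, listed
in the order of any given factorization of its characteristic polynomial. -/
theorem exists_eigenbasis {E : Type*} [AddCommGroup E] [Module ℝ E] [FiniteDimensional ℝ E]
    (b : E →ₗ[ℝ] E →ₗ[ℝ] ℝ) (hsymm : ∀ v w, b v w = b w v) (hpos : ∀ v, v ≠ 0 → 0 < b v v)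
    (T : Module.End ℝ E) (hT : ∀ v w, b (T v) w = b v (T w)) {n : ℕ}
    (hn : Module.finrank ℝ E = n) (lam : Fin n → ℝ)
    (hlam : T.charpoly = ∏ i, (Polynomial.X - Polynomial.C (lam i))) :
    ∃ B : Module.Basis (Fin n) ℝ E, ∀ i, T (B i) = lam i • B i := by
  let core : InnerProductSpace.Core ℝ E :=
    { inner := fun v w => b v w
      conj_inner_symm := fun v w => hsymm w v
      re_inner_nonneg := fun v => by
        by_cases hv : v = 0
        · simp [hv]
        · exact (hpos v hv).le
      add_left := fun u v w => by simp
      smul_left := fun u v r => by simp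
      definite := fun v hv => by
        by_contra hne
        exact (hpos v hne).ne' hv }
  let _ : NormedAddCommGroup E := core.toNormedAddCommGroup
  let _ : InnerProductSpace ℝ E := InnerProductSpace.ofCore core.toCore
  have hTs : T.IsSymmetric := hT
  -- The spectral theorem lists the eigenvalues in its own order; comparing the roots of the
  -- characteristic polynomial with multiplicity gives the permutation to the prescribed order.
  have hroots : Multiset.map (hTs.eigenvalues hn) Finset.univ.val =
      Multiset.map lam Finset.univ.val := by
    have h1 := hTs.roots_charpoly_eq_eigenvalues hn
    rw [hlam, Polynomial.roots_prod _ _ (by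
      simp [Finset.prod_ne_zero_iff, Polynomial.X_sub_C_ne_zero])] at h1
    simpa [Function.comp_def] using h1.symm
  obtain ⟨σ, hσ⟩ : ∃ σ : Equiv.Perm (Fin n), lam = hTs.eigenvalues hn ∘ σ := by
    refine exists_perm_of_ofFn_perm ?_
    rw [Fin.univ_val_map, Fin.univ_val_map] at hroots
    exact (Multiset.coe_eq_coe.1 hroots).symm
  refine ⟨(hTs.eigenvectorBasis hn).toBasis.reindex σ.symm, fun i => ?_⟩
  rw [Module.Basis.reindex_apply, Equiv.symm_symm, OrthonormalBasis.coe_toBasis,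
    hTs.apply_eigenvectorBasis hn, hσ]
  rfl

/-- Splitting the coordinates of `ℝᵏ⁺ᵐ` into `ℝᵏ × ℝᵐ`. -/
noncomputable def splitEquiv (k m : ℕ) : (Fin (k + m) → ℝ) ≃L[ℝ] Coord k m :=
  LinearEquiv.toContinuousLinearEquiv
    { toFun := fun x => (WithLp.toLp 2 fun i => x (Fin.castAdd m i),
        WithLp.toLp 2 fun j => x (Fin.natAdd k j))
      map_add' := fun x y => rfl
      map_smul' := fun c x => rfl
      invFun := fun z => Fin.append z.1.ofLp z.2.ofLp
      left_inv := fun x => Fin.append_castAdd_natAdd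
      right_inv := fun z => by ext <;> simp }

/-- The diagonal linear map `V₀`. -/
noncomputable def stdFieldCLM {k m : ℕ} (lam : Fin (k + m) → ℝ) : Coord k m →L[ℝ] Coord k m :=
  (euclDiag fun i => lam (Fin.castAdd m i)).prodMap (euclDiag fun j => lam (Fin.natAdd k j))

theorem splitEquiv_diagCLM {k m : ℕ} (lam x : Fin (k + m) → ℝ) :
    splitEquiv k m (diagCLM lam x) = stdFieldCLM lam (splitEquiv k m x) :=
  rfl

variable {k m : ℕ} {X : Type*} [TopologicalSpace X]
  [ChartedSpace (EuclideanSpace ℝ (Fin (k + m))) X]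

/-- The chart at `p`, composed with a linear change of coordinates. -/
noncomputable def linearChart (p : X) (L : Coord k m ≃L[ℝ] EuclideanSpace ℝ (Fin (k + m))) :
    OpenPartialHomeomorph (Coord k m) X :=
  (L.toHomeomorph.trans (Homeomorph.addRight
    (chartAt (EuclideanSpace ℝ (Fin (k + m))) p p))).toOpenPartialHomeomorph.trans
      (chartAt (EuclideanSpace ℝ (Fin (k + m))) p).symm

theorem linearChart_apply (p : X) (L : Coord k m ≃L[ℝ] EuclideanSpace ℝ (Fin (k + m)))
    (z : Coord k m) :
    linearChart p L z = (extChartAt (𝓡 (k + m)) p).symm (L z + extChartAt (𝓡 (k + m)) p p) :=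
  rfl

theorem mem_linearChart_source (p : X) (L : Coord k m ≃L[ℝ] EuclideanSpace ℝ (Fin (k + m)))
    (z : Coord k m) : z ∈ (linearChart p L).source ↔
      L z + chartAt (EuclideanSpace ℝ (Fin (k + m))) p p ∈
        (chartAt (EuclideanSpace ℝ (Fin (k + m))) p).target := by
  simp [linearChart]

theorem zero_mem_linearChart_source (p : X)
    (L : Coord k m ≃L[ℝ] EuclideanSpace ℝ (Fin (k + m))) : 0 ∈ (linearChart p L).source := by
  rw [mem_linearChart_source, _root_.map_zero, zero_add]
  exact mem_chart_target _ p

theorem linearChart_zero (p : X) (L : Coord k m ≃L[ℝ] EuclideanSpace ℝ (Fin (k + m))) :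
    linearChart p L 0 = p := by
  rw [linearChart_apply, _root_.map_zero, zero_add]
  exact extChartAt_to_inv p

variable [IsManifold (𝓡 (k + m)) ∞ X]

theorem contDiffAt_comp_extChartAt_symm {f : X → ℝ} (hf : ContMDiff (𝓡 (k + m)) 𝓘(ℝ, ℝ) ∞ f)
    (p : X) : ContDiffAt ℝ ∞ (f ∘ (extChartAt (𝓡 (k + m)) p).symm)
      (extChartAt (𝓡 (k + m)) p p) := by
  rw [← contMDiffAt_iff_contDiffAt]
  have h1 : ContMDiffOn 𝓘(ℝ, EuclideanSpace ℝ (Fin (k + m))) (𝓡 (k + m)) ∞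
      (extChartAt (𝓡 (k + m)) p).symm (extChartAt (𝓡 (k + m)) p).target :=
    contMDiffOn_extChartAt_symm p
  exact (hf.comp_contMDiffOn h1).contMDiffAt (extChartAt_target_mem_nhds p)

theorem metricForm_hessianOperator (g : SmoothMetric (k + m) X) (f : X → ℝ) (p : X)
    (v w : EuclideanSpace ℝ (Fin (k + m))) :
    metricForm g p (hessianOperator g f p v) w = hessianForm f p v w :=
  congrArg (fun l : Module.Dual ℝ (EuclideanSpace ℝ (Fin (k + m))) => l w)
    (lowerIndex_raiseIndex g p (hessianForm f p v).toLinearMap)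

theorem hessianForm_symm {f : X → ℝ} (hf : ContMDiff (𝓡 (k + m)) 𝓘(ℝ, ℝ) ∞ f) (p : X)
    (v w : EuclideanSpace ℝ (Fin (k + m))) : hessianForm f p v w = hessianForm f p w v :=
  (contDiffAt_comp_extChartAt_symm hf p).isSymmSndFDerivAt
    (by rw [minSmoothness_of_isRCLikeNormedField]; exact WithTop.coe_le_coe.2 (le_top : (2 : ℕ∞) ≤ ⊤)) v w

theorem exists_diagonalizing_equiv (g : SmoothMetric (k + m) X) {f : X → ℝ}
    (hf : ContMDiff (𝓡 (k + m)) 𝓘(ℝ, ℝ) ∞ f) {p : X} {lam : Fin (k + m) → ℝ}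
    (hlam : IsMorseEigenvalues g f p lam) :
    ∃ L : Coord k m ≃L[ℝ] EuclideanSpace ℝ (Fin (k + m)),
      ∀ z, hessianOperator g f p (L z) = L (stdFieldCLM lam z) := by
  have hsymm : ∀ v w, metricForm g p v w = metricForm g p w v := fun v w => g.symm p v w
  obtain ⟨B, hB⟩ := exists_eigenbasis
    (ContinuousLinearMap.coeLM ℝ ∘ₗ (metricForm g p).toLinearMap) hsymm
    (fun v hv => g.pos p v hv) (hessianOperator g f p)
    (fun v w => by
      change metricForm g p (hessianOperator g f p v) w = metricForm g p v (hessianOperator g f p w)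
      rw [hsymm v, metricForm_hessianOperator, metricForm_hessianOperator, hessianForm_symm hf])
    (finrank_euclideanSpace_fin) lam hlam
  have hdiag : ∀ x, hessianOperator g f p (B.equivFun.symm x) =
      B.equivFun.symm (diagCLM lam x) := by
    intro x
    simp only [Module.Basis.equivFun_symm_apply, map_sum, _root_.map_smul, hB, diagCLM_apply,
      smul_smul, mul_comm]
  refine ⟨(splitEquiv k m).symm.trans B.equivFun.symm.toContinuousLinearEquiv, fun z => ?_⟩
  have h1 : (splitEquiv k m).symm (stdFieldCLM lam z) = diagCLM lam ((splitEquiv k m).symm z) := by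
    rw [ContinuousLinearEquiv.symm_apply_eq, splitEquiv_diagCLM,
      ContinuousLinearEquiv.apply_symm_apply]
  have h2 := hdiag ((splitEquiv k m).symm z)
  rw [← h1] at h2
  exact h2

theorem isSmoothChart_linearChart (p : X) (L : Coord k m ≃L[ℝ] EuclideanSpace ℝ (Fin (k + m))) :
    IsSmoothChart (linearChart p L) := by
  set c := chartAt (EuclideanSpace ℝ (Fin (k + m))) p p with hc
  refine ⟨?_, ?_⟩
  · have h1 : ContDiff ℝ ∞ fun z : Coord k m => L z + c := L.contDiff.add contDiff_const
    exact (contMDiffOn_chart_symm (I := 𝓡 (k + m)) (n := ∞) (x := p)).comp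
      h1.contMDiff.contMDiffOn fun z hz => (mem_linearChart_source p L z).1 hz
  · have h1 : ContDiff ℝ ∞ fun y : EuclideanSpace ℝ (Fin (k + m)) => L.symm (y + -c) :=
      L.symm.contDiff.comp (contDiff_id.add contDiff_const)
    have h2 : ContMDiffOn (𝓡 (k + m)) 𝓘(ℝ, Coord k m) ∞
        (fun x => L.symm (chartAt (EuclideanSpace ℝ (Fin (k + m))) p x + -c))
        (chartAt (EuclideanSpace ℝ (Fin (k + m))) p).source :=
      h1.contMDiff.comp_contMDiffOn (contMDiffOn_chart (I := 𝓡 (k + m)) (n := ∞) (x := p))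
    refine h2.mono fun x hx => ?_
    simp [linearChart] at hx
    exact hx

/-- The tangent space at `p` is identified with the model space through the preferred chart at `p`,
whose derivative there is therefore the identity. -/
theorem chartDeriv_linearChart (p : X) (L : Coord k m ≃L[ℝ] EuclideanSpace ℝ (Fin (k + m))) :
    chartDeriv (linearChart p L) 0 = (L : Coord k m →L[ℝ] EuclideanSpace ℝ (Fin (k + m))) := by
  have hΦ := isSmoothChart_linearChart p L
  have h0 := zero_mem_linearChart_source p L
  have h1 := hΦ.hasMFDerivAt h0
  have h2 : HasMFDerivAt (𝓡 (k + m)) 𝓘(ℝ, EuclideanSpace ℝ (Fin (k + m)))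
      (extChartAt (𝓡 (k + m)) p) (linearChart p L 0)
      (mfderiv (𝓡 (k + m)) 𝓘(ℝ, EuclideanSpace ℝ (Fin (k + m))) (extChartAt (𝓡 (k + m)) p)
        (linearChart p L 0)) := by
    refine (mdifferentiableAt_extChartAt ?_).hasMFDerivAt
    rw [linearChart_zero]
    exact mem_chart_source _ p
  obtain ⟨M, hM, hMv⟩ : ∃ M : Coord k m →L[ℝ] EuclideanSpace ℝ (Fin (k + m)),
      HasFDerivAt (fun z => extChartAt (𝓡 (k + m)) p (linearChart p L z)) M 0 ∧
        M = chartDeriv (linearChart p L) 0 := by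
    refine ⟨_, (h2.comp 0 h1).hasFDerivAt, ?_⟩
    have h3 : (mfderiv (𝓡 (k + m)) 𝓘(ℝ, EuclideanSpace ℝ (Fin (k + m)))
        (extChartAt (𝓡 (k + m)) p) (linearChart p L 0) :
        EuclideanSpace ℝ (Fin (k + m)) →L[ℝ] EuclideanSpace ℝ (Fin (k + m))) =
        ContinuousLinearMap.id ℝ _ := by
      rw [linearChart_zero]
      exact mfderiv_extChartAt_self
    refine ContinuousLinearMap.ext fun v => ?_
    exact congrArg (fun A : EuclideanSpace ℝ (Fin (k + m)) →L[ℝ] EuclideanSpace ℝ (Fin (k + m)) =>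
      A (chartDeriv (linearChart p L) 0 v)) h3
  rw [← hMv]
  have h4 : HasFDerivAt (fun z => L z + extChartAt (𝓡 (k + m)) p p)
      (L : Coord k m →L[ℝ] EuclideanSpace ℝ (Fin (k + m))) 0 :=
    L.hasFDerivAt.add_const _
  refine hM.unique (h4.congr_of_eventuallyEq ?_)
  filter_upwards [(linearChart p L).open_source.mem_nhds h0] with z hz
  rw [linearChart_apply]
  refine (extChartAt (𝓡 (k + m)) p).right_inv ?_
  rw [mem_linearChart_source] at hz
  simpa using hz

/-- Differentiate G(z) c(z) = dF(z) at 0. Since c(0) = 0 the derivative of the metric drops out, so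
G(0) Dc(0) is the Hessian and Dc(0) is g⁻¹ Hess f in the eigenbasis. -/
theorem exists_chart_with_diagonal_linear_part (g : SmoothMetric (k + m) X) {f : X → ℝ}
    (hf : ContMDiff (𝓡 (k + m)) 𝓘(ℝ, ℝ) ∞ f) {p : X} (hp : riemGradient g f p = 0)
    {lam : Fin (k + m) → ℝ} (hlam : IsMorseEigenvalues g f p lam) :
    ∃ Φ : OpenPartialHomeomorph (Coord k m) X, IsSmoothChart Φ ∧ 0 ∈ Φ.source ∧ Φ 0 = p ∧
      coordField (riemGradient g f) Φ 0 = 0 ∧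
      HasFDerivAt (coordField (riemGradient g f) Φ) (stdFieldCLM lam) 0 := by
  obtain ⟨L, hL⟩ := exists_diagonalizing_equiv g hf hlam
  have hΦ := isSmoothChart_linearChart p L
  have h0 := zero_mem_linearChart_source p L
  have hΦ0 := linearChart_zero p L
  have hΦ' := chartDeriv_linearChart p L
  set Φ := linearChart p L with hΦdef
  have hc0 : coordField (riemGradient g f) Φ 0 = 0 := by
    refine hΦ.coordField_eq h0 ?_
    rw [_root_.map_zero, hΦ0]
    exact hp.symm
  refine ⟨Φ, hΦ, h0, hΦ0, hc0, ?_⟩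
  set c := coordField (riemGradient g f) Φ with hc
  have hnhds := Φ.open_source.mem_nhds h0
  have hcs : DifferentiableAt ℝ c 0 := ((contDiffOn_coordField_riemGradient hΦ g hf).contDiffAt
    hnhds).differentiableAt (by simp)
  have hGs : DifferentiableAt ℝ (metricCoord g Φ) 0 :=
    ((contDiffOn_metricCoord hΦ g).contDiffAt hnhds).differentiableAt (by simp)
  have h1 : HasFDerivAt (fun z => metricCoord g Φ z (c z))
      ((metricCoord g Φ 0).comp (fderiv ℝ c 0)) 0 := by
    refine (hGs.hasFDerivAt.clm_apply hcs.hasFDerivAt).congr_fderiv ?_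
    refine ContinuousLinearMap.ext fun v => ?_
    simp [hc0]
  set F := f ∘ (extChartAt (𝓡 (k + m)) p).symm with hF
  set q := extChartAt (𝓡 (k + m)) p p with hq
  have hFs : ContDiffAt ℝ ∞ F q := contDiffAt_comp_extChartAt_symm hf p
  let Lc : Coord k m →L[ℝ] EuclideanSpace ℝ (Fin (k + m)) := L
  have hLz : ∀ z, HasFDerivAt (fun z => L z + q) Lc z := fun z => L.hasFDerivAt.add_const _
  have hev : ∀ᶠ z in 𝓝 (0 : Coord k m), DifferentiableAt ℝ F (L z + q) := by
    have h2 : Tendsto (fun z : Coord k m => L z + q) (𝓝 0) (𝓝 q) := by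
      simpa using (hLz 0).continuousAt.tendsto
    refine h2.eventually ?_
    filter_upwards [(hFs.of_le (m := 1) (by simp)).eventually (by simp)] with y hy
    exact hy.differentiableAt (by simp)
  have hev2 : (fun z => metricCoord g Φ z (c z)) =ᶠ[𝓝 0]
      fun z => (fderiv ℝ F (L z + q)).comp Lc := by
    filter_upwards [hev, hnhds] with z hz hzs
    rw [hc, metricCoord_coordField hΦ g hf hzs]
    exact (hz.hasFDerivAt.comp z (hLz z)).fderiv
  have h3 : HasFDerivAt (fderiv ℝ F) (hessianForm f p) (L 0 + q) := by
    rw [_root_.map_zero, zero_add]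
    exact ((hFs.fderiv_right (m := ∞) le_rfl).differentiableAt (by simp)).hasFDerivAt
  have h4 := ((h3.comp 0 (hLz 0)).clm_comp (hasFDerivAt_const Lc 0)).congr_of_eventuallyEq hev2
  have h5 := h1.unique h4
  refine hcs.hasFDerivAt.congr_fderiv (ContinuousLinearMap.ext fun v => ?_)
  have h6 : ∀ w, metricForm g p (L (fderiv ℝ c 0 v)) (L w) =
      metricForm g p (L (stdFieldCLM lam v)) (L w) := by
    intro w
    have h7 := congrArg (fun A : Coord k m →L[ℝ] Coord k m →L[ℝ] ℝ => A v w) h5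
    rw [← hL, metricForm_hessianOperator]
    have h8 : (((metricCoord g Φ 0).comp (fderiv ℝ c 0)) v) w =
        metricForm g p (L (fderiv ℝ c 0 v)) (L w) := by
      rw [ContinuousLinearMap.comp_apply, metricCoord_apply, hΦ0, hΦ']
      rfl
    rw [← h8]
    refine h7.trans ?_
    simp [Lc]
  by_contra hne
  have hne' : L (fderiv ℝ c 0 v) - L (stdFieldCLM lam v) ≠ 0 := by
    rw [sub_ne_zero]
    exact fun h => hne (L.injective h)
  refine (g.pos p _ hne').ne' ?_
  change metricForm g p (L (fderiv ℝ c 0 v) - L (stdFieldCLM lam v))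
    (L (fderiv ℝ c 0 v) - L (stdFieldCLM lam v)) = 0
  have h9 : ∀ w, metricForm g p (L (fderiv ℝ c 0 v) - L (stdFieldCLM lam v)) (L w) = 0 := fun w => by
    rw [_root_.map_sub, sub_apply, h6, sub_self]
  have h10 := h9 (fderiv ℝ c 0 v - stdFieldCLM lam v)
  rwa [_root_.map_sub L] at h10

end Diagonalization

/-! ### Coordinates with flat remainder and straight invariant manifolds -/

section FlatCoordinates

theorem isBigO_sq_of_hasFDerivAt {E F : Type*} [NormedAddCommGroup E] [NormedSpace ℝ E]
    [FiniteDimensional ℝ E]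
    [NormedAddCommGroup F] [NormedSpace ℝ F] {V : E → F} {A : E →L[ℝ] F} {O : Set E}
    (hO : O ∈ 𝓝 0) (hV : ContDiffOn ℝ ∞ V O) (h0 : V 0 = 0) (hA : HasFDerivAt V A 0) :
    (fun x => V x - A x) =O[𝓝 0] fun x => ‖x‖ ^ 2 := by
  obtain ⟨W, hW, hWV⟩ := exists_contDiff_eventuallyEq hO hV
  have hWA : HasFDerivAt W A 0 := hA.congr_of_eventuallyEq hWV
  have hW0 : W 0 = 0 := hWV.self_of_nhds.trans h0
  set r : E → F := fun x => W x - A x with hr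
  have hrs : ContDiff ℝ ∞ r := hW.sub A.contDiff
  have hr' : HasFDerivAt r (0 : E →L[ℝ] F) 0 :=
    (hWA.sub A.hasFDerivAt).congr_fderiv (sub_self A)
  have hd : Differentiable ℝ r := hrs.differentiable (by simp)
  have hd2 : DifferentiableAt ℝ (fderiv ℝ r) 0 :=
    (hrs.fderiv_right (m := ∞) le_rfl).differentiable (by simp) 0
  have h1 : fderiv ℝ r =O[𝓝 0] fun x => x := by
    simpa [hr'.fderiv] using hd2.hasFDerivAt.isBigO_sub
  obtain ⟨C, hC0, hC⟩ := h1.exists_nonneg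
  obtain ⟨δ, hδ, hball⟩ := Metric.eventually_nhds_iff.1 hC.bound
  have h2 : r =O[𝓝 0] fun x => ‖x‖ ^ 2 := by
    refine IsBigO.of_bound C ?_
    filter_upwards [Metric.ball_mem_nhds (0 : E) hδ] with x hx
    have h3 := (convex_closedBall (0 : E) ‖x‖).norm_image_sub_le_of_norm_fderiv_le (𝕜 := ℝ) (f := r)
      (C := C * ‖x‖) (x := 0) (y := x) (fun y _ => hd y) (fun y hy => ?_) (by simp) (by simp)
    · have hr0 : r 0 = 0 := by simp [hr, hW0]
      rw [hr0, sub_zero, sub_zero] at h3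
      rw [norm_pow, norm_norm, pow_two, ← mul_assoc]
      exact h3
    · have hyx : ‖y‖ ≤ ‖x‖ := by simpa using hy
      have h4 := hball (y := y) (by
        rw [dist_zero_right]
        exact hyx.trans_lt (by simpa using hx))
      exact h4.trans (mul_le_mul_of_nonneg_left hyx hC0)
  refine h2.congr' ?_ EventuallyEq.rfl
  filter_upwards [hWV] with x hx
  simp [hr, hx]

/-- The multiplicities with which `s` takes its values form the multi-index to which the condition
is applied. -/
theorem NLinearity.sum_ne {n : ℕ} {lam : Fin n → ℝ} (hN : NLinearity lam) {d : ℕ} (hd : 2 ≤ d)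
    (s : Fin d → Fin n) (i : Fin n) : ∑ j, lam (s j) ≠ lam i := by
  have h1 : ∑ l, (Finset.univ.filter fun j => s j = l).card = d := by
    rw [← Finset.card_eq_sum_card_fiberwise (fun _ _ => Finset.mem_coe.2 (Finset.mem_univ _))]
    simp
  have h2 := hN (fun l => (Finset.univ.filter fun j => s j = l).card) (by rw [h1]; exact hd) i
  have h3 : ∑ l, ((Finset.univ.filter fun j => s j = l).card : ℝ) * lam l = ∑ j, lam (s j) := by
    rw [← Finset.sum_fiberwise Finset.univ s fun j => lam (s j)]
    refine Finset.sum_congr rfl fun l _ => ?_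
    rw [Finset.sum_congr rfl fun j hj => by rw [(Finset.mem_filter.1 hj).2], Finset.sum_const,
      nsmul_eq_mul]
  rw [h3] at h2
  exact sub_ne_zero.1 h2

variable {k m : ℕ} {X : Type*} [TopologicalSpace X]
  [ChartedSpace (EuclideanSpace ℝ (Fin (k + m))) X] [IsManifold (𝓡 (k + m)) ∞ X]

/-- The straightening map lives on ℝ^{k+m} and is transported to ℝᵏ × ℝᵐ by `splitEquiv`, where the
sign conditions on `lam` identify its two planes with the coordinate factors. -/
theorem exists_chart_flat_straight (g : SmoothMetric (k + m) X) {f : X → ℝ}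
    (hf : ContMDiff (𝓡 (k + m)) 𝓘(ℝ, ℝ) ∞ f) {p : X} (hp : riemGradient g f p = 0)
    {lam : Fin (k + m) → ℝ} (hlam : IsMorseEigenvalues g f p lam) (hN : NLinearity lam)
    (hpos : ∀ i : Fin k, 0 < lam (Fin.castAdd m i))
    (hneg : ∀ j : Fin m, lam (Fin.natAdd k j) < 0) :
    ∃ Φ : OpenPartialHomeomorph (Coord k m) X, IsSmoothChart Φ ∧ 0 ∈ Φ.source ∧ Φ 0 = p ∧
      IsFlat (fun z => coordField (riemGradient g f) Φ z - stdFieldCLM lam z) ∧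
      ∀ z ∈ Φ.source, z.1 = 0 ∨ z.2 = 0 →
        coordField (riemGradient g f) Φ z = stdFieldCLM lam z := by
  obtain ⟨Φ, hΦ, h0, hΦ0, hc0, hc'⟩ := exists_chart_with_diagonal_linear_part g hf hp hlam
  set c := coordField (riemGradient g f) Φ with hc
  have hcs : ContDiffOn ℝ ∞ c Φ.source := contDiffOn_coordField_riemGradient hΦ g hf
  have hne : ∀ i, lam i ≠ 0 := by
    intro i
    induction i using Fin.addCases with
    | left i => exact (hpos i).ne'
    | right j => exact (hneg j).ne
  let S := splitEquiv k m
  have hSs : ∀ z, S (S.symm z) = z := S.apply_symm_apply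
  set V : (Fin (k + m) → ℝ) → Fin (k + m) → ℝ := fun x => S.symm (c (S x)) with hV
  have hO : S ⁻¹' Φ.source ∈ 𝓝 (0 : Fin (k + m) → ℝ) :=
    (Φ.open_source.preimage S.continuous).mem_nhds (by rwa [mem_preimage, _root_.map_zero])
  have hVs : ContDiffOn ℝ ∞ V (S ⁻¹' Φ.source) :=
    S.symm.contDiff.comp_contDiffOn (hcs.comp S.contDiff.contDiffOn fun x hx => hx)
  have hV0 : V 0 = 0 := by simp only [hV, _root_.map_zero, hc0]
  have hSdiag : ∀ x, S (diagCLM lam x) = stdFieldCLM lam (S x) := splitEquiv_diagCLM lam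
  have hV' : HasFDerivAt V (diagCLM lam) 0 := by
    have h1 : HasFDerivAt c (stdFieldCLM lam) (S 0) := by rwa [_root_.map_zero]
    refine (S.symm.hasFDerivAt.comp 0 (h1.comp 0 S.hasFDerivAt)).congr_fderiv ?_
    refine ContinuousLinearMap.ext fun x => ?_
    change S.symm (stdFieldCLM lam (S x)) = _
    rw [← hSdiag, S.symm_apply_apply]
  obtain ⟨θ, h0θ, hθ0, hθt, hθs, hθs', hθflat, hθstraight⟩ := exists_straightening hne
    (fun d hd s i => hN.sum_ne hd s i) hO hVs (isBigO_sq_of_hasFDerivAt hO hVs hV0 hV')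
  set κ : OpenPartialHomeomorph (Coord k m) (Coord k m) :=
    (S.symm.toHomeomorph.toOpenPartialHomeomorph.trans θ).transHomeomorph S.toHomeomorph with hκ
  have hκsrc : ∀ z, z ∈ κ.source ↔ S.symm z ∈ θ.source := fun z => by
    change z ∈ (S.symm.toHomeomorph.toOpenPartialHomeomorph.trans θ).source ↔ _
    simp
  have hκz : ∀ z, κ z = S (θ (S.symm z)) := fun z => rfl
  have hκs : ContDiffOn ℝ ∞ κ κ.source :=
    S.contDiff.comp_contDiffOn (hθs.comp S.symm.contDiff.contDiffOn fun z hz => (hκsrc z).1 hz)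
  have hκtgt : ∀ y, y ∈ κ.target ↔ S.symm y ∈ θ.target := fun y => by
    change S.symm y ∈ (S.symm.toHomeomorph.toOpenPartialHomeomorph.trans θ).target ↔ _
    simp
  have hκs' : ContDiffOn ℝ ∞ κ.symm κ.target :=
    S.contDiff.comp_contDiffOn (hθs'.comp S.symm.contDiff.contDiffOn fun z hz => (hκtgt z).1 hz)
  have h0κ : (0 : Coord k m) ∈ κ.source := by rw [hκsrc, _root_.map_zero]; exact h0θ
  have hκ0 : κ 0 = 0 := by rw [hκz, _root_.map_zero, hθ0, _root_.map_zero]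
  have hκΦ : ∀ z ∈ κ.source, κ z ∈ Φ.source := fun z hz =>
    hθt (θ.map_source ((hκsrc z).1 hz))
  have hsrc : ∀ z, z ∈ (κ.trans Φ).source ↔ z ∈ κ.source := fun z => by
    rw [OpenPartialHomeomorph.trans_source]
    exact ⟨fun h => h.1, fun h => ⟨h, hκΦ z h⟩⟩
  have hκd : ∀ z ∈ κ.source, DifferentiableAt ℝ κ z := fun z hz =>
    (hκs.contDiffAt (κ.open_source.mem_nhds hz)).differentiableAt (by simp)
  have hκ' : ∀ z ∈ κ.source, ∀ v, fderiv ℝ κ z v = S (fderiv ℝ θ (S.symm z) (S.symm v)) := by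
    intro z hz v
    have h1 : DifferentiableAt ℝ θ (S.symm z) := (hθs.contDiffAt
      (θ.open_source.mem_nhds ((hκsrc z).1 hz))).differentiableAt (by simp)
    have h2 := S.hasFDerivAt.comp z (h1.hasFDerivAt.comp z S.symm.hasFDerivAt)
    have h3 : HasFDerivAt κ _ z := h2
    rw [h3.fderiv]
    rfl
  have hinv : ∀ z ∈ κ.source, ∀ v, fderiv ℝ κ.symm (κ z) (fderiv ℝ κ z v) = v := by
    intro z hz v
    have h1 : DifferentiableAt ℝ κ.symm (κ z) := (hκs'.contDiffAt
      (κ.open_target.mem_nhds (κ.map_source hz))).differentiableAt (by simp)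
    have h2 := h1.hasFDerivAt.comp z (hκd z hz).hasFDerivAt
    have h3 : HasFDerivAt (κ.symm ∘ κ) (ContinuousLinearMap.id ℝ (Coord k m)) z :=
      (hasFDerivAt_id z).congr_of_eventuallyEq (by
        filter_upwards [κ.open_source.mem_nhds hz] with y hy
        exact κ.left_inv hy)
    exact congrArg (fun L : Coord k m →L[ℝ] Coord k m => L v) (h2.unique h3)
  have hΦ₁ := hΦ.trans hκs hκs'
  set c₁ := coordField (riemGradient g f) (κ.trans Φ) with hc₁
  -- The straightening defect is expressed at the image point; the inverse derivative of κ carries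
  -- it back to the new coordinates, preserving flatness and zeros.
  have hdefect : ∀ z ∈ κ.source, c₁ z - stdFieldCLM lam z = fderiv ℝ κ.symm (κ z)
      (S (V (θ (S.symm z)) - fderiv ℝ θ (S.symm z) (diagCLM lam (S.symm z)))) := by
    intro z hz
    have h1 := hΦ.fderiv_coordField_trans hκs hκs' (riemGradient g f) ((hsrc z).2 hz)
    rw [← hc, ← hc₁] at h1
    have h2 : S.symm (stdFieldCLM lam z) = diagCLM lam (S.symm z) := by
      rw [ContinuousLinearEquiv.symm_apply_eq, hSdiag, hSs]
    rw [← hinv z hz (c₁ z - stdFieldCLM lam z), _root_.map_sub (fderiv ℝ κ z), h1,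
      hκ' z hz (stdFieldCLM lam z), h2, _root_.map_sub S]
    simp only [hV, hSs]
    rfl
  refine ⟨κ.trans Φ, hΦ₁, (hsrc 0).2 h0κ, ?_, ?_, ?_⟩
  · change Φ (κ 0) = p
    rw [hκ0, hΦ0]
  · have h1 : IsFlat fun z => S (V (θ (S.symm z)) -
        fderiv ℝ θ (S.symm z) (diagCLM lam (S.symm z))) :=
      (hθflat.comp_of_differentiableAt (g := S.symm) S.symm.differentiableAt
        (_root_.map_zero _)).clm_apply (A := fun _ => (S : (Fin (k + m) → ℝ) →L[ℝ] Coord k m))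
          continuousAt_const
    have h2 : ContinuousAt (fun z => fderiv ℝ κ.symm (κ z)) 0 := by
      have h3 := (hκs'.fderiv_of_isOpen κ.open_target (m := ∞) le_rfl).continuousOn.continuousAt
        (κ.open_target.mem_nhds (κ.map_source h0κ))
      exact h3.comp (κ.continuousAt h0κ)
    refine (h1.clm_apply h2).congr ?_
    filter_upwards [κ.open_source.mem_nhds h0κ] with z hz
    exact (hdefect z hz).symm
  · intro z hz hplane
    have hzκ := (hsrc z).1 hz
    have h1 : V (θ (S.symm z)) = fderiv ℝ θ (S.symm z) (diagCLM lam (S.symm z)) := by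
      refine hθstraight _ ((hκsrc z).1 hzκ) ?_
      have hz1 : ∀ i, S.symm z (Fin.castAdd m i) = z.1 i := fun i => by
        conv_rhs => rw [← hSs z]
        rfl
      have hz2 : ∀ j, S.symm z (Fin.natAdd k j) = z.2 j := fun j => by
        conv_rhs => rw [← hSs z]
        rfl
      rcases hplane with h | h
      · right
        intro i hi
        induction i using Fin.addCases with
        | left i => rw [hz1, h]; rfl
        | right j => exact absurd hi (hneg j).not_gt
      · left
        intro i hi
        induction i using Fin.addCases with
        | left i => exact absurd hi (hpos i).not_gt
        | right j => rw [hz2, h]; rfl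
    have h2 := hdefect z hzκ
    rw [h1, sub_self, _root_.map_zero, _root_.map_zero] at h2
    exact sub_eq_zero.1 h2

end FlatCoordinates

/-! ### Gradient lines converging to the critical point stay in the coordinates -/

section Trapping

theorem monotoneOn_of_forall_hasDerivWithinAt {D : Set ℝ} (hD : Convex ℝ D) {h h' : ℝ → ℝ}
    (hd : ∀ t ∈ D, HasDerivWithinAt h (h' t) D t) (hn : ∀ t ∈ D, 0 ≤ h' t) : MonotoneOn h D := by
  have hint : ∀ t ∈ interior D, HasDerivAt h (h' t) t := fun t ht =>
    (hd t (interior_subset ht)).hasDerivAt (mem_interior_iff_mem_nhds.1 ht)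
  refine monotoneOn_of_deriv_nonneg hD (fun t ht => (hd t ht).continuousWithinAt)
    (fun t ht => (hint t ht).differentiableAt.differentiableWithinAt) fun t ht => ?_
  rw [(hint t ht).deriv]
  exact hn t (interior_subset ht)

/-- An expanding curve which tends to `0` vanishes. -/
theorem eq_zero_of_inner_deriv_nonneg {E : Type*} [NormedAddCommGroup E] [InnerProductSpace ℝ E]
    {x x' : ℝ → E} (hx : ∀ t ∈ Ici (0 : ℝ), HasDerivWithinAt x (x' t) (Ici 0) t)
    (h : ∀ t ∈ Ici (0 : ℝ), 0 ≤ inner ℝ (x t) (x' t)) (hlim : Tendsto x atTop (𝓝 0)) :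
    x 0 = 0 := by
  have hmono : MonotoneOn (fun t => ‖x t‖ ^ 2) (Ici 0) :=
    monotoneOn_of_forall_hasDerivWithinAt (convex_Ici 0) (fun t ht => (hx t ht).norm_sq)
      fun t ht => mul_nonneg zero_le_two (h t ht)
  have h1 : Tendsto (fun t => ‖x t‖ ^ 2) atTop (𝓝 0) := by
    simpa using hlim.norm.pow 2
  have h2 : ‖x 0‖ ^ 2 ≤ 0 := ge_of_tendsto h1 (by
    filter_upwards [eventually_ge_atTop 0] with t ht
    exact hmono self_mem_Ici ht ht)
  simpa using le_antisymm h2 (by positivity)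

theorem mul_norm_sq_le_inner_euclDiag {ι : Type} [Fintype ι] {mu : ι → ℝ} {a : ℝ}
    (h : ∀ i, a ≤ mu i) (x : EuclideanSpace ℝ ι) : a * ‖x‖ ^ 2 ≤ inner ℝ x (euclDiag mu x) := by
  rw [EuclideanSpace.norm_sq_eq, PiLp.inner_apply, Finset.mul_sum]
  refine Finset.sum_le_sum fun i _ => ?_
  rw [euclDiag_apply]
  have h1 : inner ℝ (x i) (mu i * x i) = mu i * ‖x i‖ ^ 2 := by
    rw [Real.norm_eq_abs, sq_abs]
    simp only [RCLike.inner_apply, conj_trivial]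
    ring
  rw [h1]
  exact mul_le_mul_of_nonneg_right (h i) (by positivity)

theorem exists_pos_forall_le {ι : Type} [Finite ι] {a : ι → ℝ} (ha : ∀ i, 0 < a i) :
    ∃ c > 0, ∀ i, c ≤ a i := by
  have h : ∀ᶠ c in 𝓝[>] (0 : ℝ), ∀ i, c ≤ a i := by
    rw [eventually_all]
    exact fun i => (eventually_le_nhds (ha i)).filter_mono nhdsWithin_le_nhds
  obtain ⟨c, hc, hc0⟩ := (h.and self_mem_nhdsWithin).exists
  exact ⟨c, hc0, hc⟩

variable {k m : ℕ}

/-- The square of the Euclidean norm. -/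
noncomputable def coordSq (z : Coord k m) : ℝ := ‖z.1‖ ^ 2 + ‖z.2‖ ^ 2

theorem continuous_coordSq : Continuous (coordSq : Coord k m → ℝ) := by
  unfold coordSq
  fun_prop

theorem exists_coordSq_subset {s : Set (Coord k m)} (hs : s ∈ 𝓝 0) :
    ∃ R > 0, {z : Coord k m | coordSq z ≤ R} ⊆ s := by
  obtain ⟨r, hr, hball⟩ := Metric.mem_nhds_iff.1 hs
  refine ⟨(r / 2) ^ 2, by positivity, fun z hz => hball ?_⟩
  have hz : ‖z.1‖ ^ 2 + ‖z.2‖ ^ 2 ≤ (r / 2) ^ 2 := hz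
  have h1 : ‖z.1‖ ≤ r / 2 := abs_le_of_sq_le_sq' (by nlinarith [sq_nonneg ‖z.2‖]) (by positivity) |>.2
  have h2 : ‖z.2‖ ≤ r / 2 := abs_le_of_sq_le_sq' (by nlinarith [sq_nonneg ‖z.1‖]) (by positivity) |>.2
  rw [mem_ball_zero_iff]
  exact (norm_prod_le_iff.2 ⟨h1, h2⟩).trans_lt (by linarith)

theorem isCompact_coordSq_le (R : ℝ) : IsCompact {z : Coord k m | coordSq z ≤ R} := by
  refine Metric.isCompact_of_isClosed_isBounded
    (isClosed_le continuous_coordSq continuous_const) ?_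
  refine (Metric.isBounded_closedBall (x := (0 : Coord k m)) (r := R + 1)).subset fun z hz => ?_
  have hz : ‖z.1‖ ^ 2 + ‖z.2‖ ^ 2 ≤ R := hz
  rw [mem_closedBall_zero_iff]
  refine norm_prod_le_iff.2 ⟨?_, ?_⟩
  · nlinarith [sq_nonneg ‖z.2‖, sq_nonneg (‖z.1‖ - 1)]
  · nlinarith [sq_nonneg ‖z.1‖, sq_nonneg (‖z.2‖ - 1)]

/-- The difference c - Λ has a small Lipschitz constant near 0 and vanishes on both planes.
Comparing z with its projection to either plane bounds the error by a small multiple of |z.1|,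
respectively |z.2|, so the linear expansion and contraction rates survive with half their strength.
-/
theorem exists_hyperbolic_estimate {lam : Fin (k + m) → ℝ}
    (hpos : ∀ i : Fin k, 0 < lam (Fin.castAdd m i))
    (hneg : ∀ j : Fin m, lam (Fin.natAdd k j) < 0) {c : Coord k m → Coord k m}
    (hc : HasStrictFDerivAt c (stdFieldCLM lam) 0) {O : Set (Coord k m)} (hO : O ∈ 𝓝 0)
    (hplane : ∀ z ∈ O, z.1 = 0 ∨ z.2 = 0 → c z = stdFieldCLM lam z) :
    ∃ μ > 0, ∀ᶠ z in 𝓝 (0 : Coord k m), μ * ‖z.1‖ ^ 2 ≤ inner ℝ z.1 (c z).1 ∧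
      μ * ‖z.2‖ ^ 2 ≤ -inner ℝ z.2 (c z).2 := by
  obtain ⟨a, ha, hap⟩ := exists_pos_forall_le hpos
  obtain ⟨b, hb, hbn⟩ := exists_pos_forall_le (a := fun j : Fin m => -lam (Fin.natAdd k j))
    fun j => neg_pos.2 (hneg j)
  set ν := min a b with hν
  have hν0 : 0 < ν := lt_min ha hb
  obtain ⟨O', hO', hOO'⟩ := hc.approximates_deriv_on_nhds (c := ⟨ν / 2, (half_pos hν0).le⟩)
    (Or.inr (half_pos hν0))
  obtain ⟨r, hr, hball⟩ := Metric.mem_nhds_iff.1 (inter_mem hO hO')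
  have hdiff : ∀ z z' : Coord k m, ‖z‖ < r → ‖z'‖ < r → z'.1 = 0 ∨ z'.2 = 0 →
      ‖c z - stdFieldCLM lam z‖ ≤ ν / 2 * ‖z - z'‖ := by
    intro z z' hz hz' hpl
    have h1 : ‖c z - c z' - stdFieldCLM lam (z - z')‖ ≤ ν / 2 * ‖z - z'‖ :=
      hOO' z (hball (mem_ball_zero_iff.2 hz)).2 z' (hball (mem_ball_zero_iff.2 hz')).2
    have h2 : c z - c z' - stdFieldCLM lam (z - z') = c z - stdFieldCLM lam z := by
      rw [hplane z' (hball (mem_ball_zero_iff.2 hz')).1 hpl, (stdFieldCLM lam).map_sub]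
      abel
    exact (congrArg norm h2).symm.trans_le h1
  refine ⟨ν / 2, half_pos hν0, ?_⟩
  filter_upwards [Metric.ball_mem_nhds (0 : Coord k m) hr] with z hz
  rw [mem_ball_zero_iff] at hz
  have hz1 : ‖z.1‖ < r := (norm_fst_le z).trans_lt hz
  have hz2 : ‖z.2‖ < r := (norm_snd_le z).trans_lt hz
  have e1 : ‖(c z).1 - (stdFieldCLM lam z).1‖ ≤ ν / 2 * ‖z.1‖ := by
    have h1 := hdiff z (0, z.2) hz (by simpa [Prod.norm_def] using hz2) (Or.inl rfl)
    have h2 : ‖z - (0, z.2)‖ = ‖z.1‖ := by simp [Prod.norm_def]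
    rw [h2] at h1
    exact (norm_fst_le (c z - stdFieldCLM lam z)).trans h1
  have e2 : ‖(c z).2 - (stdFieldCLM lam z).2‖ ≤ ν / 2 * ‖z.2‖ := by
    have h1 := hdiff z (z.1, 0) hz (by simpa [Prod.norm_def] using hz1) (Or.inr rfl)
    have h2 : ‖z - (z.1, 0)‖ = ‖z.2‖ := by simp [Prod.norm_def]
    rw [h2] at h1
    exact (norm_snd_le (c z - stdFieldCLM lam z)).trans h1
  constructor
  · have h1 : ν * ‖z.1‖ ^ 2 ≤ inner ℝ z.1 (stdFieldCLM lam z).1 :=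
      mul_norm_sq_le_inner_euclDiag (fun i => (min_le_left a b).trans (hap i)) z.1
    have h2 := abs_real_inner_le_norm z.1 ((c z).1 - (stdFieldCLM lam z).1)
    have h3 := mul_le_mul_of_nonneg_left e1 (norm_nonneg z.1)
    have h4 := neg_abs_le (inner ℝ z.1 ((c z).1 - (stdFieldCLM lam z).1))
    rw [inner_sub_right] at h2 h4
    nlinarith
  · have h1 : ν * ‖z.2‖ ^ 2 ≤ -inner ℝ z.2 (stdFieldCLM lam z).2 := by
      have h5 := mul_norm_sq_le_inner_euclDiag (mu := fun j : Fin m => -lam (Fin.natAdd k j))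
        (fun j => (min_le_right a b).trans (hbn j)) z.2
      rw [← inner_neg_right]
      refine h5.trans_eq ?_
      congr 1
      ext j
      simp [stdFieldCLM]
    have h2 := abs_real_inner_le_norm z.2 ((c z).2 - (stdFieldCLM lam z).2)
    have h3 := mul_le_mul_of_nonneg_left e2 (norm_nonneg z.2)
    have h4 := le_abs_self (inner ℝ z.2 ((c z).2 - (stdFieldCLM lam z).2))
    rw [inner_sub_right] at h2 h4
    nlinarith

theorem exists_coercive_near {E : Type*} [NormedAddCommGroup E] [NormedSpace ℝ E]
    [FiniteDimensional ℝ E] {G : E → E →L[ℝ] E →L[ℝ] ℝ} (hG : ContinuousAt G 0)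
    (hpos : ∀ v, v ≠ 0 → 0 < G 0 v v) :
    ∃ a > 0, ∀ᶠ z in 𝓝 (0 : E), ∀ v, a * ‖v‖ ^ 2 ≤ G z v v := by
  obtain ⟨b, hb, hbG⟩ : ∃ b > 0, ∀ v, b * ‖v‖ ^ 2 ≤ G 0 v v := by
    rcases subsingleton_or_nontrivial E with hE | hE
    · exact ⟨1, one_pos, fun v => by simp [Subsingleton.elim v 0]⟩
    · have : ProperSpace E := FiniteDimensional.proper_real E
      have hcont : Continuous fun v => G 0 v v := by fun_prop
      obtain ⟨v₀, hv₀, hmin⟩ := (isCompact_sphere (0 : E) 1).exists_isMinOn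
        (NormedSpace.sphere_nonempty.2 zero_le_one) hcont.continuousOn
      have hv₀0 : v₀ ≠ 0 := by
        rintro rfl
        simp at hv₀
      refine ⟨G 0 v₀ v₀, hpos v₀ hv₀0, fun v => ?_⟩
      by_cases hv : v = 0
      · simp [hv]
      · have hn : 0 < ‖v‖ := norm_pos_iff.2 hv
        have h1 : G 0 v₀ v₀ ≤ G 0 (‖v‖⁻¹ • v) (‖v‖⁻¹ • v) := hmin (by
          rw [mem_sphere_zero_iff_norm, norm_smul, norm_inv, norm_norm, inv_mul_cancel₀ hn.ne'])
        simp only [_root_.map_smul, smul_apply, smul_eq_mul] at h1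
        calc G 0 v₀ v₀ * ‖v‖ ^ 2 ≤ ‖v‖⁻¹ * (‖v‖⁻¹ * G 0 v v) * ‖v‖ ^ 2 := by gcongr
          _ = G 0 v v := by field_simp
  refine ⟨b / 2, half_pos hb, ?_⟩
  filter_upwards [hG.eventually_mem (Metric.ball_mem_nhds (G 0) (half_pos hb))] with z hz v
  replace hz : ‖G z - G 0‖ < b / 2 :=
    lt_of_eq_of_lt (dist_eq_norm (G z) (G 0)).symm (Metric.mem_ball.1 hz)
  have h1 : |(G z - G 0) v v| ≤ b / 2 * ‖v‖ ^ 2 := by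
    have h2 := (G z - G 0).le_opNorm₂ v v
    rw [Real.norm_eq_abs] at h2
    refine h2.trans ?_
    rw [mul_assoc, ← pow_two]
    gcongr
  have h3 := neg_abs_le ((G z - G 0) v v)
  rw [sub_apply, sub_apply] at h1 h3
  linarith [hbG v]

variable {X : Type*} [TopologicalSpace X]
  [ChartedSpace (EuclideanSpace ℝ (Fin (k + m))) X]

/-! ### Time reversal. -/

theorem coordField_neg (V : (x : X) → TangentSpace (𝓡 (k + m)) x)
    (Φ : OpenPartialHomeomorph (Coord k m) X) (z : Coord k m) :
    coordField (fun x => -V x) Φ z = -coordField V Φ z :=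
  VectorField.mpullback_neg_apply

theorem IsMIntegralCurveOn.reverse {V : (x : X) → TangentSpace (𝓡 (k + m)) x} {γ : ℝ → X}
    (hγ : IsMIntegralCurveOn γ V (Iic 0)) :
    IsMIntegralCurveOn (fun t => γ (-t)) (fun x => -V x) (Ici 0) := by
  have h1 := hγ.comp_mul (-1)
  have h2 : {t : ℝ | t * -1 ∈ Iic (0 : ℝ)} = Ici 0 := by ext; simp
  have h3 : ((-1 : ℝ) • V) = fun x => -V x := by funext x; exact neg_one_smul ℝ (V x)
  rw [h2, h3] at h1
  simpa [Function.comp_def] using h1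

theorem IsMIntegralCurveOn.unreverse {V : (x : X) → TangentSpace (𝓡 (k + m)) x} {γ : ℝ → X}
    (hγ : IsMIntegralCurveOn γ (fun x => -V x) (Ici 0)) :
    IsMIntegralCurveOn (fun t => γ (-t)) V (Iic 0) := by
  have h1 := hγ.comp_mul (-1)
  have h2 : {t : ℝ | t * -1 ∈ Ici (0 : ℝ)} = Iic 0 := by ext; simp
  have h3 : ((-1 : ℝ) • fun x => -V x) = V := by
    funext x
    exact (neg_one_smul ℝ (-V x)).trans (neg_neg _)
  rw [h2, h3] at h1
  simpa [Function.comp_def] using h1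

theorem mem_unstableManifold_iff {V : (x : X) → TangentSpace (𝓡 (k + m)) x} {p q : X} :
    q ∈ unstableManifold V p ↔ q ∈ stableManifold (fun x => -V x) p := by
  constructor
  · rintro ⟨γ, hγ, hγ0, hlim⟩
    exact ⟨fun t => γ (-t), hγ.reverse, by simpa using hγ0, hlim.comp tendsto_neg_atTop_atBot⟩
  · rintro ⟨γ, hγ, hγ0, hlim⟩
    exact ⟨fun t => γ (-t), hγ.unreverse, by simpa using hγ0, hlim.comp tendsto_neg_atBot_atTop⟩

variable [IsManifold (𝓡 (k + m)) ∞ X]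

theorem riemGradient_neg (g : SmoothMetric (k + m) X) (f : X → ℝ) :
    riemGradient g (fun x => -f x) = fun x => -riemGradient g f x := by
  funext x
  have h1 : (mfderiv (𝓡 (k + m)) 𝓘(ℝ, ℝ) (fun x => -f x) x :
      EuclideanSpace ℝ (Fin (k + m)) →L[ℝ] ℝ).toLinearMap =
      -(mfderiv (𝓡 (k + m)) 𝓘(ℝ, ℝ) f x : EuclideanSpace ℝ (Fin (k + m)) →L[ℝ] ℝ).toLinearMap :=
    congrArg ContinuousLinearMap.toLinearMap (mfderiv_neg (I := 𝓡 (k + m)) (f := f) (x := x))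
  exact (congrArg (raiseIndex g x) h1).trans (_root_.map_neg (raiseIndex g x) _)

/-! ### Energy along gradient lines. -/

theorem hasDerivWithinAt_comp_gradient_line (g : SmoothMetric (k + m) X) {f : X → ℝ}
    (hf : ContMDiff (𝓡 (k + m)) 𝓘(ℝ, ℝ) ∞ f) {β : ℝ → X} {s : Set ℝ}
    (hβ : IsMIntegralCurveOn β (riemGradient g f) s) {t : ℝ} (ht : t ∈ s) :
    HasDerivWithinAt (fun t => f (β t))
      (metricForm g (β t) (riemGradient g f (β t)) (riemGradient g f (β t))) s t := by
  obtain ⟨L, hL, hL1⟩ : ∃ L : ℝ →L[ℝ] ℝ, HasFDerivWithinAt (fun t => f (β t)) L s t ∧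
      L 1 = mfderiv (𝓡 (k + m)) 𝓘(ℝ, ℝ) f (β t) ((1 : ℝ) • riemGradient g f (β t)) :=
    ⟨_, ((hf.mdifferentiable (by simp) (β t)).hasMFDerivAt.comp_hasMFDerivWithinAt t
      (hβ t ht)).hasFDerivWithinAt, rfl⟩
  refine hL.hasDerivWithinAt.congr_deriv ?_
  rw [hL1, one_smul]
  exact (inner_riemGradient g f (β t) _).symm

theorem metricForm_self_nonneg (g : SmoothMetric (k + m) X) (x : X)
    (v : EuclideanSpace ℝ (Fin (k + m))) : 0 ≤ metricForm g x v v := by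
  by_cases hv : v = 0
  · simp [hv]
  · exact (g.pos x v hv).le

/-- The hypothesis makes C f - |z|² nondecreasing along the line inside the ball, and f increases
towards f(p). Hence |z(t)|² ≤ |z(0)|² + C (f(p) - f(z(0))) < R, so there is no first exit time. -/
theorem gradient_line_stays [T2Space X] {Φ : OpenPartialHomeomorph (Coord k m) X}
    (hΦ : IsSmoothChart Φ) (g : SmoothMetric (k + m) X) {f : X → ℝ}
    (hf : ContMDiff (𝓡 (k + m)) 𝓘(ℝ, ℝ) ∞ f) {p : X} {R C : ℝ} (hC : 0 ≤ C)
    (hR : ∀ z : Coord k m, coordSq z ≤ R → z ∈ Φ.source ∧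
      2 * |inner ℝ z.1 (coordField (riemGradient g f) Φ z).1 +
        inner ℝ z.2 (coordField (riemGradient g f) Φ z).2| ≤
      C * metricCoord g Φ z (coordField (riemGradient g f) Φ z)
        (coordField (riemGradient g f) Φ z))
    {β : ℝ → X} (hβ : IsMIntegralCurveOn β (riemGradient g f) (Ici 0))
    (hlim : Tendsto β atTop (𝓝 p)) {z : Coord k m} (hz : β 0 = Φ z)
    (hzR : coordSq z + C * |f p - f (Φ z)| < R) :
    ∀ t, 0 ≤ t → β t ∈ Φ.target ∧ coordSq (Φ.symm (β t)) < R := by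
  set c := coordField (riemGradient g f) Φ with hc
  have hfβ := fun t (ht : t ∈ Ici (0 : ℝ)) => hasDerivWithinAt_comp_gradient_line g hf hβ ht
  have hmono : MonotoneOn (fun t => f (β t)) (Ici 0) :=
    monotoneOn_of_forall_hasDerivWithinAt (convex_Ici 0) hfβ
      fun t _ => metricForm_self_nonneg g _ _
  have hflim : Tendsto (fun t => f (β t)) atTop (𝓝 (f p)) :=
    (hf.continuous.tendsto p).comp hlim
  have hfle : ∀ t ∈ Ici (0 : ℝ), f (β t) ≤ f p := fun t ht => ge_of_tendsto hflim (by
    filter_upwards [eventually_ge_atTop t] with s hs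
    exact hmono ht (mem_Ici.2 (le_trans (mem_Ici.1 ht) hs)) hs)
  have hβc : ContinuousOn β (Ici 0) := fun t ht => (hβ t ht).1
  have hsub : {z : Coord k m | coordSq z ≤ R} ⊆ Φ.source := fun z hz => (hR z hz).1
  have hzlt : coordSq z < R := by
    have := mul_nonneg hC (abs_nonneg (f p - f (Φ z)))
    linarith
  have hzsrc : z ∈ Φ.source := hsub hzlt.le
  set U : Set X := Φ '' {z : Coord k m | coordSq z < R} with hU
  have hUo : IsOpen U := Φ.isOpen_image_of_subset_source
    (isOpen_lt continuous_coordSq continuous_const) fun z hz =>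
      hsub (show coordSq z ≤ R from le_of_lt hz)
  -- The compact image of the closed ball is closed because X is Hausdorff; without this the line
  -- could leave the chart without crossing its sphere.
  set K : Set X := Φ '' {z : Coord k m | coordSq z ≤ R} with hK
  have hKc : IsClosed K :=
    ((isCompact_coordSq_le R).image_of_continuousOn (Φ.continuousOn.mono hsub)).isClosed
  have hest : ∀ b, 0 ≤ b → (∀ t ∈ Icc 0 b, β t ∈ K) → β b ∈ U := by
    intro b hb hin
    have hsymm : ∀ t ∈ Icc 0 b, β t ∈ Φ.target ∧ coordSq (Φ.symm (β t)) ≤ R := by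
      intro t ht
      obtain ⟨y, hy, hyt⟩ := hin t ht
      have hys := hsub hy
      rw [← hyt]
      exact ⟨Φ.map_source hys, by rw [Φ.left_inv hys]; exact hy⟩
    set u : ℝ → Coord k m := fun t => Φ.symm (β t) with hu
    have hsol : IsSolutionIn c Φ.source u (Icc 0 b) :=
      hΦ.isSolutionIn_of_isMIntegralCurveOn
        (fun t ht => (hβ t ht.1).mono Icc_subset_Ici_self) fun t ht => (hsymm t ht).1
    have hd : ∀ t ∈ Icc 0 b, HasDerivWithinAt (fun t => C * f (β t) - coordSq (u t))
        (C * metricForm g (β t) (riemGradient g f (β t)) (riemGradient g f (β t)) -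
          (2 * inner ℝ (u t).1 (c (u t)).1 + 2 * inner ℝ (u t).2 (c (u t)).2)) (Icc 0 b) t := by
      intro t ht
      have h1 := (hsol t ht).1
      have h2 : HasDerivWithinAt (fun t => (u t).1) (c (u t)).1 (Icc 0 b) t :=
        (ContinuousLinearMap.fst ℝ (EuclideanSpace ℝ (Fin k))
          (EuclideanSpace ℝ (Fin m))).hasFDerivAt.comp_hasDerivWithinAt t h1
      have h3 : HasDerivWithinAt (fun t => (u t).2) (c (u t)).2 (Icc 0 b) t :=
        (ContinuousLinearMap.snd ℝ (EuclideanSpace ℝ (Fin k))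
          (EuclideanSpace ℝ (Fin m))).hasFDerivAt.comp_hasDerivWithinAt t h1
      exact (((hfβ t ht.1).mono Icc_subset_Ici_self).const_mul C).sub
        (h2.norm_sq.add h3.norm_sq)
    have hm := monotoneOn_of_forall_hasDerivWithinAt (convex_Icc 0 b) hd fun t ht => by
      have h1 := (hR _ (hsymm t ht).2).2
      have h2 : metricCoord g Φ (u t) (c (u t)) (c (u t)) =
          metricForm g (β t) (riemGradient g f (β t)) (riemGradient g f (β t)) := by
        rw [metricCoord_apply, hc, hΦ.chartDeriv_coordField _ (hsol t ht).2, hu,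
          Φ.right_inv (hsymm t ht).1]
      rw [h2] at h1
      have h3 := le_abs_self (inner ℝ (u t).1 (c (u t)).1 + inner ℝ (u t).2 (c (u t)).2)
      linarith
    have h4 := hm (left_mem_Icc.2 hb) (right_mem_Icc.2 hb) hb
    have hu0 : u 0 = z := by simp only [hu, hz, Φ.left_inv hzsrc]
    simp only [hu0, hz] at h4
    have h5 := mul_le_mul_of_nonneg_left (hfle b hb) hC
    have h6 := mul_le_mul_of_nonneg_left (le_abs_self (f p - f (Φ z))) hC
    have h7 : coordSq (u b) < R := by
      rw [mul_sub] at h6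
      linarith
    exact ⟨u b, h7, Φ.right_inv (hsymm b (right_mem_Icc.2 hb)).1⟩
  have hall : ∀ t, 0 ≤ t → β t ∈ U := by
    intro T hT
    by_contra hTU
    -- At the first exit time b the curve is still in the closed set `K`, so the energy estimate
    -- applies on [0, b] and puts it back in `U`.
    set B := Icc 0 T ∩ β ⁻¹' Uᶜ with hB
    have hBc : IsCompact B := isCompact_Icc.of_isClosed_subset
      ((hβc.mono Icc_subset_Ici_self).preimage_isClosed_of_isClosed isClosed_Icc
        hUo.isClosed_compl) inter_subset_left
    obtain ⟨b, ⟨hbI, hbB⟩, hbmin⟩ := hBc.exists_isLeast ⟨T, right_mem_Icc.2 hT, hTU⟩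
    have hlt : ∀ t ∈ Ico 0 b, β t ∈ U := by
      intro t ht
      by_contra h1
      exact absurd (hbmin ⟨⟨ht.1, ht.2.le.trans hbI.2⟩, h1⟩) (not_le.2 ht.2)
    have hb0 : 0 < b := by
      refine lt_of_le_of_ne hbI.1 fun h => hbB ?_
      rw [← h]
      exact ⟨z, hzlt, hz.symm⟩
    have hUK : U ⊆ K := image_mono fun z hz => show coordSq z ≤ R from le_of_lt hz
    refine hbB (hest b hb0.le fun t ht => ?_)
    rcases ht.2.eq_or_lt with rfl | htb
    · have h1 : Tendsto β (𝓝[Ico 0 t] t) (𝓝 (β t)) :=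
        (hβc t hb0.le).mono_left (nhdsWithin_mono t fun s hs => hs.1)
      have h2 : (𝓝[Ico 0 t] t).NeBot := by
        rw [← mem_closure_iff_nhdsWithin_neBot, closure_Ico hb0.ne]
        exact right_mem_Icc.2 hb0.le
      exact hKc.mem_of_tendsto h1 (by
        filter_upwards [self_mem_nhdsWithin] with s hs
        exact hUK (hlt s hs))
    · exact hUK (hlt t ⟨ht.1, htb⟩)
  intro t ht
  obtain ⟨y, hy, hyt⟩ := hall t ht
  have hys : y ∈ Φ.source := hsub (show coordSq y ≤ R from le_of_lt hy)
  rw [← hyt]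
  exact ⟨Φ.map_source hys, by rw [Φ.left_inv hys]; exact hy⟩

end Trapping

/-! ### Existence of adapted coordinates -/

section Existence

theorem IsFlat.hasStrictFDerivAt {E F : Type*} [NormedAddCommGroup E] [NormedSpace ℝ E]
    [NormedAddCommGroup F] [NormedSpace ℝ F] {c : E → F} {A : E →L[ℝ] F}
    (hc : ContDiffAt ℝ ∞ c 0) (h : IsFlat fun z => c z - A z) : HasStrictFDerivAt c A 0 := by
  refine hc.hasStrictFDerivAt' ?_ (by simp)
  have h1 : HasFDerivAt (fun z => c z - A z) (0 : E →L[ℝ] F) 0 :=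
    IsBigO.hasFDerivAt (n := 2) (by simpa using h 2) one_lt_two
  refine ((h1.add A.hasFDerivAt).congr_fderiv (zero_add A)).congr_of_eventuallyEq
    (Eventually.of_forall fun z => ?_)
  exact (sub_add_cancel (c z) (A z)).symm

variable {k m : ℕ} {X : Type*} [TopologicalSpace X]
  [ChartedSpace (EuclideanSpace ℝ (Fin (k + m))) X]

theorem IsSmoothChart.mem_stableManifold {Φ : OpenPartialHomeomorph (Coord k m) X}
    (hΦ : IsSmoothChart Φ) {V : (x : X) → TangentSpace (𝓡 (k + m)) x} {p : X}
    (h0 : 0 ∈ Φ.source) (hp : Φ 0 = p) {u : ℝ → Coord k m}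
    (hu : IsSolutionIn (coordField V Φ) Φ.source u (Ici 0)) (hlim : Tendsto u atTop (𝓝 0)) :
    Φ (u 0) ∈ stableManifold V p :=
  ⟨fun t => Φ (u t), hΦ.isMIntegralCurveOn_of_isSolutionIn hu, rfl,
    hp ▸ (Φ.continuousAt h0).tendsto.comp hlim⟩

variable [IsManifold (𝓡 (k + m)) ∞ X]

/-- The chart with straight planes is restricted to starting points to which the trapping estimate
applies. Points of the planes are joined to p by explicit linear solutions; conversely a trapped
line tending to p in forward time has vanishing expanding component. -/
theorem exists_isAdaptedChart [T2Space X] (g : SmoothMetric (k + m) X) {f : X → ℝ}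
    (hf : ContMDiff (𝓡 (k + m)) 𝓘(ℝ, ℝ) ∞ f) {p : X} (hp : riemGradient g f p = 0)
    {lam : Fin (k + m) → ℝ} (hlam : IsMorseEigenvalues g f p lam) (hN : NLinearity lam)
    (hpos : ∀ i : Fin k, 0 < lam (Fin.castAdd m i))
    (hneg : ∀ j : Fin m, lam (Fin.natAdd k j) < 0) :
    ∃ Φ : OpenPartialHomeomorph (Coord k m) X, IsAdaptedChart (riemGradient g f) p lam Φ := by
  obtain ⟨Φ, hΦ, h0, hΦ0, hflat, hplane⟩ := exists_chart_flat_straight g hf hp hlam hN hpos hneg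
  set c := coordField (riemGradient g f) Φ with hc
  have hnhds := Φ.open_source.mem_nhds h0
  have hcs : ContDiffAt ℝ ∞ c 0 := (contDiffOn_coordField_riemGradient hΦ g hf).contDiffAt hnhds
  obtain ⟨μ, hμ, hhyp⟩ := exists_hyperbolic_estimate hpos hneg (IsFlat.hasStrictFDerivAt hcs hflat)
    hnhds hplane
  obtain ⟨a, ha, hcoer⟩ := exists_coercive_near
    ((contDiffOn_metricCoord hΦ g).continuousOn.continuousAt hnhds)
    fun v hv => metricCoord_pos hΦ g h0 hv
  obtain ⟨R, hR0, hR⟩ := exists_coordSq_subset ((hhyp.and hcoer).and hnhds)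
  -- Each of the two inner products is at most |c|²/μ because μ |z.i| ≤ |c|, and a |c|² ≤ G(c, c);
  -- the factor 4 collects the two terms and the factor 2.
  set C := 4 / (μ * a) with hC
  have hC0 : 0 ≤ C := by positivity
  have hRsrc : ∀ z : Coord k m, coordSq z ≤ R → z ∈ Φ.source := fun z hz => (hR hz).2
  have hRhyp : ∀ z : Coord k m, coordSq z ≤ R → μ * ‖z.1‖ ^ 2 ≤ inner ℝ z.1 (c z).1 ∧
      μ * ‖z.2‖ ^ 2 ≤ -inner ℝ z.2 (c z).2 := fun z hz => (hR hz).1.1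
  have hbound : ∀ z : Coord k m, coordSq z ≤ R →
      2 * |inner ℝ z.1 (c z).1 + inner ℝ z.2 (c z).2| ≤ C * metricCoord g Φ z (c z) (c z) := by
    intro z hz
    obtain ⟨h1, h2⟩ := hRhyp z hz
    have h3 := (hR hz).1.2 (c z)
    have e1 : |inner ℝ z.1 (c z).1| ≤ ‖c z‖ ^ 2 / μ := by
      have h4 := abs_real_inner_le_norm z.1 (c z).1
      have h5 : ‖(c z).1‖ ≤ ‖c z‖ := norm_fst_le _
      have h6 : μ * ‖z.1‖ ≤ ‖c z‖ := by
        rcases (norm_nonneg z.1).eq_or_lt with h | h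
        · rw [← h]; simp
        · refine le_of_mul_le_mul_right ?_ h
          have := le_abs_self (inner ℝ z.1 (c z).1)
          nlinarith
      rw [le_div_iff₀ hμ]
      nlinarith [norm_nonneg z.1, norm_nonneg (c z).1]
    have e2 : |inner ℝ z.2 (c z).2| ≤ ‖c z‖ ^ 2 / μ := by
      have h4 := abs_real_inner_le_norm z.2 (c z).2
      have h5 : ‖(c z).2‖ ≤ ‖c z‖ := norm_snd_le _
      have h6 : μ * ‖z.2‖ ≤ ‖c z‖ := by
        rcases (norm_nonneg z.2).eq_or_lt with h | h
        · rw [← h]; simp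
        · refine le_of_mul_le_mul_right ?_ h
          have := neg_le_abs (inner ℝ z.2 (c z).2)
          nlinarith
      rw [le_div_iff₀ hμ]
      nlinarith [norm_nonneg z.2, norm_nonneg (c z).2]
    calc 2 * |inner ℝ z.1 (c z).1 + inner ℝ z.2 (c z).2|
        ≤ 2 * (‖c z‖ ^ 2 / μ + ‖c z‖ ^ 2 / μ) := by
          gcongr
          exact (abs_add_le _ _).trans (add_le_add e1 e2)
      _ = C * (a * ‖c z‖ ^ 2) := by rw [hC]; field_simp; ring
      _ ≤ C * metricCoord g Φ z (c z) (c z) := mul_le_mul_of_nonneg_left h3 hC0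
  have hfΦ : ContinuousOn (fun z : Coord k m => coordSq z + C * |f p - f (Φ z)|) Φ.source :=
    continuous_coordSq.continuousOn.add (continuousOn_const.mul
      (continuousOn_const.sub (hΦ.contDiffOn_comp hf).continuousOn).abs)
  -- The starting points whose energy budget keeps them in the ball; an open neighbourhood of 0 that
  -- serves for both f and -f.
  set D := Φ.source ∩ (fun z : Coord k m => coordSq z + C * |f p - f (Φ z)|) ⁻¹' Iio R with hD
  have hDo : IsOpen D := hfΦ.isOpen_inter_preimage Φ.open_source isOpen_Iio
  have h0D : (0 : Coord k m) ∈ D := ⟨h0, by simp [coordSq, hΦ0, hR0]⟩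
  have hDR : ∀ z ∈ D, coordSq z < R := fun z hz => by
    have h1 : coordSq z + C * |f p - f (Φ z)| < R := hz.2
    have := mul_nonneg hC0 (abs_nonneg (f p - f (Φ z)))
    linarith
  have hsymm0 : Φ.symm p = 0 := by rw [← hΦ0, Φ.left_inv h0]
  have hpt : p ∈ Φ.target := hΦ0 ▸ Φ.map_source h0
  have hlim0 : ∀ {β : ℝ → X}, Tendsto β atTop (𝓝 p) →
      Tendsto (fun t => Φ.symm (β t)) atTop (𝓝 0) := fun hβ => by
    have h1 := (Φ.continuousAt_symm hpt).tendsto.comp hβ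
    rwa [hsymm0] at h1
  have hcneg : ∀ z, coordField (riemGradient g fun x => -f x) Φ z = -c z := fun z => by
    rw [riemGradient_neg, coordField_neg]
  have hstable : ∀ z ∈ D, Φ z ∈ stableManifold (riemGradient g f) p → z.1 = 0 := by
    rintro z hz ⟨β, hβ, hβ0, hlim⟩
    have hstay := gradient_line_stays hΦ g hf hC0 (fun z hz => ⟨hRsrc z hz, hbound z hz⟩) hβ hlim
      hβ0 hz.2
    have hsol := hΦ.isSolutionIn_of_isMIntegralCurveOn hβ fun t ht => (hstay t ht).1
    have h1 := eq_zero_of_inner_deriv_nonneg (x := fun t => (Φ.symm (β t)).1)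
      (x' := fun t => (c (Φ.symm (β t))).1)
      (fun t ht => (ContinuousLinearMap.fst ℝ (EuclideanSpace ℝ (Fin k))
        (EuclideanSpace ℝ (Fin m))).hasFDerivAt.comp_hasDerivWithinAt t (hsol t ht).1)
      (fun t ht => le_trans (by positivity) (hRhyp _ (hstay t ht).2.le).1)
      ((continuous_fst.tendsto _).comp (hlim0 hlim))
    simpa only [hβ0, Φ.left_inv hz.1] using h1
  -- The stable case for the gradient of -f, whose expanding directions are the z.2 coordinates.
  have hunstable : ∀ z ∈ D, Φ z ∈ stableManifold (fun x => -riemGradient g f x) p → z.2 = 0 := by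
    rintro z hz ⟨β, hβ, hβ0, hlim⟩
    rw [← riemGradient_neg] at hβ
    have hstay := gradient_line_stays hΦ g hf.neg hC0 (fun z hz => ⟨hRsrc z hz, by
      rw [hcneg, Prod.fst_neg, Prod.snd_neg, inner_neg_right, inner_neg_right, ← neg_add, abs_neg,
        _root_.map_neg, _root_.map_neg, neg_apply, neg_neg]
      exact hbound z hz⟩) hβ hlim
      hβ0 (by rw [neg_sub_neg, abs_sub_comm]; exact hz.2)
    have hsol := hΦ.isSolutionIn_of_isMIntegralCurveOn hβ fun t ht => (hstay t ht).1
    have h1 := eq_zero_of_inner_deriv_nonneg (x := fun t => (Φ.symm (β t)).2)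
      (x' := fun t => -(c (Φ.symm (β t))).2)
      (fun t ht => by
        have h2 := (ContinuousLinearMap.snd ℝ (EuclideanSpace ℝ (Fin k))
          (EuclideanSpace ℝ (Fin m))).hasFDerivAt.comp_hasDerivWithinAt t (hsol t ht).1
        rw [hcneg] at h2
        exact h2)
      (fun t ht => by
        rw [inner_neg_right]
        exact le_trans (by positivity) (hRhyp _ (hstay t ht).2.le).2)
      ((continuous_snd.tendsto _).comp (hlim0 hlim))
    simpa only [hβ0, Φ.left_inv hz.1] using h1
  refine ⟨Φ.restrOpen D hDo, ⟨h0, h0D⟩, hΦ0, (hΦ.restrOpen hDo).smooth,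
    (hΦ.restrOpen hDo).smooth_symm, hflat, ?_, ?_⟩
  · intro z hz
    rw [mem_unstableManifold_iff]
    refine ⟨hunstable z hz.2, fun hz2 => ?_⟩
    have hneg' : ∀ i : Fin k, -lam (Fin.castAdd m i) < 0 := fun i => neg_neg_of_pos (hpos i)
    set mu : Fin k → ℝ := fun i => -lam (Fin.castAdd m i) with hmu
    have hz' : (euclExp mu 0 z.1, (0 : EuclideanSpace ℝ (Fin m))) = z := by
      rw [euclExp_zero, ← hz2]
    -- On the plane the field is exactly linear, and the contracting flow does not leave the ball.
    have hsol : IsSolutionIn (coordField (fun x => -riemGradient g f x) Φ) Φ.source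
        (fun t => (euclExp mu t z.1, 0)) (Ici 0) := by
      intro t ht
      have h1 : coordSq ((euclExp mu t z.1, 0) : Coord k m) ≤ R := by
        refine le_trans ?_ (hDR z hz.2).le
        have h2 := norm_euclExp_le (fun i => (hneg' i).le) ht z.1
        simp only [coordSq, norm_zero]
        gcongr
        exact norm_nonneg _
      refine ⟨?_, hRsrc _ h1⟩
      rw [coordField_neg, ← hc, hplane _ (hRsrc _ h1) (Or.inr rfl)]
      refine ((hasDerivAt_euclExp mu t z.1).hasDerivWithinAt.prodMk
        (hasDerivWithinAt_const t _ 0)).congr_deriv ?_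
      ext i <;> simp [stdFieldCLM, hmu]
    have hlim : Tendsto (fun t => ((euclExp mu t z.1, 0) : Coord k m)) atTop (𝓝 0) :=
      (tendsto_euclExp_atTop hneg' z.1).prodMk_nhds tendsto_const_nhds
    have h3 := hΦ.mem_stableManifold h0 hΦ0 hsol hlim
    rwa [hz'] at h3
  · intro z hz
    refine ⟨hstable z hz.2, fun hz1 => ?_⟩
    set mu : Fin m → ℝ := fun j => lam (Fin.natAdd k j) with hmu
    have hz' : ((0 : EuclideanSpace ℝ (Fin k)), euclExp mu 0 z.2) = z := by
      rw [euclExp_zero, ← hz1]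
    have hsol : IsSolutionIn (coordField (riemGradient g f) Φ) Φ.source
        (fun t => (0, euclExp mu t z.2)) (Ici 0) := by
      intro t ht
      have h1 : coordSq ((0, euclExp mu t z.2) : Coord k m) ≤ R := by
        refine le_trans ?_ (hDR z hz.2).le
        have h2 := norm_euclExp_le (fun j => (hneg j).le) ht z.2
        simp only [coordSq, norm_zero]
        gcongr
        exact norm_nonneg _
      refine ⟨?_, hRsrc _ h1⟩
      rw [← hc, hplane _ (hRsrc _ h1) (Or.inl rfl)]
      refine ((hasDerivWithinAt_const t _ 0).prodMk
        (hasDerivAt_euclExp mu t z.2).hasDerivWithinAt).congr_deriv ?_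
      ext i <;> simp [stdFieldCLM, hmu]
    have hlim : Tendsto (fun t => ((0, euclExp mu t z.2) : Coord k m)) atTop (𝓝 0) :=
      tendsto_const_nhds.prodMk_nhds (tendsto_euclExp_atTop hneg z.2)
    have h3 := hΦ.mem_stableManifold h0 hΦ0 hsol hlim
    rwa [hz'] at h3

end Existence

/-! ### The conjugating map on an invariant coordinate plane -/

section InvariantPlane

variable {k m : ℕ} {X : Type*} [TopologicalSpace X]
  [ChartedSpace (EuclideanSpace ℝ (Fin (k + m))) X]

theorem stableManifold_of_line {V : (x : X) → TangentSpace (𝓡 (k + m)) x} {p : X} {γ : ℝ → X}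
    (hγ : IsMIntegralCurveOn γ V (Ici 0)) (hlim : Tendsto γ atTop (𝓝 p)) {t : ℝ} (ht : 0 ≤ t) :
    γ t ∈ stableManifold V p := by
  refine ⟨γ ∘ (· + t), (hγ.comp_add t).mono fun s hs => ?_, by simp,
    hlim.comp (tendsto_atTop_add_const_right atTop t tendsto_id)⟩
  exact add_nonneg (mem_Ici.1 hs) ht

/-- The points of a coordinate plane, embedded by `i`, whose forward flow line stays in the
coordinates and converges to `p`. -/
def localStablePlane {E : Type} [NormedAddCommGroup E] [NormedSpace ℝ E]
    (V : (x : X) → TangentSpace (𝓡 (k + m)) x) (p : X)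
    (Φ : OpenPartialHomeomorph (Coord k m) X) (i : E →L[ℝ] Coord k m) : Set E :=
  {y | i y ∈ Φ.source ∧ ∃ γ, IsStableLine V p Φ (i y) γ}

variable {E : Type} [NormedAddCommGroup E] [NormedSpace ℝ E]
  {V : (x : X) → TangentSpace (𝓡 (k + m)) x} {p : X}
  {Φ : OpenPartialHomeomorph (Coord k m) X} {i : E →L[ℝ] Coord k m} {π : Coord k m →L[ℝ] E}

theorem IsStableLine.symm_mem_plane
    (hplane : ∀ z ∈ Φ.source, Φ z ∈ stableManifold V p ↔ i (π z) = z) {z : Coord k m} {γ : ℝ → X}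
    (hγ : IsStableLine V p Φ z γ) {t : ℝ} (ht : 0 ≤ t) :
    i (π (Φ.symm (γ t))) = Φ.symm (γ t) := by
  refine (hplane _ (Φ.map_target (hγ.mem t ht))).1 ?_
  rw [Φ.right_inv (hγ.mem t ht)]
  exact stableManifold_of_line hγ.curve hγ.lim ht

/-- The vector field is tangent to the stable plane. -/
theorem IsSmoothChart.coordField_mem_plane (hΦ : IsSmoothChart Φ) (hπ : ∀ y, π (i y) = y)
    (hplane : ∀ z ∈ Φ.source, Φ z ∈ stableManifold V p ↔ i (π z) = z) {y : E}
    (hy : i y ∈ Φ.source) : i (π (coordField V Φ (i y))) = coordField V Φ (i y) := by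
  obtain ⟨γ, hγ, hγ0, hlim⟩ := (hplane _ hy).2 (by rw [hπ])
  have htgt : Φ (i y) ∈ Φ.target := Φ.map_source hy
  have hev : ∀ᶠ t in 𝓝[≥] (0 : ℝ), γ t ∈ Φ.target := by
    have h1 : Tendsto γ (𝓝[≥] 0) (𝓝 (γ 0)) := (hγ 0 self_mem_Ici).1
    rw [hγ0] at h1
    exact h1.eventually (Φ.open_target.mem_nhds htgt)
  obtain ⟨δ, hδ, hball⟩ := mem_nhdsGE_iff_exists_Icc_subset.1 hev
  have hδ : 0 < δ := hδ
  have hsol := hΦ.isSolutionIn_of_isMIntegralCurveOn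
    (hγ.mono (Icc_subset_Ici_self : Icc 0 δ ⊆ Ici 0)) fun t ht => hball ht
  have h0 : (0 : ℝ) ∈ Icc 0 δ := left_mem_Icc.2 hδ.le
  have hu0 : Φ.symm (γ 0) = i y := by rw [hγ0, Φ.left_inv hy]
  have h1 := (hsol 0 h0).1
  beta_reduce at h1
  rw [hu0] at h1
  -- The whole forward line consists of stable points, so for small times its coordinates are fixed
  -- by the projection i ∘ π, and so is their derivative.
  have h2 : HasDerivWithinAt (fun t => Φ.symm (γ t)) (i (π (coordField V Φ (i y)))) (Icc 0 δ) 0 := by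
    refine ((i.comp π).hasFDerivAt.comp_hasDerivWithinAt 0 h1).congr (fun t ht => ?_) ?_
    · refine ((hplane _ (Φ.map_target (hball ht))).1 ?_).symm
      rw [Φ.right_inv (hball ht)]
      exact stableManifold_of_line hγ hlim ht.1
    · simp [hu0, hπ]
  exact (uniqueDiffOn_Icc hδ 0 h0).eq_deriv _ h2 h1

theorem IsSmoothChart.isSolutionIn_plane (hΦ : IsSmoothChart Φ)
    (hplane : ∀ z ∈ Φ.source, Φ z ∈ stableManifold V p ↔ i (π z) = z) {z : Coord k m} {γ : ℝ → X}
    (hγ : IsStableLine V p Φ z γ) :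
    IsSolutionIn (fun y => π (coordField V Φ (i y))) (i ⁻¹' Φ.source)
      (fun t => π (Φ.symm (γ t))) (Ici 0) := by
  have hsol := hΦ.isSolutionIn_of_isMIntegralCurveOn hγ.curve hγ.mem
  intro t ht
  obtain ⟨h1, h2⟩ := hsol t ht
  have h3 := hγ.symm_mem_plane hplane ht
  refine ⟨?_, by rw [mem_preimage, h3]; exact h2⟩
  have h4 := π.hasFDerivAt.comp_hasDerivWithinAt t h1
  beta_reduce
  rw [h3]
  exact h4

theorem IsStableLine.tendsto_plane (h0 : 0 ∈ Φ.source) (hp : Φ 0 = p) {z : Coord k m}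
    {γ : ℝ → X} (hγ : IsStableLine V p Φ z γ) :
    Tendsto (fun t => π (Φ.symm (γ t))) atTop (𝓝 0) := by
  have hpt : p ∈ Φ.target := hp ▸ Φ.map_source h0
  have h1 := (Φ.continuousAt_symm hpt).tendsto.comp hγ.lim
  rw [show Φ.symm p = 0 by rw [← hp, Φ.left_inv h0]] at h1
  have h2 := (π.continuous.tendsto 0).comp h1
  rwa [_root_.map_zero] at h2

/-- Tangency of the field to the plane identifies flow lines in the chart converging to p with
solutions of the restricted equation on the plane converging to 0, so that `exists_conjugation`
becomes applicable. -/
theorem IsSmoothChart.localStablePlane_eq_basin (hΦ : IsSmoothChart Φ) (h0 : 0 ∈ Φ.source)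
    (hp : Φ 0 = p) (hπ : ∀ y, π (i y) = y)
    (hplane : ∀ z ∈ Φ.source, Φ z ∈ stableManifold V p ↔ i (π z) = z) :
    localStablePlane V p Φ i = basin (fun y => π (coordField V Φ (i y))) (i ⁻¹' Φ.source) := by
  ext y
  constructor
  · rintro ⟨hy, γ, hγ⟩
    refine ⟨_, ?_, hΦ.isSolutionIn_plane hplane hγ, hγ.tendsto_plane h0 hp⟩
    simp only [hγ.start, Φ.left_inv hy, hπ]
  · rintro ⟨u, hu0, hu, hlim⟩
    have hsol : IsSolutionIn (coordField V Φ) Φ.source (fun t => i (u t)) (Ici 0) := by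
      intro t ht
      obtain ⟨h1, h2⟩ := hu t ht
      refine ⟨?_, h2⟩
      rw [← hΦ.coordField_mem_plane hπ hplane h2]
      exact i.hasFDerivAt.comp_hasDerivWithinAt t h1
    have hlim' : Tendsto (fun t => Φ (i (u t))) atTop (𝓝 p) := by
      have h1 : Tendsto (fun t => i (u t)) atTop (𝓝 0) := by
        have := (i.continuous.tendsto 0).comp hlim
        rwa [_root_.map_zero] at this
      exact hp ▸ (Φ.continuousAt h0).tendsto.comp h1
    exact ⟨hu0 ▸ (hu 0 self_mem_Ici).2, fun t => Φ (i (u t)),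
      hΦ.isMIntegralCurveOn_of_isSolutionIn hsol, by rw [hu0],
      fun t ht => Φ.map_source (hu t ht).2, hlim'⟩

/-- Along the stable plane, the rescaled flow converges to a local diffeomorphism which linearizes
the vector field. -/
theorem IsSmoothChart.exists_conjugate_plane {ι : Type} [Fintype ι] {mu : ι → ℝ}
    (hmu : ∀ j, mu j < 0) {i : EuclideanSpace ℝ ι →L[ℝ] Coord k m}
    {π : Coord k m →L[ℝ] EuclideanSpace ℝ ι} (hΦ : IsSmoothChart Φ) (h0 : 0 ∈ Φ.source)
    (hp : Φ 0 = p) (hπ : ∀ y, π (i y) = y)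
    (hplane : ∀ z ∈ Φ.source, Φ z ∈ stableManifold V p ↔ i (π z) = z)
    (hV : ContDiffOn ℝ ∞ (coordField V Φ) Φ.source) {B : Coord k m →L[ℝ] Coord k m}
    (hB : ∀ y, π (B (i y)) = euclDiag mu y) (hflat : IsFlat fun z => coordField V Φ z - B z) :
    0 ∈ localStablePlane V p Φ i ∧ ∃ Ψ : EuclideanSpace ℝ ι → EuclideanSpace ℝ ι, Ψ 0 = 0 ∧
      (∀ y ∈ localStablePlane V p Φ i,
        ∃ g : OpenPartialHomeomorph (EuclideanSpace ℝ ι) (EuclideanSpace ℝ ι),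
        y ∈ g.source ∧ g.source ⊆ localStablePlane V p Φ i ∧ EqOn Ψ g g.source ∧
        ContDiffOn ℝ ∞ g g.source ∧ ContDiffOn ℝ ∞ g.symm g.target) ∧
      (∀ y ∈ localStablePlane V p Φ i,
        fderiv ℝ Ψ y (π (coordField V Φ (i y))) = euclDiag mu (Ψ y)) ∧
      ∀ y ∈ localStablePlane V p Φ i, ∀ γ, IsStableLine V p Φ (i y) γ →
        Tendsto (fun t => euclExp mu (-t) (π (Φ.symm (γ t)))) atTop (𝓝 (Ψ y)) := by
  have hw : ContDiffOn ℝ ∞ (fun y => π (coordField V Φ (i y))) (i ⁻¹' Φ.source) :=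
    π.contDiff.comp_contDiffOn (hV.comp i.contDiff.contDiffOn fun y hy => hy)
  have hwflat : IsFlat fun y => π (coordField V Φ (i y)) - euclDiag mu y := by
    have h1 : IsFlat fun y => π (coordField V Φ (i y) - B (i y)) :=
      (hflat.comp_of_differentiableAt i.differentiableAt (_root_.map_zero i)).clm_apply
        (A := fun _ => π) continuousAt_const
    refine h1.congr (Eventually.of_forall fun y => ?_)
    beta_reduce
    rw [_root_.map_sub, hB]
  rw [hΦ.localStablePlane_eq_basin h0 hp hπ hplane]
  obtain ⟨hb, Ψ, hΨ0, hΨg, hΨd, hΨlim⟩ := exists_conjugation hmu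
    (Φ.open_source.preimage i.continuous) (by rw [mem_preimage, _root_.map_zero]; exact h0) hw hwflat
  refine ⟨hb, Ψ, hΨ0, hΨg, hΨd, fun y hy γ hγ => ?_⟩
  have h1 := hΨlim _ (hΦ.isSolutionIn_plane hplane hγ) (hγ.tendsto_plane h0 hp)
  have hysrc : i y ∈ Φ.source := by
    obtain ⟨u, rfl, hu, -⟩ := hy
    exact (hu 0 self_mem_Ici).2
  rwa [hγ.start, Φ.left_inv hysrc, hπ] at h1

theorem isUnstableLine_iff {z : Coord k m} {γ : ℝ → X} :
    IsUnstableLine V p Φ z γ ↔ IsStableLine (fun x => -V x) p Φ z fun t => γ (-t) := by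
  constructor
  · rintro ⟨h1, h2, h3, h4⟩
    exact ⟨h1.reverse, by simpa using h2, fun t ht => h3 _ (neg_nonpos.2 ht),
      h4.comp tendsto_neg_atTop_atBot⟩
  · rintro ⟨h1, h2, h3, h4⟩
    refine ⟨?_, by simpa using h2, fun t ht => ?_, ?_⟩
    · simpa using h1.unreverse
    · simpa using h3 (-t) (neg_nonneg.2 ht)
    · simpa [Function.comp_def] using h4.comp tendsto_neg_atBot_atTop

theorem localUnstable_eq_localStablePlane :
    localUnstable V p Φ = localStablePlane (fun x => -V x) p Φ
      (ContinuousLinearMap.inl ℝ (EuclideanSpace ℝ (Fin k)) (EuclideanSpace ℝ (Fin m))) := by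
  ext x
  refine and_congr_right fun _ => ⟨fun ⟨γ, hγ⟩ => ⟨_, isUnstableLine_iff.1 hγ⟩,
    fun ⟨γ, hγ⟩ => ⟨fun t => γ (-t), isUnstableLine_iff.2 ?_⟩⟩
  simp only [neg_neg]
  exact hγ

end InvariantPlane

/-! ### The coordinates induced by the conjugating maps -/

section InducedCoordinates

theorem isLocalDiffeomorphOn_of_forall_exists {E : Type*} [NormedAddCommGroup E] [NormedSpace ℝ E]
    {Ψ : E → E} {W : Set E} (h : ∀ x ∈ W, ∃ g : OpenPartialHomeomorph E E, x ∈ g.source ∧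
      g.source ⊆ W ∧ EqOn Ψ g g.source ∧ ContDiffOn ℝ ∞ g g.source ∧
      ContDiffOn ℝ ∞ g.symm g.target) : IsLocalDiffeomorphOn 𝓘(ℝ, E) 𝓘(ℝ, E) ∞ Ψ W := by
  rintro ⟨x, hx⟩
  obtain ⟨g, hxg, -, hgΨ, hgs, hgs'⟩ := h x hx
  exact ⟨{ toPartialEquiv := g.toPartialEquiv
           open_source := g.open_source
           open_target := g.open_target
           contMDiffOn_toFun := hgs.contMDiffOn
           contMDiffOn_invFun := hgs'.contMDiffOn }, hxg, hgΨ⟩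

theorem isOpen_of_forall_exists_chart {E : Type*} [TopologicalSpace E] {W : Set E}
    {P : OpenPartialHomeomorph E E → Prop}
    (h : ∀ x ∈ W, ∃ g : OpenPartialHomeomorph E E, x ∈ g.source ∧ g.source ⊆ W ∧ P g) :
    IsOpen W := by
  refine isOpen_iff_mem_nhds.2 fun x hx => ?_
  obtain ⟨g, hxg, hgW, -⟩ := h x hx
  exact mem_of_superset (g.open_source.mem_nhds hxg) hgW

variable {k m : ℕ} {X : Type*} [TopologicalSpace X]
  [ChartedSpace (EuclideanSpace ℝ (Fin (k + m))) X] [IsManifold (𝓡 (k + m)) ∞ X]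

/-- The product map P = gu × gs linearizes each restriction of the field to a plane, and Θ = Φ ∘
P⁻¹. It preserves the two planes, so membership in the invariant manifolds is inherited. -/
theorem exists_induced_coordinates {V : (x : X) → TangentSpace (𝓡 (k + m)) x} {p : X}
    {lam : Fin (k + m) → ℝ} {Φ : OpenPartialHomeomorph (Coord k m) X}
    (hΦ : IsAdaptedChart V p lam Φ)
    {gu : OpenPartialHomeomorph (EuclideanSpace ℝ (Fin k)) (EuclideanSpace ℝ (Fin k))}
    (h0u : 0 ∈ gu.source) (hgu0 : gu 0 = 0) (hgu : ContDiffOn ℝ ∞ gu gu.source)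
    (hgu' : ContDiffOn ℝ ∞ gu.symm gu.target)
    (hguV : ∀ x ∈ gu.source, (coordField V Φ (x, 0)).2 = 0 ∧
      fderiv ℝ gu x (coordField V Φ (x, 0)).1 = stdUnstable lam (gu x))
    {gs : OpenPartialHomeomorph (EuclideanSpace ℝ (Fin m)) (EuclideanSpace ℝ (Fin m))}
    (h0s : 0 ∈ gs.source) (hgs0 : gs 0 = 0) (hgs : ContDiffOn ℝ ∞ gs gs.source)
    (hgs' : ContDiffOn ℝ ∞ gs.symm gs.target)
    (hgsV : ∀ y ∈ gs.source, (coordField V Φ (0, y)).1 = 0 ∧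
      fderiv ℝ gs y (coordField V Φ (0, y)).2 = stdStable lam (gs y)) :
    ∃ (A : Set (EuclideanSpace ℝ (Fin k))) (B : Set (EuclideanSpace ℝ (Fin m)))
      (Θ : OpenPartialHomeomorph (Coord k m) X),
      IsOpen A ∧ 0 ∈ A ∧ A ⊆ gu.source ∧ IsOpen B ∧ 0 ∈ B ∧ B ⊆ gs.source ∧
      A ×ˢ B ⊆ Φ.source ∧ Θ.source = (gu '' A) ×ˢ (gs '' B) ∧
      (∀ x ∈ A, ∀ y ∈ B, Θ (gu x, gs y) = Φ (x, y)) ∧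
      IsAdaptedChart V p lam Θ ∧
      (∀ x, (x, 0) ∈ Θ.source → coordField V Θ (x, 0) = stdField lam (x, 0)) ∧
      (∀ y, (0, y) ∈ Θ.source → coordField V Θ (0, y) = stdField lam (0, y)) := by
  have hΦs := hΦ.isSmoothChart
  set v := coordField V Φ with hv
  obtain ⟨A', hA', B', hB', hAB'⟩ := mem_nhds_prod_iff.1
    (show Φ.source ∈ 𝓝 ((0 : EuclideanSpace ℝ (Fin k)), (0 : EuclideanSpace ℝ (Fin m))) from
      Φ.open_source.mem_nhds hΦ.zero_mem)
  set A := gu.source ∩ interior A' with hA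
  set B := gs.source ∩ interior B' with hB
  have hAo : IsOpen A := gu.open_source.inter isOpen_interior
  have hBo : IsOpen B := gs.open_source.inter isOpen_interior
  have h0A : 0 ∈ A := ⟨h0u, mem_interior_iff_mem_nhds.2 hA'⟩
  have h0B : 0 ∈ B := ⟨h0s, mem_interior_iff_mem_nhds.2 hB'⟩
  have hAB : A ×ˢ B ⊆ Φ.source := fun z hz =>
    hAB' ⟨interior_subset hz.1.2, interior_subset hz.2.2⟩
  set P : OpenPartialHomeomorph (Coord k m) (Coord k m) :=
    (gu.restrOpen A hAo).prod (gs.restrOpen B hBo) with hP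
  have hPsrc : P.source = A ×ˢ B := by
    change (gu.source ∩ A) ×ˢ (gs.source ∩ B) = A ×ˢ B
    rw [inter_eq_right.2 inter_subset_left, inter_eq_right.2 inter_subset_left]
  have hPtgt : P.target = (gu '' A) ×ˢ (gs '' B) := by
    have h1 : (gu.restrOpen A hAo).target = gu '' A := by
      rw [← (gu.restrOpen A hAo).image_source_eq_target, OpenPartialHomeomorph.restrOpen_source,
        inter_eq_right.2 inter_subset_left]
      rfl
    have h2 : (gs.restrOpen B hBo).target = gs '' B := by
      rw [← (gs.restrOpen B hBo).image_source_eq_target, OpenPartialHomeomorph.restrOpen_source,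
        inter_eq_right.2 inter_subset_left]
      rfl
    rw [← h1, ← h2]
    rfl
  have hPz : ∀ z, P z = (gu z.1, gs z.2) := fun z => rfl
  have hPs : ContDiffOn ℝ ∞ P P.source := by
    rw [hPsrc]
    exact (hgu.comp contDiff_fst.contDiffOn fun z hz => hz.1.1).prodMk
      (hgs.comp contDiff_snd.contDiffOn fun z hz => hz.2.1)
  have hPs' : ContDiffOn ℝ ∞ P.symm P.target :=
    (hgu'.comp contDiff_fst.contDiffOn fun z hz => hz.1.1).prodMk
      (hgs'.comp contDiff_snd.contDiffOn fun z hz => hz.2.1)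
  have h0P : (0 : Coord k m) ∈ P.source := by rw [hPsrc]; exact ⟨h0A, h0B⟩
  have hP0 : P 0 = 0 := Prod.ext hgu0 hgs0
  have h0Pt : (0 : Coord k m) ∈ P.target := hP0 ▸ P.map_source h0P
  have hPsymm0 : P.symm 0 = 0 := by
    have := P.left_inv h0P
    rwa [hP0] at this
  have hΘsrc : (P.symm.trans Φ).source = P.target := by
    rw [OpenPartialHomeomorph.trans_source]
    refine inter_eq_left.2 fun z hz => hAB ?_
    rw [← hPsrc]
    exact P.map_target hz
  have hsymmsrc : ∀ z ∈ P.target, P.symm z ∈ Φ.source := fun z hz =>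
    hAB (by rw [← hPsrc]; exact P.map_target hz)
  have hΘs : IsSmoothChart (P.symm.trans Φ) := hΦs.trans hPs' (by simpa using hPs)
  have hPd : ∀ z ∈ P.source, ∀ w, fderiv ℝ P z w = (fderiv ℝ gu z.1 w.1, fderiv ℝ gs z.2 w.2) := by
    intro z hz w
    rw [hPsrc] at hz
    have h1 : DifferentiableAt ℝ gu z.1 :=
      (hgu.contDiffAt (gu.open_source.mem_nhds hz.1.1)).differentiableAt (by simp)
    have h2 : DifferentiableAt ℝ gs z.2 :=
      (hgs.contDiffAt (gs.open_source.mem_nhds hz.2.1)).differentiableAt (by simp)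
    have h3 : HasFDerivAt P ((fderiv ℝ gu z.1).prodMap (fderiv ℝ gs z.2)) z :=
      HasFDerivAt.prodMap z h1.hasFDerivAt h2.hasFDerivAt
    rw [h3.fderiv]
    rfl
  -- The deviation of the field from the product of its restrictions. The linear part is itself such
  -- a product, so `r` is flat; by tangency `r` vanishes on each plane.
  set r : Coord k m → Coord k m := fun z => v z - ((v (z.1, 0)).1, (v (0, z.2)).2) with hr
  set c := coordField V (P.symm.trans Φ) with hc
  have hdefect : ∀ z ∈ P.target, c z - stdFieldCLM lam z =
      fderiv ℝ P (P.symm z) (r (P.symm z)) := by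
    intro z hz
    have hy := P.map_target hz
    have hy' := hy
    rw [hPsrc] at hy'
    have h1 := hΦs.fderiv_coordField_trans hPs' (by simpa using hPs) V
      (show z ∈ (P.symm.trans Φ).source by rw [hΘsrc]; exact hz)
    have hd1 : DifferentiableAt ℝ P (P.symm z) :=
      (hPs.contDiffAt (P.open_source.mem_nhds hy)).differentiableAt (by simp)
    have hd2 : DifferentiableAt ℝ P.symm z :=
      (hPs'.contDiffAt (P.open_target.mem_nhds hz)).differentiableAt (by simp)
    have h2 : HasFDerivAt (P ∘ P.symm) (ContinuousLinearMap.id ℝ (Coord k m)) z :=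
      (hasFDerivAt_id z).congr_of_eventuallyEq (by
        filter_upwards [P.open_target.mem_nhds hz] with y hy
        exact P.right_inv hy)
    have h3 : fderiv ℝ P (P.symm z) (fderiv ℝ P.symm z (c z)) = c z :=
      congrArg (fun L : Coord k m →L[ℝ] Coord k m => L (c z))
        ((hd1.hasFDerivAt.comp z hd2.hasFDerivAt).unique h2)
    -- The derivative of P maps the product of the restrictions exactly to V₀, so only `r`
    -- contributes to the defect.
    have h4 : fderiv ℝ P (P.symm z) ((v ((P.symm z).1, 0)).1, (v (0, (P.symm z).2)).2) =
        stdFieldCLM lam z := by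
      rw [hPd _ hy, (hguV _ hy'.1.1).2, (hgsV _ hy'.2.1).2]
      conv_rhs => rw [← P.right_inv hz]
      rfl
    rw [hr, _root_.map_sub, h4, ← h3, h1]
  have hrflat : IsFlat r := by
    have hflat : IsFlat fun z => v z - stdFieldCLM lam z := hΦ.flat
    let iu : Coord k m →L[ℝ] Coord k m := (ContinuousLinearMap.inl ℝ (EuclideanSpace ℝ (Fin k))
      (EuclideanSpace ℝ (Fin m))).comp (ContinuousLinearMap.fst ℝ _ _)
    let is : Coord k m →L[ℝ] Coord k m := (ContinuousLinearMap.inr ℝ (EuclideanSpace ℝ (Fin k))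
      (EuclideanSpace ℝ (Fin m))).comp (ContinuousLinearMap.snd ℝ _ _)
    have h1 := (hflat.comp_of_differentiableAt iu.differentiableAt (_root_.map_zero iu)).clm_apply
      (A := fun _ => iu) continuousAt_const
    have h2 := (hflat.comp_of_differentiableAt is.differentiableAt (_root_.map_zero is)).clm_apply
      (A := fun _ => is) continuousAt_const
    refine ((hflat.sub h1).sub h2).congr (Eventually.of_forall fun z => ?_)
    ext j
    · simp [hr, iu, is, stdFieldCLM]
    · simp [hr, iu, is, stdFieldCLM]
  have hv0 : v 0 = 0 := Prod.ext (hgsV 0 h0s).1 (hguV 0 h0u).1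
  have hcplane : ∀ z ∈ P.target, (P.symm z).1 = 0 ∨ (P.symm z).2 = 0 → c z = stdField lam z := by
    intro z hz hpl
    have hy := P.map_target hz
    rw [hPsrc] at hy
    have h1 : r (P.symm z) = 0 := by
      set y := P.symm z with hydef
      rcases hpl with h | h
      · have h2 : y = (0, y.2) := Prod.ext h rfl
        have h3 := (hgsV _ hy.2.1).1
        have h4 : (v (y.1, 0)).1 = 0 := by
          rw [h]
          exact congrArg Prod.fst hv0
        simp only [hr]
        refine Prod.ext ?_ ?_
        · rw [Prod.fst_sub, h4, sub_zero, h2]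
          exact h3
        · rw [Prod.snd_sub]
          conv_lhs => rw [← h2]
          exact sub_self _
      · have h2 : y = (y.1, 0) := Prod.ext rfl h
        have h3 := (hguV _ hy.1.1).1
        have h4 : (v (0, y.2)).2 = 0 := by
          rw [h]
          exact congrArg Prod.snd hv0
        simp only [hr]
        refine Prod.ext ?_ ?_
        · rw [Prod.fst_sub]
          conv_lhs => rw [← h2]
          exact sub_self _
        · rw [Prod.snd_sub, h4, sub_zero, h2]
          exact h3
    have h5 := hdefect z hz
    rw [h1, _root_.map_zero] at h5
    exact sub_eq_zero.1 h5
  have hsymm2 : ∀ z ∈ P.target, (P.symm z).2 = 0 ↔ z.2 = 0 := by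
    intro z hz
    have h1 : gs (P.symm z).2 = z.2 := congrArg Prod.snd (P.right_inv hz)
    have hy := P.map_target hz
    rw [hPsrc] at hy
    rw [← h1]
    constructor
    · intro h
      rw [h, hgs0]
    · intro h
      exact gs.injOn hy.2.1 h0s (h.trans hgs0.symm)
  have hsymm1 : ∀ z ∈ P.target, (P.symm z).1 = 0 ↔ z.1 = 0 := by
    intro z hz
    have h1 : gu (P.symm z).1 = z.1 := congrArg Prod.fst (P.right_inv hz)
    have hy := P.map_target hz
    rw [hPsrc] at hy
    rw [← h1]
    constructor
    · intro h
      rw [h, hgu0]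
    · intro h
      exact gu.injOn hy.1.1 h0u (h.trans hgu0.symm)
  have hΘ : IsAdaptedChart V p lam (P.symm.trans Φ) := by
    refine ⟨by rw [hΘsrc]; exact h0Pt, ?_, hΘs.smooth, hΘs.smooth_symm, ?_, ?_, ?_⟩
    · change Φ (P.symm 0) = p
      rw [hPsymm0, hΦ.map_zero]
    · have hd : DifferentiableAt ℝ P.symm 0 :=
        (hPs'.contDiffAt (P.open_target.mem_nhds h0Pt)).differentiableAt (by simp)
      have hcont : ContinuousAt (fun z => fderiv ℝ P (P.symm z)) 0 := by
        have h1 : ContinuousAt (fderiv ℝ P) (P.symm 0) :=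
          (hPs.fderiv_of_isOpen P.open_source (m := ∞) le_rfl).continuousOn.continuousAt
            (P.open_source.mem_nhds (P.map_target h0Pt))
        exact h1.comp hd.continuousAt
      refine ((hrflat.comp_of_differentiableAt hd hPsymm0).clm_apply hcont).congr ?_
      filter_upwards [P.open_target.mem_nhds h0Pt] with z hz
      exact (hdefect z hz).symm
    · intro z hz
      rw [hΘsrc] at hz
      exact (hΦ.unstable _ (hsymmsrc z hz)).trans (hsymm2 z hz)
    · intro z hz
      rw [hΘsrc] at hz
      exact (hΦ.stable _ (hsymmsrc z hz)).trans (hsymm1 z hz)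
  refine ⟨A, B, P.symm.trans Φ, hAo, h0A, inter_subset_left, hBo, h0B, inter_subset_left, hAB,
    hΘsrc.trans hPtgt, ?_, hΘ, ?_, ?_⟩
  · intro x hx y hy
    change Φ (P.symm (P (x, y))) = _
    rw [P.left_inv (by rw [hPsrc]; exact ⟨hx, hy⟩)]
  · intro x hx
    rw [hΘsrc] at hx
    exact hcplane _ hx (Or.inr ((hsymm2 _ hx).2 rfl))
  · intro y hy
    rw [hΘsrc] at hy
    exact hcplane _ hy (Or.inl ((hsymm1 _ hy).2 rfl))

end InducedCoordinates

/-! ### The conjugating maps of an adapted chart -/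

section ConjugateFunctions

variable {k m : ℕ} {X : Type*} [TopologicalSpace X]
  [ChartedSpace (EuclideanSpace ℝ (Fin (k + m))) X] [IsManifold (𝓡 (k + m)) ∞ X]
  {V : (x : X) → TangentSpace (𝓡 (k + m)) x} {p : X} {lam : Fin (k + m) → ℝ}
  {Φ : OpenPartialHomeomorph (Coord k m) X}

theorem IsAdaptedChart.exists_conjugateStable (hΦ : IsAdaptedChart V p lam Φ)
    (hV : ContDiffOn ℝ ∞ (coordField V Φ) Φ.source)
    (hneg : ∀ j : Fin m, lam (Fin.natAdd k j) < 0) :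
    0 ∈ localStable V p Φ ∧ ∃ Ψ : EuclideanSpace ℝ (Fin m) → EuclideanSpace ℝ (Fin m),
      IsConjugateStable V p lam Φ Ψ ∧ Ψ 0 = 0 ∧
      (∀ y ∈ localStable V p Φ,
        ∃ g : OpenPartialHomeomorph (EuclideanSpace ℝ (Fin m)) (EuclideanSpace ℝ (Fin m)),
        y ∈ g.source ∧ g.source ⊆ localStable V p Φ ∧ EqOn Ψ g g.source ∧
        ContDiffOn ℝ ∞ g g.source ∧ ContDiffOn ℝ ∞ g.symm g.target) ∧
      ∀ y ∈ localStable V p Φ, (coordField V Φ (0, y)).1 = 0 ∧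
        fderiv ℝ Ψ y (coordField V Φ (0, y)).2 = stdStable lam (Ψ y) := by
  let i := ContinuousLinearMap.inr ℝ (EuclideanSpace ℝ (Fin k)) (EuclideanSpace ℝ (Fin m))
  let π := ContinuousLinearMap.snd ℝ (EuclideanSpace ℝ (Fin k)) (EuclideanSpace ℝ (Fin m))
  have hplane : ∀ z ∈ Φ.source, Φ z ∈ stableManifold V p ↔ i (π z) = z := fun z hz =>
    (hΦ.stable z hz).trans ⟨fun h => Prod.ext h.symm rfl, fun h => (congrArg Prod.fst h).symm⟩
  obtain ⟨h0, Ψ, hΨ0, hΨg, hΨd, hΨlim⟩ := hΦ.isSmoothChart.exists_conjugate_plane hneg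
    hΦ.zero_mem hΦ.map_zero (i := i) (π := π) (fun _ => rfl) hplane hV (B := stdFieldCLM lam)
    (fun _ => rfl) hΦ.flat
  refine ⟨h0, Ψ, fun y hy γ hγ => ?_, hΨ0, hΨg, fun y hy => ⟨?_, hΨd y hy⟩⟩
  · refine (tendsto_const_nhds.prodMk_nhds (hΨlim y hy γ hγ)).congr' ?_
    filter_upwards [eventually_ge_atTop 0] with t ht
    have h1 : (Φ.symm (γ t)).1 = 0 := (congrArg Prod.fst (hγ.symm_mem_plane hplane ht)).symm
    refine Prod.ext ?_ rfl
    ext j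
    simp [stdFlow, h1]
  · exact (congrArg Prod.fst
      (hΦ.isSmoothChart.coordField_mem_plane (i := i) (π := π) (fun _ => rfl) hplane hy.1)).symm

/-- The stable plane argument is applied to -V with rates -λ_i; backward lines of V are forward
lines of -V, and both signs cancel in F_T G_{-T} and in the conjugation equation. -/
theorem IsAdaptedChart.exists_conjugateUnstable (hΦ : IsAdaptedChart V p lam Φ)
    (hV : ContDiffOn ℝ ∞ (coordField V Φ) Φ.source)
    (hpos : ∀ i : Fin k, 0 < lam (Fin.castAdd m i)) :
    0 ∈ localUnstable V p Φ ∧ ∃ Ψ : EuclideanSpace ℝ (Fin k) → EuclideanSpace ℝ (Fin k),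
      IsConjugateUnstable V p lam Φ Ψ ∧ Ψ 0 = 0 ∧
      (∀ x ∈ localUnstable V p Φ,
        ∃ g : OpenPartialHomeomorph (EuclideanSpace ℝ (Fin k)) (EuclideanSpace ℝ (Fin k)),
        x ∈ g.source ∧ g.source ⊆ localUnstable V p Φ ∧ EqOn Ψ g g.source ∧
        ContDiffOn ℝ ∞ g g.source ∧ ContDiffOn ℝ ∞ g.symm g.target) ∧
      ∀ x ∈ localUnstable V p Φ, (coordField V Φ (x, 0)).2 = 0 ∧
        fderiv ℝ Ψ x (coordField V Φ (x, 0)).1 = stdUnstable lam (Ψ x) := by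
  let i := ContinuousLinearMap.inl ℝ (EuclideanSpace ℝ (Fin k)) (EuclideanSpace ℝ (Fin m))
  let π := ContinuousLinearMap.fst ℝ (EuclideanSpace ℝ (Fin k)) (EuclideanSpace ℝ (Fin m))
  have hplane : ∀ z ∈ Φ.source, Φ z ∈ stableManifold (fun x => -V x) p ↔ i (π z) = z :=
    fun z hz => (mem_unstableManifold_iff.symm.trans (hΦ.unstable z hz)).trans
      ⟨fun h => Prod.ext rfl h.symm, fun h => (congrArg Prod.snd h).symm⟩
  have hcf : coordField (fun x => -V x) Φ = fun z => -coordField V Φ z :=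
    funext fun z => coordField_neg V Φ z
  have hB : ∀ x, π ((-stdFieldCLM lam) (i x)) = euclDiag (fun j => -lam (Fin.castAdd m j)) x := by
    intro x
    ext j
    simp [π, i, stdFieldCLM]
  have hflat : IsFlat fun z => coordField (fun x => -V x) Φ z - (-stdFieldCLM lam) z := by
    have h1 : IsFlat fun z => coordField V Φ z - stdFieldCLM lam z := hΦ.flat
    refine (h1.clm_apply (A := fun _ => -ContinuousLinearMap.id ℝ (Coord k m))
      continuousAt_const).congr (Eventually.of_forall fun z => ?_)
    simp [hcf, sub_eq_add_neg, add_comm]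
  obtain ⟨h0, Ψ, hΨ0, hΨg, hΨd, hΨlim⟩ := hΦ.isSmoothChart.exists_conjugate_plane
    (mu := fun j => -lam (Fin.castAdd m j)) (fun j => neg_neg_of_pos (hpos j))
    hΦ.zero_mem hΦ.map_zero (i := i) (π := π) (fun _ => rfl) hplane (by rw [hcf]; exact hV.neg)
    hB hflat
  rw [localUnstable_eq_localStablePlane]
  refine ⟨h0, Ψ, fun x hx γ hγ => ?_, hΨ0, hΨg, fun x hx => ⟨?_, ?_⟩⟩
  · rw [localUnstable_eq_localStablePlane] at hx
    have hγ' := isUnstableLine_iff.1 hγ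
    refine ((hΨlim x hx _ hγ').prodMk_nhds tendsto_const_nhds).congr' ?_
    filter_upwards [eventually_ge_atTop 0] with t ht
    have h1 : (Φ.symm (γ (-t))).2 = 0 :=
      (congrArg Prod.snd (hγ'.symm_mem_plane hplane ht)).symm
    refine Prod.ext ?_ ?_
    · ext j
      simp [stdFlow, euclExp, π]
    · ext j
      simp [stdFlow, h1]
  · have h1 := congrArg Prod.snd
      (hΦ.isSmoothChart.coordField_mem_plane (i := i) (π := π) (fun _ => rfl) hplane hx.1)
    rw [hcf] at h1
    exact neg_eq_zero.1 h1.symm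
  · have h1 := hΨd x hx
    rw [hcf] at h1
    have h2 : fderiv ℝ Ψ x (-(coordField V Φ (x, 0)).1) = -stdUnstable lam (Ψ x) := by
      refine h1.trans ?_
      ext j
      simp [stdUnstable]
    rwa [_root_.map_neg, neg_inj] at h2

end ConjugateFunctions

theorem mainTheorem4 {k m : ℕ} {X : Type*} [TopologicalSpace X] [T2Space X]
    [ChartedSpace (EuclideanSpace ℝ (Fin (k + m))) X] [IsManifold (𝓡 (k + m)) ∞ X]
    (g : SmoothMetric (k + m) X) (f : X → ℝ) (hf : ContMDiff (𝓡 (k + m)) 𝓘(ℝ, ℝ) ∞ f)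
    (p : X) (hp : riemGradient g f p = 0)
    (lam : Fin (k + m) → ℝ) (hlam : IsMorseEigenvalues g f p lam) (hN : NLinearity lam)
    (hpos : ∀ i : Fin k, 0 < lam (Fin.castAdd m i))
    (hneg : ∀ j : Fin m, lam (Fin.natAdd k j) < 0) :
    -- there are coordinates in which the conjugate functions are defined
    (∃ Φ : OpenPartialHomeomorph (Coord k m) X, IsAdaptedChart (riemGradient g f) p lam Φ) ∧
    -- and in all such coordinates they have the following properties
    ∀ Φ : OpenPartialHomeomorph (Coord k m) X, IsAdaptedChart (riemGradient g f) p lam Φ →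
      -- `W^u`, `W^s` are open neighbourhoods of `p` in the unstable and stable submanifolds
      IsOpen (localUnstable (riemGradient g f) p Φ) ∧ 0 ∈ localUnstable (riemGradient g f) p Φ ∧
      IsOpen (localStable (riemGradient g f) p Φ) ∧ 0 ∈ localStable (riemGradient g f) p Φ ∧
      ∃ (Ψu : EuclideanSpace ℝ (Fin k) → EuclideanSpace ℝ (Fin k))
        (Ψs : EuclideanSpace ℝ (Fin m) → EuclideanSpace ℝ (Fin m)),
        -- the limits exist
        IsConjugateUnstable (riemGradient g f) p lam Φ Ψu ∧
        IsConjugateStable (riemGradient g f) p lam Φ Ψs ∧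
        -- they are smooth local diffeomorphisms fixing the critical point
        IsLocalDiffeomorphOn 𝓘(ℝ, EuclideanSpace ℝ (Fin k)) 𝓘(ℝ, EuclideanSpace ℝ (Fin k)) ∞ Ψu
          (localUnstable (riemGradient g f) p Φ) ∧
        IsLocalDiffeomorphOn 𝓘(ℝ, EuclideanSpace ℝ (Fin m)) 𝓘(ℝ, EuclideanSpace ℝ (Fin m)) ∞ Ψs
          (localStable (riemGradient g f) p Φ) ∧
        Ψu 0 = 0 ∧ Ψs 0 = 0 ∧
        -- `V` is tangent to `W^u` and `W^s`, and `Ψ_u`, `Ψ_s` carry it to `V₀` there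
        (∀ x ∈ localUnstable (riemGradient g f) p Φ,
          (coordField (riemGradient g f) Φ (x, 0)).2 = 0 ∧
          fderiv ℝ Ψu x (coordField (riemGradient g f) Φ (x, 0)).1 = stdUnstable lam (Ψu x)) ∧
        (∀ y ∈ localStable (riemGradient g f) p Φ,
          (coordField (riemGradient g f) Φ (0, y)).1 = 0 ∧
          fderiv ℝ Ψs y (coordField (riemGradient g f) Φ (0, y)).2 = stdStable lam (Ψs y)) ∧
        -- the coordinates `Θ(Ψ_u(x), Ψ_s(y)) = Φ(x, y)` induced by `Ψ_u` and `Ψ_s`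
        ∃ (A : Set (EuclideanSpace ℝ (Fin k))) (B : Set (EuclideanSpace ℝ (Fin m)))
          (Θ : OpenPartialHomeomorph (Coord k m) X),
          IsOpen A ∧ 0 ∈ A ∧ A ⊆ localUnstable (riemGradient g f) p Φ ∧
          IsOpen B ∧ 0 ∈ B ∧ B ⊆ localStable (riemGradient g f) p Φ ∧
          A ×ˢ B ⊆ Φ.source ∧
          Θ.source = (Ψu '' A) ×ˢ (Ψs '' B) ∧
          (∀ x ∈ A, ∀ y ∈ B, Θ (Ψu x, Ψs y) = Φ (x, y)) ∧
          IsAdaptedChart (riemGradient g f) p lam Θ ∧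
          (∀ x, (x, 0) ∈ Θ.source →
            coordField (riemGradient g f) Θ (x, 0) = stdField lam (x, 0)) ∧
          (∀ y, (0, y) ∈ Θ.source →
            coordField (riemGradient g f) Θ (0, y) = stdField lam (0, y)) := by
  refine ⟨exists_isAdaptedChart g hf hp hlam hN hpos hneg, fun Φ hΦ => ?_⟩
  have hV := contDiffOn_coordField_riemGradient hΦ.isSmoothChart g hf
  obtain ⟨h0u, Ψu, hu, hu0, hug, huV⟩ := hΦ.exists_conjugateUnstable hV hpos
  obtain ⟨h0s, Ψs, hs, hs0, hsg, hsV⟩ := hΦ.exists_conjugateStable hV hneg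
  refine ⟨isOpen_of_forall_exists_chart hug, h0u, isOpen_of_forall_exists_chart hsg, h0s, Ψu, Ψs,
    hu, hs, isLocalDiffeomorphOn_of_forall_exists hug, isLocalDiffeomorphOn_of_forall_exists hsg,
    hu0, hs0, huV, hsV, ?_⟩
  -- Near 0 the maps Ψ_u and Ψ_s coincide with invertible branches, so Θ can be a genuine chart
  -- there, although Ψ_u and Ψ_s are only known to be local diffeomorphisms on W^u and W^s.
  obtain ⟨gu, h0gu, hguW, hguΨ, hgu, hgu'⟩ := hug 0 h0u
  obtain ⟨gs, h0gs, hgsW, hgsΨ, hgs, hgs'⟩ := hsg 0 h0s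
  have hgud : ∀ x ∈ gu.source, (coordField (riemGradient g f) Φ (x, 0)).2 = 0 ∧
      fderiv ℝ gu x (coordField (riemGradient g f) Φ (x, 0)).1 = stdUnstable lam (gu x) := by
    intro x hx
    rw [← (hguΨ.eventuallyEq_of_mem (gu.open_source.mem_nhds hx)).fderiv_eq, ← hguΨ hx]
    exact huV x (hguW hx)
  have hgsd : ∀ y ∈ gs.source, (coordField (riemGradient g f) Φ (0, y)).1 = 0 ∧
      fderiv ℝ gs y (coordField (riemGradient g f) Φ (0, y)).2 = stdStable lam (gs y) := by
    intro y hy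
    rw [← (hgsΨ.eventuallyEq_of_mem (gs.open_source.mem_nhds hy)).fderiv_eq, ← hgsΨ hy]
    exact hsV y (hgsW hy)
  obtain ⟨A, B, Θ, hA, h0A, hAu, hB, h0B, hBs, hAB, hΘsrc, hΘ, hΘadapted, hΘu, hΘs⟩ :=
    exists_induced_coordinates hΦ h0gu ((hguΨ h0gu).symm.trans hu0) hgu hgu' hgud
      h0gs ((hgsΨ h0gs).symm.trans hs0) hgs hgs' hgsd
  refine ⟨A, B, Θ, hA, h0A, hAu.trans hguW, hB, h0B, hBs.trans hgsW, hAB, ?_, ?_, hΘadapted,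
    hΘu, hΘs⟩
  · rw [hΘsrc, image_congr (hguΨ.mono hAu), image_congr (hgsΨ.mono hBs)]
  · intro x hx y hy
    rw [hguΨ (hAu hx), hgsΨ (hBs hy)]
    exact hΘ x hx y hy
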